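/- **Setting.** Let $N\in\{1,2,3\}$, let $D\subset\mathbb R^N$ be open and bounded with Lipschitz boundary and surface measure $\sigma$, and let $f\in W^{1,\infty}(\mathbb R)$ satisfy $f(0)=f(1)=0$ and $f\ge 0$ on $(0,1)$. Spaces $W^{1,p}(D)$ carry the norm $\|u\|_{L^p}+\|\nabla u\|_{L^p}$. Fix a bound $M$. For $T>0$ consider two problems, with flux $J=-\nabla u+f(u)\nabla V$. *Problem 1*: $\partial_t u+\nabla\cdot J=\alpha f(u)-\beta u$ in $(0,T)\times D$, $J\cdot n=0$ on $\partial D$, $u(0)=u^0$. The data $\xi=(\alpha,\beta,V,u^0)$ lie in $\mathcal X=L^\infty((0,T)\times D)^2\times L^\infty((0,T);W^{1,\infty}(D))\times L^2(D)$ with the metric $d(\xi_1,\xi_2)=\|\alpha_1-\alpha_2\|_{L^\infty}+\|\beta_1-\beta_2\|_{L^\infty}+\|V_1-V_2\|_{L^\infty(W^{1,\infty})}+\|u^0_1-u^0_2\|_{L^2}$. A datum is admissible if $\alpha\ge\alpha_0$ and $\beta\ge\beta_0$ a.e. for some $\alpha_0,\beta_0>0$, $0\le u^0\le1$ a.e.,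 and $\|\alpha\|,\|\beta\|,\|V\|\le M$. *Problem 2*: let $\Gamma_{\rm in},\Gamma_{\rm out}\subset\partial D$ be relatively open and disjoint with $\Gamma_{\rm out}\neq\emptyset$, and let $g\in W^{1,\infty}(\mathbb R)$ be decreasing with $g(0)=1$, $g(1)=0$. The problem is $\partial_t u+\nabla\cdot J=0$ in $(0,T)\times D$, $-J\cdot n=a\,g(u)$ on $\Gamma_{\rm in}$, $J\cdot n=b\,u$ on $\Gamma_{\rm out}$, $J\cdot n=0$ on the rest of $\partial D$, $u(0)=u^0$. The data $\xi=(a,b,V,u^0)$ lie in $\mathcal X=L^\infty((0,T)\times\Gamma_{\rm in})\times L^\infty((0,T)\times\Gamma_{\rm out})\times L^2((0,T);W^{1,\infty}(D))\times L^2(D)$ with the metric $d$ given by the sum of the four norms of the differences. A datum is admissible if $a_0\le a\le1$ and $b_0\le b\le1$ a.e. for some $a_0,b_0>0$, $0\le u^0\le1$ a.e., $V(t)$ is (weakly) harmonic in $D$ for a.e. $t$, and $\|V\|\le M$. A *weak solution* is $u\in L^2((0,T);H^1(D))$ with $\partial_tu\in L^2((0,T);H^1(D)^*)$, whose continuous representative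 in $C([0,T];L^2(D))$ equals $u^0$ at $t=0$, such that for a.e. $t$ and all $\varphi\in H^1(D)$ $$\langle\partial_tu,\varphi\rangle-\int_D J\cdot\nabla\varphi\,dx+\int_D\beta u\varphi\,dx-\int_D\alpha f(u)\varphi\,dx=0\quad\text{(Problem 1)},$$ $$\langle\partial_tu,\varphi\rangle-\int_D J\cdot\nabla\varphi\,dx+\int_{\Gamma_{\rm out}}b\,u\varphi\,d\sigma=\int_{\Gamma_{\rm in}}a\,g(u)\varphi\,d\sigma\quad\text{(Problem 2)},$$ boundary values being traces. Let $\Xi$ be the set of all $u\in L^2((0,T);H^1(D))$ with $\partial_tu\in L^2((0,T);H^1(D)^*)$. *Distances.* On $\mathcal X$ (with its Borel $\sigma$-algebra) let $\mathcal F_t$ be the $\sigma$-algebra generated by the values up to time $t$ of $(\alpha,\beta,V)$, resp. of $(a,b,V)$ (for classes of functions: by their integrals over measurable sets of points with time coordinate $\le t$). For probability measures $P,\tilde P$ on $\mathcal X$ let $$\mathrm{nd}_2(P,\tilde P)^2=\inf_\pi\iint d(\xi,\tilde\xi)^2\,\pi(d\xi,d\tilde\xi),$$ the infimum being over all couplings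 $\pi$ of $P$ and $\tilde P$ such that for all $t\in[0,T]$ and all measurable $A,B$, $\pi$-a.s., $\pi(A\times\mathcal X\mid\mathcal F_t\otimes\mathcal F_t)=P(A\mid\mathcal F_t)$ and $\pi(\mathcal X\times B\mid\mathcal F_t\otimes\mathcal F_t)=\tilde P(B\mid\mathcal F_t)$. For $t'<t$ let $P_t^{|\mathcal F_{t'}}$ be the regular conditional law of $P$ given $\mathcal F_{t'}$, restricted to $\mathcal F_t$. Let $d_r$ be the Wasserstein distance of order $r$ between such laws for the distance given by the part of $d$ accumulated during $(t',t)$, i.e. the sum of the three norms of the differences of the time-dependent data, taken over the time interval $(t',t)$ only. **Theorem (Gluing theorem).** For Problem 1, and likewise for Problem 2 (for all $\Gamma_{\rm in},\Gamma_{\rm out},g$ as above), there are constants $C,\tilde C>0$, depending only on $D$, $f$, $M$ (and on $\Gamma_{\rm in},\Gamma_{\rm out},g$ for Problem 2), such that the following holds for all $T>0$. Let $P,\tilde P$ be probability measures on $\mathcal X$ which are concentrated on admissible data, and let $\mathcal S$, $\tilde{\mathcal S}$ assign to $P$-almost every, resp. $\tilde P$-almost every, datum $\xi$ a weak solution with data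 $\xi$ (in particular $\mathcal S=\tilde{\mathcal S}$ may be the solution operator). Let $\Phi$ be a real function that is Lipschitz on $\Xi$ with constant $L_\Phi$ for the norm of $L^2((0,T);H^1(D))$. Suppose that for some $r\ge1$ and $C_H>0$ $$d_r\big(P_t^{|\mathcal F_{t'}},\tilde P_t^{|\mathcal F_{t'}}\big)^r\le C_H\,|t'-t|\quad\text{a.s. (with respect to } P\otimes\tilde P),\ \text{ for all }0\le t'<t\le T,$$ for suitable versions of the regular conditional laws. Then $\Phi(\mathcal S)$ and $\Phi(\tilde{\mathcal S})$ are integrable with respect to $P$ and $\tilde P$, respectively, and $$\big|\mathbb E_P\Phi(\mathcal S)-\mathbb E_{\tilde P}\Phi(\tilde{\mathcal S})\big|\le L_\Phi\,C\,\max\big(1,\sqrt{C_HT}\big)\,e^{\tilde C T/2}\;\mathrm{nd}_2(P,\tilde P).$$ -/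

import Mathlib

open Set Filter Topology MeasureTheory ProbabilityTheory
open scoped NNReal ENNReal RealInnerProductSpace

noncomputable section

namespace DriftDiffusion

/-! ### Domains, Lebesgue and surface measure -/

/-- Euclidean space `ℝ^N`. -/
abbrev Euc (N : ℕ) := EuclideanSpace ℝ (Fin N)

/-- `D` has a Lipschitz boundary: near every boundary point, after a choice of a "vertical" unit
vector `ν`, the set `D` is the strict epigraph of a Lipschitz function of the coordinates
orthogonal to `ν`. -/
def IsLipschitzDomain {N : ℕ} (D : Set (Euc N)) : Prop :=
  ∀ x₀ ∈ frontier D, ∃ ν : Euc N, ‖ν‖ = 1 ∧ ∃ (K : ℝ≥0) (γ : Euc N → ℝ), LipschitzWith K γ ∧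
    ∃ ρ > 0, ∀ x ∈ Metric.ball x₀ ρ, (x ∈ D ↔ γ (x - ⟪ν, x⟫ • ν) < ⟪ν, x⟫)

/-- Lebesgue measure on the time interval `(0, T)`. -/
abbrev timeMeasure (T : ℝ) : Measure ℝ := volume.restrict (Ioo 0 T)

/-- Lebesgue measure on `D`. -/
abbrev domMeasure {N : ℕ} (D : Set (Euc N)) : Measure (Euc N) := volume.restrict D

/-- The surface measure `σ` on `∂D`: the `(N-1)`-dimensional Hausdorff measure, normalised so as
to agree with Lebesgue measure on hyperplanes, restricted to `∂D`. -/
abbrev surfMeasure {N : ℕ} (D : Set (Euc N)) : Measure (Euc N) :=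
  (Measure.euclideanHausdorffMeasure (N - 1)).restrict (frontier D)

/-! ### Sobolev spaces -/

/-- `G` is the weak gradient of `u` in `D`. -/
def IsWeakGradient {N : ℕ} (D : Set (Euc N)) (u : Euc N → ℝ) (G : Euc N → Euc N) : Prop :=
  ∀ φ : Euc N → ℝ, ContDiff ℝ (⊤ : ℕ∞) φ → HasCompactSupport φ → tsupport φ ⊆ D → ∀ v : Euc N,
    ∫ x, u x * fderiv ℝ φ x v ∂(domMeasure D) = - ∫ x, φ x * ⟪G x, v⟫ ∂(domMeasure D)

lemma integrable_mul_test {N : ℕ} {D : Set (Euc N)} {p : ℝ≥0∞} [hp : Fact (1 ≤ p)]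
    (u : Lp ℝ p (domMeasure D)) {ψ : Euc N → ℝ} (hψ : Continuous ψ) (hs : HasCompactSupport ψ) :
    Integrable (fun x => u x * ψ x) (domMeasure D) := by
  have h := ((Lp.memLp u).locallyIntegrable hp.out).integrable_smul_left_of_hasCompactSupport hψ hs
  refine h.congr (Eventually.of_forall fun x => ?_)
  simp [mul_comm]

lemma integrable_test_inner {N : ℕ} {D : Set (Euc N)} {p : ℝ≥0∞} [hp : Fact (1 ≤ p)]
    (G : Lp (Euc N) p (domMeasure D)) {ψ : Euc N → ℝ} (hψ : Continuous ψ)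
    (hs : HasCompactSupport ψ) (v : Euc N) :
    Integrable (fun x => ψ x * ⟪G x, v⟫) (domMeasure D) := by
  have h := ((Lp.memLp G).locallyIntegrable hp.out).integrable_smul_left_of_hasCompactSupport hψ hs
  refine (h.inner_const (𝕜 := ℝ) v).congr (Eventually.of_forall fun x => ?_)
  simp [real_inner_smul_left]

lemma continuous_fderiv_apply_test {N : ℕ} {φ : Euc N → ℝ} (hφ : ContDiff ℝ (⊤ : ℕ∞) φ) (v : Euc N) :
    Continuous fun x => fderiv ℝ φ x v :=
  (hφ.continuous_fderiv (by simp)).clm_apply continuous_const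

/-- The Sobolev space `W^{1,p}(D)`, realised as the space of pairs `(u, ∇u)` in
`L^p(D) × L^p(D; ℝ^N)`, with norm `‖u‖_{L^p} + ‖∇u‖_{L^p}`. -/
def sobolev {N : ℕ} (D : Set (Euc N)) (p : ℝ≥0∞) [Fact (1 ≤ p)] :
    Submodule ℝ (WithLp 1 (Lp ℝ p (domMeasure D) × Lp (Euc N) p (domMeasure D))) where
  carrier := {w | IsWeakGradient D w.fst w.snd}
  zero_mem' := by
    intro φ hφ hc hs v
    have h1 : (fun x => (0 : Lp ℝ p (domMeasure D)) x * fderiv ℝ φ x v)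
        =ᵐ[domMeasure D] fun _ => (0 : ℝ) := by
      filter_upwards [Lp.coeFn_zero ℝ p (domMeasure D)] with x hx
      rw [hx, Pi.zero_apply, zero_mul]
    have h2 : (fun x => φ x * ⟪(0 : Lp (Euc N) p (domMeasure D)) x, v⟫)
        =ᵐ[domMeasure D] fun _ => (0 : ℝ) := by
      filter_upwards [Lp.coeFn_zero (Euc N) p (domMeasure D)] with x hx
      rw [hx, Pi.zero_apply, inner_zero_left, mul_zero]
    change ∫ x, (0 : Lp ℝ p (domMeasure D)) x * fderiv ℝ φ x v ∂(domMeasure D)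
      = - ∫ x, φ x * ⟪(0 : Lp (Euc N) p (domMeasure D)) x, v⟫ ∂(domMeasure D)
    rw [integral_congr_ae h1, integral_congr_ae h2]
    simp
  add_mem' := by
    intro a b ha hb φ hφ hc hs v
    have h1 : (fun x => (a.fst + b.fst) x * fderiv ℝ φ x v)
        =ᵐ[domMeasure D] fun x => a.fst x * fderiv ℝ φ x v + b.fst x * fderiv ℝ φ x v := by
      filter_upwards [Lp.coeFn_add a.fst b.fst] with x hx
      rw [hx, Pi.add_apply, add_mul]
    have h2 : (fun x => φ x * ⟪(a.snd + b.snd) x, v⟫)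
        =ᵐ[domMeasure D] fun x => φ x * ⟪a.snd x, v⟫ + φ x * ⟪b.snd x, v⟫ := by
      filter_upwards [Lp.coeFn_add a.snd b.snd] with x hx
      rw [hx, Pi.add_apply, inner_add_left, mul_add]
    have hc' : HasCompactSupport fun x => fderiv ℝ φ x v := hc.fderiv_apply (𝕜 := ℝ) v
    have hφ' := continuous_fderiv_apply_test hφ v
    change ∫ x, (a.fst + b.fst) x * fderiv ℝ φ x v ∂(domMeasure D)
      = - ∫ x, φ x * ⟪(a.snd + b.snd) x, v⟫ ∂(domMeasure D)
    rw [integral_congr_ae h1, integral_congr_ae h2,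
      integral_add (integrable_mul_test _ hφ' hc') (integrable_mul_test _ hφ' hc'),
      integral_add (integrable_test_inner _ hφ.continuous hc v)
        (integrable_test_inner _ hφ.continuous hc v), ha φ hφ hc hs v, hb φ hφ hc hs v]
    ring
  smul_mem' := by
    intro c a ha φ hφ hc hs v
    have h1 : (fun x => (c • a.fst) x * fderiv ℝ φ x v)
        =ᵐ[domMeasure D] fun x => c * (a.fst x * fderiv ℝ φ x v) := by
      filter_upwards [Lp.coeFn_smul c a.fst] with x hx
      rw [hx, Pi.smul_apply, smul_eq_mul, mul_assoc]
    have h2 : (fun x => φ x * ⟪(c • a.snd) x, v⟫)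
        =ᵐ[domMeasure D] fun x => c * (φ x * ⟪a.snd x, v⟫) := by
      filter_upwards [Lp.coeFn_smul c a.snd] with x hx
      rw [hx, Pi.smul_apply, real_inner_smul_left]
      ring
    change ∫ x, (c • a.fst) x * fderiv ℝ φ x v ∂(domMeasure D)
      = - ∫ x, φ x * ⟪(c • a.snd) x, v⟫ ∂(domMeasure D)
    rw [integral_congr_ae h1, integral_congr_ae h2, integral_const_mul, integral_const_mul,
      ha φ hφ hc hs v]
    ring

/-- The Sobolev space `W^{1,p}(D)` as a normed space. -/
abbrev W1 {N : ℕ} (D : Set (Euc N)) (p : ℝ≥0∞) [Fact (1 ≤ p)] := ↥(sobolev D p)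

/-- The function underlying an element of `W^{1,p}(D)`. -/
abbrev val {N : ℕ} {D : Set (Euc N)} {p : ℝ≥0∞} [Fact (1 ≤ p)] (u : W1 D p) :
    Lp ℝ p (domMeasure D) := u.1.fst

/-- The weak gradient of an element of `W^{1,p}(D)`. -/
abbrev grad {N : ℕ} {D : Set (Euc N)} {p : ℝ≥0∞} [Fact (1 ≤ p)] (u : W1 D p) :
    Lp (Euc N) p (domMeasure D) := u.1.snd

/-- The space `H¹(D)`. -/
abbrev H1 {N : ℕ} (D : Set (Euc N)) := W1 D 2

/-- The dual space `H¹(D)*`. -/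
abbrev H1Dual {N : ℕ} (D : Set (Euc N)) := H1 D →L[ℝ] ℝ

/-- `v ∈ L²(∂D)` is the trace of `u ∈ H¹(D)`: some functions smooth up to the boundary converge to
`u` in `H¹(D)` while their boundary values converge to `v` in `L²(∂D)`. On a bounded Lipschitz
domain every `u ∈ H¹(D)` has exactly one trace. -/
def IsTrace {N : ℕ} (D : Set (Euc N)) (u : H1 D) (v : Lp ℝ 2 (surfMeasure D)) : Prop :=
  ∃ w : ℕ → Euc N → ℝ, (∀ n, ContDiff ℝ (⊤ : ℕ∞) (w n)) ∧
    Tendsto (fun n => eLpNorm (fun x => w n x - val u x) 2 (domMeasure D)) atTop (𝓝 0) ∧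
    Tendsto (fun n => eLpNorm (fun x => gradient (w n) x - grad u x) 2 (domMeasure D))
      atTop (𝓝 0) ∧
    Tendsto (fun n => eLpNorm (fun x => w n x - v x) 2 (surfMeasure D)) atTop (𝓝 0)

/-! ### Evolution spaces -/

/-- The Bochner space `L²((0,T); H¹(D))`. -/
abbrev L2H1 {N : ℕ} (D : Set (Euc N)) (T : ℝ) := Lp (H1 D) 2 (timeMeasure T)

/-- `w ∈ L²((0,T); H¹(D)*)` is the distributional time derivative `∂ₜu`, where `L²(D)` is
embedded in `H¹(D)*` through the `L²(D)` inner product. -/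
def IsTimeDeriv {N : ℕ} {D : Set (Euc N)} {T : ℝ} (u : L2H1 D T)
    (w : Lp (H1Dual D) 2 (timeMeasure T)) : Prop :=
  ∀ (φ : H1 D) (η : ℝ → ℝ), ContDiff ℝ (⊤ : ℕ∞) η → HasCompactSupport η → tsupport η ⊆ Ioo 0 T →
    ∫ t, deriv η t * (∫ x, val (u t) x * val φ x ∂(domMeasure D)) ∂(timeMeasure T)
      = - ∫ t, η t * w t φ ∂(timeMeasure T)

/-- The solution space: all `u ∈ L²((0,T); H¹(D))` with `∂ₜu ∈ L²((0,T); H¹(D)*)`. -/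
def solutionSpace {N : ℕ} (D : Set (Euc N)) (T : ℝ) : Set (L2H1 D T) :=
  {u | ∃ w : Lp (H1Dual D) 2 (timeMeasure T), IsTimeDeriv u w}

/-- The continuous representative of `u` in `C([0,T]; L²(D))` starts at `u₀`. -/
def HasInitialValue {N : ℕ} {D : Set (Euc N)} {T : ℝ} (u : L2H1 D T)
    (u₀ : Lp ℝ 2 (domMeasure D)) : Prop :=
  ∃ U : ℝ → Lp ℝ 2 (domMeasure D), ContinuousOn U (Icc 0 T) ∧ U 0 = u₀ ∧
    ∀ᵐ t ∂(timeMeasure T), U t = val (u t)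

/-! ### The nonlinearities -/

/-- The mobility: `f ∈ W^{1,∞}(ℝ)`, `f(0) = f(1) = 0` and `f ≥ 0` on `(0,1)`. -/
structure IsMobility (f : ℝ → ℝ) : Prop where
  bounded : ∃ B, ∀ s, |f s| ≤ B
  lipschitz : ∃ K, LipschitzWith K f
  zero : f 0 = 0
  one : f 1 = 0
  nonneg : ∀ s ∈ Ioo (0 : ℝ) 1, 0 ≤ f s

/-- The inflow limiter: `g ∈ W^{1,∞}(ℝ)` is decreasing with `g(0) = 1` and `g(1) = 0`. -/
structure IsInflowLimiter (g : ℝ → ℝ) : Prop where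
  bounded : ∃ B, ∀ s, |g s| ≤ B
  lipschitz : ∃ K, LipschitzWith K g
  antitone : Antitone g
  zero : g 0 = 1
  one : g 1 = 0

/-! ### The data spaces -/

/-- Data `(α, β, V, u⁰)` of the problem with reaction terms. -/
structure Data1 {N : ℕ} (D : Set (Euc N)) (T : ℝ) where
  /-- the creation rate `α ∈ L^∞((0,T) × D)` -/
  α : Lp ℝ ∞ ((timeMeasure T).prod (domMeasure D))
  /-- the removal rate `β ∈ L^∞((0,T) × D)` -/
  β : Lp ℝ ∞ ((timeMeasure T).prod (domMeasure D))
  /-- the potential `V ∈ L^∞((0,T); W^{1,∞}(D))` -/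
  V : Lp (W1 D ∞) ∞ (timeMeasure T)
  /-- the initial value `u⁰ ∈ L²(D)` -/
  u₀ : Lp ℝ 2 (domMeasure D)

/-- Data `(a, b, V, u⁰)` of the problem with in- and outflow through the boundary. -/
structure Data2 {N : ℕ} (D Γin Γout : Set (Euc N)) (T : ℝ) where
  /-- the inflow rate `a ∈ L^∞((0,T) × Γ_in)` -/
  a : Lp ℝ ∞ ((timeMeasure T).prod ((surfMeasure D).restrict Γin))
  /-- the outflow rate `b ∈ L^∞((0,T) × Γ_out)` -/
  b : Lp ℝ ∞ ((timeMeasure T).prod ((surfMeasure D).restrict Γout))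
  /-- the potential `V ∈ L²((0,T); W^{1,∞}(D))` -/
  V : Lp (W1 D ∞) 2 (timeMeasure T)
  /-- the initial value `u⁰ ∈ L²(D)` -/
  u₀ : Lp ℝ 2 (domMeasure D)

/-- The product of the norm topologies. -/
instance {N : ℕ} (D : Set (Euc N)) (T : ℝ) : TopologicalSpace (Data1 D T) :=
  TopologicalSpace.induced (fun ξ => (ξ.α, ξ.β, ξ.V, ξ.u₀)) inferInstance

/-- The product of the norm topologies. -/
instance {N : ℕ} (D Γin Γout : Set (Euc N)) (T : ℝ) : TopologicalSpace (Data2 D Γin Γout T) :=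
  TopologicalSpace.induced (fun ξ => (ξ.a, ξ.b, ξ.V, ξ.u₀)) inferInstance

/-- The Borel σ-algebra. -/
instance {N : ℕ} (D : Set (Euc N)) (T : ℝ) : MeasurableSpace (Data1 D T) := borel _

/-- The Borel σ-algebra. -/
instance {N : ℕ} (D Γin Γout : Set (Euc N)) (T : ℝ) : MeasurableSpace (Data2 D Γin Γout T) :=
  borel _

instance {N : ℕ} (D : Set (Euc N)) (T : ℝ) : BorelSpace (Data1 D T) := ⟨rfl⟩

instance {N : ℕ} (D Γin Γout : Set (Euc N)) (T : ℝ) : BorelSpace (Data2 D Γin Γout T) := ⟨rfl⟩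

/-- The distance `‖α₁-α₂‖ + ‖β₁-β₂‖ + ‖V₁-V₂‖ + ‖u⁰₁-u⁰₂‖` of two data. -/
def dist1 {N : ℕ} {D : Set (Euc N)} {T : ℝ} (ξ η : Data1 D T) : ℝ≥0∞ :=
  ‖ξ.α - η.α‖ₑ + ‖ξ.β - η.β‖ₑ + ‖ξ.V - η.V‖ₑ + ‖ξ.u₀ - η.u₀‖ₑ

/-- The distance `‖a₁-a₂‖ + ‖b₁-b₂‖ + ‖V₁-V₂‖ + ‖u⁰₁-u⁰₂‖` of two data. -/
def dist2 {N : ℕ} {D Γin Γout : Set (Euc N)} {T : ℝ} (ξ η : Data2 D Γin Γout T) : ℝ≥0∞ :=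
  ‖ξ.a - η.a‖ₑ + ‖ξ.b - η.b‖ₑ + ‖ξ.V - η.V‖ₑ + ‖ξ.u₀ - η.u₀‖ₑ

/-- The part of the distance `dist1` which is accumulated during the time interval `(s, t)`. -/
def segDist1 {N : ℕ} {D : Set (Euc N)} {T : ℝ} (s t : ℝ) (ξ η : Data1 D T) : ℝ≥0∞ :=
  eLpNorm ⇑(ξ.α - η.α) ∞ (((timeMeasure T).prod (domMeasure D)).restrict (Ioo s t ×ˢ univ)) +
  eLpNorm ⇑(ξ.β - η.β) ∞ (((timeMeasure T).prod (domMeasure D)).restrict (Ioo s t ×ˢ univ)) +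
  eLpNorm ⇑(ξ.V - η.V) ∞ ((timeMeasure T).restrict (Ioo s t))

/-- The part of the distance `dist2` which is accumulated during the time interval `(s, t)`. -/
def segDist2 {N : ℕ} {D Γin Γout : Set (Euc N)} {T : ℝ} (s t : ℝ) (ξ η : Data2 D Γin Γout T) :
    ℝ≥0∞ :=
  eLpNorm ⇑(ξ.a - η.a) ∞
    (((timeMeasure T).prod ((surfMeasure D).restrict Γin)).restrict (Ioo s t ×ˢ univ)) +
  eLpNorm ⇑(ξ.b - η.b) ∞
    (((timeMeasure T).prod ((surfMeasure D).restrict Γout)).restrict (Ioo s t ×ˢ univ)) +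
  eLpNorm ⇑(ξ.V - η.V) 2 ((timeMeasure T).restrict (Ioo s t))

/-- Data which satisfy the standing hypotheses of the first problem and which are bounded by
`M`. -/
structure Admissible1 {N : ℕ} {D : Set (Euc N)} {T : ℝ} (M : ℝ) (ξ : Data1 D T) : Prop where
  α_pos : ∃ α₀ > 0, ∀ᵐ z ∂((timeMeasure T).prod (domMeasure D)), α₀ ≤ ξ.α z
  β_pos : ∃ β₀ > 0, ∀ᵐ z ∂((timeMeasure T).prod (domMeasure D)), β₀ ≤ ξ.β z
  u₀_mem : ∀ᵐ x ∂(domMeasure D), 0 ≤ ξ.u₀ x ∧ ξ.u₀ x ≤ 1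
  α_le : ‖ξ.α‖ ≤ M
  β_le : ‖ξ.β‖ ≤ M
  V_le : ‖ξ.V‖ ≤ M

/-- Data which satisfy the standing hypotheses of the second problem and which are bounded by
`M`. -/
structure Admissible2 {N : ℕ} {D Γin Γout : Set (Euc N)} {T : ℝ} (M : ℝ)
    (ξ : Data2 D Γin Γout T) : Prop where
  a_mem : ∃ a₀ > 0, ∀ᵐ z ∂((timeMeasure T).prod ((surfMeasure D).restrict Γin)),
    a₀ ≤ ξ.a z ∧ ξ.a z ≤ 1
  b_mem : ∃ b₀ > 0, ∀ᵐ z ∂((timeMeasure T).prod ((surfMeasure D).restrict Γout)),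
    b₀ ≤ ξ.b z ∧ ξ.b z ≤ 1
  u₀_mem : ∀ᵐ x ∂(domMeasure D), 0 ≤ ξ.u₀ x ∧ ξ.u₀ x ≤ 1
  harmonic : ∀ᵐ t ∂(timeMeasure T), ∀ φ : Euc N → ℝ, ContDiff ℝ (⊤ : ℕ∞) φ → HasCompactSupport φ →
    tsupport φ ⊆ D → ∫ x, ⟪grad (ξ.V t) x, gradient φ x⟫ ∂(domMeasure D) = 0
  V_le : ‖ξ.V‖ ≤ M

/-! ### Weak solutions -/

/-- `u` is a weak solution of `∂ₜu + ∇·J = α f(u) - β u` in `(0,T) × D` with flux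
`J = -∇u + f(u)∇V`, no-flux boundary condition `J·n = 0` and initial value `u⁰`. -/
def IsWeakSolution1 {N : ℕ} {D : Set (Euc N)} {T : ℝ} (f : ℝ → ℝ) (ξ : Data1 D T)
    (u : L2H1 D T) : Prop :=
  HasInitialValue u ξ.u₀ ∧
  ∃ w : Lp (H1Dual D) 2 (timeMeasure T), IsTimeDeriv u w ∧
    ∀ᵐ t ∂(timeMeasure T), ∀ φ : H1 D,
      w t φ
        - (∫ x, ⟪-grad (u t) x + f (val (u t) x) • grad (ξ.V t) x, grad φ x⟫ ∂(domMeasure D))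
        + (∫ x, ξ.β (t, x) * val (u t) x * val φ x ∂(domMeasure D))
        - (∫ x, ξ.α (t, x) * f (val (u t) x) * val φ x ∂(domMeasure D)) = 0

/-- `u` is a weak solution of `∂ₜu + ∇·J = 0` in `(0,T) × D` with flux `J = -∇u + f(u)∇V`, initial
value `u⁰` and boundary conditions `-J·n = a g(u)` on `Γ_in`, `J·n = b u` on `Γ_out`, `J·n = 0` on
the rest of `∂D`. On the boundary `u(t)` and the test function are replaced by their traces. -/
def IsWeakSolution2 {N : ℕ} {D Γin Γout : Set (Euc N)} {T : ℝ} (f g : ℝ → ℝ)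
    (ξ : Data2 D Γin Γout T) (u : L2H1 D T) : Prop :=
  HasInitialValue u ξ.u₀ ∧
  ∃ w : Lp (H1Dual D) 2 (timeMeasure T), IsTimeDeriv u w ∧
    ∀ᵐ t ∂(timeMeasure T), ∃ v : Lp ℝ 2 (surfMeasure D), IsTrace D (u t) v ∧
      ∀ (φ : H1 D) (ψ : Lp ℝ 2 (surfMeasure D)), IsTrace D φ ψ →
        w t φ
          - (∫ x, ⟪-grad (u t) x + f (val (u t) x) • grad (ξ.V t) x, grad φ x⟫ ∂(domMeasure D))
          + (∫ x, ξ.b (t, x) * v x * ψ x ∂((surfMeasure D).restrict Γout))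
          = ∫ x, ξ.a (t, x) * g (v x) * ψ x ∂((surfMeasure D).restrict Γin)

/-! ### The filtrations generated by the data -/

lemma continuous_setIntegral_Lp {X : Type*} [MeasurableSpace X] {μ : Measure X} {p : ℝ≥0∞}
    [hp : Fact (1 ≤ p)] {B : Set X} (hB : μ B < ∞) :
    Continuous fun h : Lp ℝ p μ => ∫ z in B, h z ∂μ := by
  have : IsFiniteMeasure (μ.restrict B) := ⟨by simpa using hB⟩
  set c : ℝ≥0∞ := (μ.restrict B) univ ^ (1 / (1 : ℝ≥0∞).toReal - 1 / p.toReal) with hc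
  have hc' : c ≠ ∞ := by
    refine ENNReal.rpow_ne_top_of_nonneg ?_ (measure_ne_top _ _)
    rcases eq_or_ne p ∞ with rfl | hpt
    · simp
    · have : 1 ≤ p.toReal := by
        have := ENNReal.toReal_mono hpt hp.out
        simpa using this
      have h2 : 1 / p.toReal ≤ 1 := by
        rw [div_le_one (by linarith)]
        exact this
      simpa using h2
  have hint : ∀ h : Lp ℝ p μ, Integrable h (μ.restrict B) := fun h =>
    ((Lp.memLp h).restrict B).integrable hp.out
  refine LipschitzWith.continuous (K := c.toNNReal) (LipschitzWith.of_dist_le_mul fun h k => ?_)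
  rw [dist_eq_norm, dist_eq_norm, ← integral_sub (hint h) (hint k)]
  have hsub : (fun z => h z - k z) =ᵐ[μ.restrict B] (h - k : Lp ℝ p μ) :=
    ae_restrict_of_ae ((Lp.coeFn_sub h k).symm)
  rw [integral_congr_ae hsub]
  refine (norm_integral_le_lintegral_norm _).trans ?_
  have key : ∫⁻ z in B, ENNReal.ofReal ‖(h - k : Lp ℝ p μ) z‖ ∂μ
      ≤ ‖(h - k : Lp ℝ p μ)‖ₑ * c := by
    have e1 : ∫⁻ z in B, ENNReal.ofReal ‖(h - k : Lp ℝ p μ) z‖ ∂μ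
        = eLpNorm (h - k : Lp ℝ p μ) 1 (μ.restrict B) := by
      rw [eLpNorm_one_eq_lintegral_enorm]
      simp only [ofReal_norm]
    rw [e1]
    refine (eLpNorm_le_eLpNorm_mul_rpow_measure_univ hp.out
      ((Lp.aestronglyMeasurable _).restrict)).trans ?_
    gcongr
    rw [Lp.enorm_def]
    exact eLpNorm_restrict_le _ _ _ _
  have := ENNReal.toReal_mono (ENNReal.mul_ne_top (by simp) hc') key
  rw [ENNReal.toReal_mul, toReal_enorm] at this
  rw [mul_comm]
  exact this

/-- The linear functional `V ↦ ∫_A V dx` on `W^{1,∞}(D)`, and its continuity. -/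
lemma continuous_average {N : ℕ} {D : Set (Euc N)} {p : ℝ≥0∞} [Fact (1 ≤ p)] {T : ℝ} {I : Set ℝ}
    {A : Set (Euc N)} (hA : domMeasure D A < ∞) :
    Continuous fun V : Lp (W1 D ∞) p (timeMeasure T) =>
      ∫ s in I, (∫ x in A, val (V s) x ∂(domMeasure D)) ∂(timeMeasure T) := by
  have : IsFiniteMeasure ((domMeasure D).restrict A) := ⟨by simpa using hA⟩
  have hint : ∀ h : Lp ℝ ∞ (domMeasure D), Integrable h ((domMeasure D).restrict A) := fun h =>
    ((Lp.memLp h).restrict A).integrable le_top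
  let ℓ : W1 D ∞ →L[ℝ] ℝ :=
    { toFun := fun v => ∫ x in A, val v x ∂(domMeasure D)
      map_add' := fun v w => by
        rw [← integral_add (hint _) (hint _)]
        exact integral_congr_ae (ae_restrict_of_ae (Lp.coeFn_add (val v) (val w)))
      map_smul' := fun r v => by
        rw [RingHom.id_apply, smul_eq_mul, ← integral_const_mul]
        exact integral_congr_ae (ae_restrict_of_ae (Lp.coeFn_smul r (val v)))
      cont := by
        refine (continuous_setIntegral_Lp hA).comp ?_
        exact (WithLp.continuous_fst 1 _ _).comp continuous_subtype_val }
  have hI : timeMeasure T I < ∞ := measure_lt_top _ _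
  have h1 := (continuous_setIntegral_Lp (μ := timeMeasure T) (p := p) hI).comp
    (ℓ.compLpL p (timeMeasure T)).continuous
  refine h1.congr fun V => ?_
  exact integral_congr_ae (ae_restrict_of_ae (ℓ.coeFn_compLpL V))

/-- The information about `h ∈ L^∞((0,T) × X)` which is available at time `t`, i.e. the σ-algebra
generated by the values `h(s, x)` with `s ≤ t`. As `h` is an equivalence class, its values are
read off from its integrals over the sets of finite measure of points `(s, x)` with `s ≤ t`. -/
@[reducible] def history {X : Type*} [MeasurableSpace X] (T : ℝ) (μ : Measure X) (t : ℝ) :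
    MeasurableSpace (Lp ℝ ∞ ((timeMeasure T).prod μ)) :=
  ⨆ B : {B : Set (ℝ × X) // MeasurableSet B ∧ B ⊆ Iic t ×ˢ univ ∧
      (timeMeasure T).prod μ B < ∞},
    MeasurableSpace.comap (fun h => ∫ z in B.1, h z ∂((timeMeasure T).prod μ)) inferInstance

/-- The information about the potential `V` which is available at time `t`, i.e. the σ-algebra
generated by the values `V(s, x)` with `s ≤ t`, read off from integrals over sets `I × A` of
finite measure with `I ⊆ (-∞, t]`. -/
@[reducible] def potentialHistory {N : ℕ} (T : ℝ) (D : Set (Euc N)) (p : ℝ≥0∞) [Fact (1 ≤ p)] (t : ℝ) :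
    MeasurableSpace (Lp (W1 D ∞) p (timeMeasure T)) :=
  ⨆ B : {B : Set ℝ × Set (Euc N) // MeasurableSet B.1 ∧ MeasurableSet B.2 ∧ B.1 ⊆ Iic t ∧
      domMeasure D B.2 < ∞},
    MeasurableSpace.comap (fun V => ∫ s in B.1.1, (∫ x in B.1.2, val (V s) x ∂(domMeasure D))
      ∂(timeMeasure T)) inferInstance

lemma history_mono {X : Type*} [MeasurableSpace X] (T : ℝ) (μ : Measure X) :
    Monotone (history T μ) := by
  intro s t hst
  refine iSup_le fun B => ?_
  exact le_iSup (fun B : {B : Set (ℝ × X) // MeasurableSet B ∧ B ⊆ Iic t ×ˢ univ ∧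
      (timeMeasure T).prod μ B < ∞} => MeasurableSpace.comap
        (fun h : Lp ℝ ∞ ((timeMeasure T).prod μ) => ∫ z in B.1, h z ∂((timeMeasure T).prod μ))
        inferInstance)
    ⟨B.1, B.2.1, B.2.2.1.trans (prod_mono (Iic_subset_Iic.2 hst) subset_rfl), B.2.2.2⟩

lemma potentialHistory_mono {N : ℕ} (T : ℝ) (D : Set (Euc N)) (p : ℝ≥0∞) [Fact (1 ≤ p)] :
    Monotone (potentialHistory T D p) := by
  intro s t hst
  refine iSup_le fun B => ?_
  exact le_iSup (fun B : {B : Set ℝ × Set (Euc N) // MeasurableSet B.1 ∧ MeasurableSet B.2 ∧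
      B.1 ⊆ Iic t ∧ domMeasure D B.2 < ∞} => MeasurableSpace.comap
        (fun V : Lp (W1 D ∞) p (timeMeasure T) =>
          ∫ s in B.1.1, (∫ x in B.1.2, val (V s) x ∂(domMeasure D)) ∂(timeMeasure T))
        inferInstance)
    ⟨B.1, B.2.1, B.2.2.1, B.2.2.2.1.trans (Iic_subset_Iic.2 hst), B.2.2.2.2⟩

lemma comap_history_le {X Y : Type*} [MeasurableSpace X] [TopologicalSpace Y] {T : ℝ}
    {μ : Measure X} {F : Y → Lp ℝ ∞ ((timeMeasure T).prod μ)} (hF : Continuous F) (t : ℝ) :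
    (history T μ t).comap F ≤ borel Y := by
  borelize Y
  rw [history, MeasurableSpace.comap_iSup]
  refine iSup_le fun B => ?_
  rw [MeasurableSpace.comap_comp]
  exact ((continuous_setIntegral_Lp B.2.2.2).comp hF).measurable.comap_le

lemma comap_potentialHistory_le {N : ℕ} {Y : Type*} [TopologicalSpace Y] {T : ℝ}
    {D : Set (Euc N)} {p : ℝ≥0∞} [Fact (1 ≤ p)] {F : Y → Lp (W1 D ∞) p (timeMeasure T)}
    (hF : Continuous F) (t : ℝ) :
    (potentialHistory T D p t).comap F ≤ borel Y := by
  borelize Y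
  rw [potentialHistory, MeasurableSpace.comap_iSup]
  refine iSup_le fun B => ?_
  rw [MeasurableSpace.comap_comp]
  exact ((continuous_average B.2.2.2.2).comp hF).measurable.comap_le

/-- The filtration `F_t = σ(α(s,x), β(s,x), V(s,x) : s ≤ t, x ∈ D)`. -/
def filtration1 {N : ℕ} (D : Set (Euc N)) (T : ℝ) :
    Filtration ℝ (inferInstance : MeasurableSpace (Data1 D T)) where
  seq t := (history T (domMeasure D) t).comap Data1.α ⊔ (history T (domMeasure D) t).comap Data1.β
    ⊔ (potentialHistory T D ∞ t).comap Data1.V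
  mono' s t hst := sup_le_sup (sup_le_sup (MeasurableSpace.comap_mono (history_mono T _ hst))
    (MeasurableSpace.comap_mono (history_mono T _ hst)))
    (MeasurableSpace.comap_mono (potentialHistory_mono T D ∞ hst))
  le' t := by
    have h : Continuous fun ξ : Data1 D T => (ξ.α, ξ.β, ξ.V, ξ.u₀) := continuous_induced_dom
    exact sup_le (sup_le (comap_history_le h.fst t) (comap_history_le h.snd.fst t))
      (comap_potentialHistory_le h.snd.snd.fst t)

/-- The filtration `F_t = σ(a(s,x), b(s,x), V(s,x) : s ≤ t)`. -/
def filtration2 {N : ℕ} (D Γin Γout : Set (Euc N)) (T : ℝ) :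
    Filtration ℝ (inferInstance : MeasurableSpace (Data2 D Γin Γout T)) where
  seq t := (history T ((surfMeasure D).restrict Γin) t).comap Data2.a
    ⊔ (history T ((surfMeasure D).restrict Γout) t).comap Data2.b
    ⊔ (potentialHistory T D 2 t).comap Data2.V
  mono' s t hst := sup_le_sup (sup_le_sup (MeasurableSpace.comap_mono (history_mono T _ hst))
    (MeasurableSpace.comap_mono (history_mono T _ hst)))
    (MeasurableSpace.comap_mono (potentialHistory_mono T D 2 hst))
  le' t := by
    have h : Continuous fun ξ : Data2 D Γin Γout T => (ξ.a, ξ.b, ξ.V, ξ.u₀) :=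
      continuous_induced_dom
    exact sup_le (sup_le (comap_history_le h.fst t) (comap_history_le h.snd.fst t))
      (comap_potentialHistory_le h.snd.snd.fst t)

/-! ### Wasserstein distance, conditional laws and nested distance -/

/-- `π` is a probability measure with marginals `μ` and `ν`. -/
structure IsCoupling {Ω Ω' : Type*} [MeasurableSpace Ω] [MeasurableSpace Ω'] (μ : Measure Ω)
    (ν : Measure Ω') (π : Measure (Ω × Ω')) : Prop where
  prob : IsProbabilityMeasure π
  fst : π.map Prod.fst = μ
  snd : π.map Prod.snd = ν

/-- The `r`-th power `d_r(μ, ν)^r` of the Wasserstein distance of order `r` for the distance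
`c`. -/
def wassersteinPow {Ω Ω' : Type*} [MeasurableSpace Ω] [MeasurableSpace Ω']
    (c : Ω → Ω' → ℝ≥0∞) (r : ℝ) (μ : Measure Ω) (ν : Measure Ω') : ℝ≥0∞ :=
  ⨅ (π : Measure (Ω × Ω')) (_ : IsCoupling μ ν π), ∫⁻ z, c z.1 z.2 ^ r ∂π

/-- `π` is a coupling of `P` and `P'` whose conditional marginals are those of `P` and `P'`:
`π(A × Ω' | F_t ⊗ F'_t) = P(A | F_t)` and `π(Ω × B | F_t ⊗ F'_t) = P'(B | F'_t)`, `π`-almost surely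
for all `t ∈ [0,T]`. -/
structure IsNestedCoupling {Ω Ω' : Type*} [mΩ : MeasurableSpace Ω] [mΩ' : MeasurableSpace Ω']
    (T : ℝ) (P : Measure Ω) (F : Filtration ℝ mΩ) (P' : Measure Ω') (F' : Filtration ℝ mΩ')
    (π : Measure (Ω × Ω')) : Prop where
  coupling : IsCoupling P P' π
  fst : ∀ t ∈ Icc 0 T, ∀ A : Set Ω, MeasurableSet A →
    π⟦A ×ˢ (univ : Set Ω') | (F t).prod (F' t)⟧ =ᵐ[π] fun z => (P⟦A | F t⟧) z.1
  snd : ∀ t ∈ Icc 0 T, ∀ B : Set Ω', MeasurableSet B →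
    π⟦(univ : Set Ω) ×ˢ B | (F t).prod (F' t)⟧ =ᵐ[π] fun z => (P'⟦B | F' t⟧) z.2

/-- The nested distance (process distance) of order `r` for the distance `c`. -/
def nestedDist {Ω Ω' : Type*} [mΩ : MeasurableSpace Ω] [mΩ' : MeasurableSpace Ω']
    (c : Ω → Ω' → ℝ≥0∞) (r T : ℝ) (P : Measure Ω) (F : Filtration ℝ mΩ) (P' : Measure Ω')
    (F' : Filtration ℝ mΩ') : ℝ≥0∞ :=
  (⨅ (π : Measure (Ω × Ω')) (_ : IsNestedCoupling T P F P' F' π), ∫⁻ z, c z.1 z.2 ^ r ∂π) ^ (1 / r)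

/-- `κ` is a regular version of the conditional law `P(· | m)`. -/
structure IsRegularCondLaw {Ω : Type*} (m : MeasurableSpace Ω) [mΩ : MeasurableSpace Ω]
    (P : Measure Ω) (κ : Ω → Measure Ω) : Prop where
  prob : ∀ ω, IsProbabilityMeasure (κ ω)
  meas : ∀ A : Set Ω, MeasurableSet A → Measurable[m] fun ω => κ ω A
  cond : ∀ A : Set Ω, MeasurableSet A → ∀ B : Set Ω, MeasurableSet[m] B →
    ∫⁻ ω in B, κ ω A ∂P = P (A ∩ B)

/-- The conditional Wasserstein distances are Hölder continuous in time: for `0 ≤ s < t ≤ T`, the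
laws of the data up to time `t` (that is, restricted to `F_t`), conditional on `F_s` resp. `F'_s`,
satisfy `d_r(P_t^{|F_s}, P'_t^{|F'_s})^r ≤ C (t - s)` almost surely. The distance `c s t` compares
what happens during the time interval `(s, t)`. -/
def CondWassersteinHolder {Ω Ω' : Type*} [mΩ : MeasurableSpace Ω] [mΩ' : MeasurableSpace Ω']
    (c : ℝ → ℝ → Ω → Ω' → ℝ≥0∞) (r C T : ℝ) (P : Measure Ω) (F : Filtration ℝ mΩ)
    (P' : Measure Ω') (F' : Filtration ℝ mΩ') : Prop :=
  ∀ s, 0 ≤ s → s < T → ∃ (κ : Ω → Measure Ω) (κ' : Ω' → Measure Ω'),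
    IsRegularCondLaw (F s) P κ ∧ IsRegularCondLaw (F' s) P' κ' ∧
    ∀ t, s < t → t ≤ T → ∀ᵐ z ∂(P.prod P'),
      @wassersteinPow Ω Ω' (F t) (F' t) (c s t) r ((κ z.1).trim (F.le t)) ((κ' z.2).trim (F'.le t))
        ≤ ENNReal.ofReal (C * (t - s))

end DriftDiffusion

end

noncomputable section

namespace DriftDiffusion

/-! ### Absolutely continuous functions on an interval -/

/-! The mathematical core is a pathwise statement: on admissible data, any two weak solutions
satisfy `‖u - v‖ ≤ C * exp (C' T / 2) * d(ξ, η)` in `L²((0,T); H¹(D))` (`exists_stability1`,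
`exists_stability2`). Hence a Lipschitz functional of the solution is a Lipschitz function of the
datum. For every coupling `π` the two expectations differ by at most the `π`-mean of `L * C * exp
(C' T / 2) * d`, which is bounded by the corresponding `L²(π)` norm. A nested coupling is in
particular a coupling, so the bound passes to the infimum (`ofReal_abs_integral_sub_le_nestedDist`,
`gluing_of_stability`). The factor `max 1 √(C_H T)` is at least one and can only enlarge the
right-hand side.

For stability, the two equations are subtracted and tested with `u₁ - u₂`. The diffusion yields
`-‖∇(u₁ - u₂)‖²`. The drift is handled by Young's inequality, using that `f` is bounded and
Lipschitz and that `∇V` is bounded in space (`flux_estimate`). In the reaction and boundary terms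
the diagonal parts either have a good sign (nonnegative `β`, `b`, and nonnegative `a` with
decreasing `g`) or are Lipschitz (`reaction_estimate`, `boundary_estimate`). The boundary
contribution carries a small factor and is absorbed into the gradient by the trace inequality
`exists_norm_trace_le`. Gronwall's inequality concludes. Since `f` and `g` are bounded on the whole
line, no bound `0 ≤ u ≤ 1` for solutions is needed.

The terms `(β₁ - β₂) u₂` and `(b₁ - b₂) u₂` leave `‖u₂‖` in the estimate. The same estimate removes
it: zero is a weak solution for suitably modified data (`isWeakSolution1_zero`,
`isWeakSolution2_zero`), and comparing `u₂` with it bounds `‖u₂‖` by an exponential in `T`.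

Two analytic tools are established along the way. The energy identity `‖U(b)‖² = ‖U(0)‖² + 2 ∫ ⟨∂ₜu,
u⟩` comes from testing the increment over `(t, t+h)` with `u(t) + u(t+h)`, which gives a difference
of squares, and from continuity of translations in `L²`. The trace inequality comes from integrating
along a direction transversal to the Lipschitz graph. -/

lemma _root_.AbsolutelyContinuousOnInterval.exp_neg {μ : ℝ → ℝ} {a b : ℝ}
    (h : AbsolutelyContinuousOnInterval μ a b) (h0 : ∀ t ∈ uIcc a b, 0 ≤ μ t) :
    AbsolutelyContinuousOnInterval (fun t => Real.exp (-μ t)) a b := by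
  rw [absolutelyContinuousOnInterval_iff] at h ⊢
  intro ε hε
  obtain ⟨δ, hδ, H⟩ := h ε hε
  refine ⟨δ, hδ, fun E hE hs => lt_of_le_of_lt (Finset.sum_le_sum fun i hi => ?_) (H E hE hs)⟩
  -- On the half-line `[0, ∞)` the function `exp (-·)` is 1-Lipschitz, so the `δ` belonging to `μ`
  -- serves again.
  have key : ∀ s t : ℝ, 0 ≤ s → 0 ≤ t → s ≤ t → Real.exp (-s) - Real.exp (-t) ≤ t - s := by
    intro s t hs ht hst
    have h1 : Real.exp (-t) = Real.exp (-s) * Real.exp (-(t - s)) := by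
      rw [← Real.exp_add]; congr 1; ring
    have h2 : 1 - (t - s) ≤ Real.exp (-(t - s)) := by
      have := Real.add_one_le_exp (-(t - s)); linarith
    have h3 : Real.exp (-s) ≤ 1 := Real.exp_le_one_iff.2 (by linarith)
    have h4 := Real.exp_pos (-s)
    rw [h1]
    nlinarith
  obtain ⟨h1, h2⟩ := hE.1 i hi
  have m1 := h0 _ h1
  have m2 := h0 _ h2
  rw [Real.dist_eq, Real.dist_eq]
  rcases le_total (μ (E.2 i).1) (μ (E.2 i).2) with hle | hle
  · rw [abs_of_nonneg (sub_nonneg.2 (Real.exp_le_exp.2 (neg_le_neg hle))), abs_sub_comm,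
      abs_of_nonneg (sub_nonneg.2 hle)]
    exact key _ _ m1 m2 hle
  · rw [abs_sub_comm, abs_of_nonneg (sub_nonneg.2 (Real.exp_le_exp.2 (neg_le_neg hle))),
      abs_of_nonneg (sub_nonneg.2 hle)]
    exact key _ _ m2 m1 hle

/-- Gronwall's inequality with an integrable coefficient. -/
theorem gronwall_integral {y m k G : ℝ → ℝ} {T : ℝ} (hT : 0 ≤ T) (hy : ContinuousOn y (Icc 0 T))
    (hm : IntervalIntegrable m volume 0 T) (hk : IntervalIntegrable k volume 0 T)
    (hm0 : ∀ t, 0 ≤ m t) (hk0 : ∀ t, 0 ≤ k t) (hG0 : ∀ t, 0 ≤ G t)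
    (h : ∀ b ∈ Icc 0 T, y b + ∫ t in (0)..b, G t ≤ y 0 + ∫ t in (0)..b, (m t * y t + k t)) :
    y T + ∫ t in (0)..T, G t ≤ Real.exp (∫ t in (0)..T, m t) * (y 0 + ∫ t in (0)..T, k t) := by
  have hI : uIcc 0 T = Icc 0 T := uIcc_of_le hT
  have hmy : IntervalIntegrable (fun t => m t * y t + k t) volume 0 T :=
    (hm.mul_continuousOn (hI ▸ hy)).add hk
  -- The majorant `z` is absolutely continuous although `y` is only continuous. The classical
  -- argument therefore applies to `z * exp (-μ)` with the fundamental theorem of calculus for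
  -- absolutely continuous functions. The integral of `G` is dropped inside the argument, where `y ≤
  -- z` suffices, and recovered at the endpoint.
  set z : ℝ → ℝ := fun b => y 0 + ∫ t in (0)..b, (m t * y t + k t) with hz
  set μ : ℝ → ℝ := fun b => ∫ t in (0)..b, m t with hμ
  have hμ0 : ∀ t ∈ uIcc 0 T, 0 ≤ μ t := fun t ht =>
    intervalIntegral.integral_nonneg (hI ▸ ht).1 fun s _ => hm0 s
  have hzac : AbsolutelyContinuousOnInterval z 0 T := by
    have h1 := hmy.absolutelyContinuousOnInterval_intervalIntegral (c := 0) (by simp)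
    have h2 : AbsolutelyContinuousOnInterval (fun _ : ℝ => y 0) 0 T :=
      contDiffOn_const.absolutelyContinuousOnInterval
    exact h2.add h1
  have hμac : AbsolutelyContinuousOnInterval μ 0 T :=
    hm.absolutelyContinuousOnInterval_intervalIntegral (c := 0) (by simp)
  have heac := hμac.exp_neg hμ0
  have hint := (hzac.fun_mul heac).integral_deriv_eq_sub
  have hle : ∫ t in (0)..T, deriv (fun t => z t * Real.exp (-μ t)) t ≤ ∫ t in (0)..T, k t := by
    refine intervalIntegral.integral_mono_ae_restrict hT
      (hzac.fun_mul heac).intervalIntegrable_deriv hk ?_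
    filter_upwards [ae_restrict_of_ae hmy.ae_hasDerivAt_integral,
      ae_restrict_of_ae hm.ae_hasDerivAt_integral, ae_restrict_mem measurableSet_Icc]
      with t h1 h2 ht
    have d1 : HasDerivAt z (m t * y t + k t) t := (h1 (hI ▸ ht) 0 (by simp)).const_add _
    have d2 : HasDerivAt μ (m t) t := h2 (hI ▸ ht) 0 (by simp)
    have d3 := (d1.mul d2.neg.exp).deriv
    rw [show (fun t => z t * Real.exp (-μ t)) = z * fun t => Real.exp ((-μ) t) from rfl, d3]
    have hyz : y t ≤ z t := by
      have := h t ht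
      have h5 : 0 ≤ ∫ s in (0)..t, G s := intervalIntegral.integral_nonneg ht.1 fun s _ => hG0 s
      simp only [hz]; linarith
    have e1 : Real.exp (-μ t) ≤ 1 := Real.exp_le_one_iff.2 (by linarith [hμ0 t (hI ▸ ht)])
    have e0 := Real.exp_pos (-μ t)
    have a1 : m t * y t ≤ m t * z t := mul_le_mul_of_nonneg_left hyz (hm0 t)
    have a2 : k t * Real.exp (-μ t) ≤ k t := mul_le_of_le_one_right (hk0 t) e1
    simp only [Pi.neg_apply]
    nlinarith
  rw [hint] at hle
  have hz0 : z 0 = y 0 := by simp [hz]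
  have hμ00 : μ 0 = 0 := by simp [hμ]
  rw [hz0, hμ00, neg_zero, Real.exp_zero, mul_one] at hle
  have hfin : z T ≤ Real.exp (μ T) * (y 0 + ∫ t in (0)..T, k t) := by
    have : z T = Real.exp (μ T) * (z T * Real.exp (-μ T)) := by
      rw [mul_left_comm, ← Real.exp_add]; simp
    rw [this]
    exact mul_le_mul_of_nonneg_left (by linarith) (Real.exp_pos _).le
  exact (h T ⟨hT, le_rfl⟩).trans hfin

/-! ### Distributional derivatives on an interval. -/

lemma integral_Ioo_eq_interval {E : Type*} [NormedAddCommGroup E] [NormedSpace ℝ E] {T : ℝ}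
    (hT : 0 ≤ T) (F : ℝ → E) : ∫ t in Ioo 0 T, F t = ∫ t in (0)..T, F t := by
  rw [intervalIntegral.integral_of_le hT, integral_Ioc_eq_integral_Ioo]

/-- The primitive of a test function with vanishing integral is a test function. -/
lemma exists_test_primitive {T : ℝ} {ψ : ℝ → ℝ} (hψ : ContDiff ℝ (⊤ : ℕ∞) ψ)
    (hc : HasCompactSupport ψ) (hs : tsupport ψ ⊆ Ioo 0 T) (h0 : ∫ t, ψ t = 0) :
    ∃ η : ℝ → ℝ, ContDiff ℝ (⊤ : ℕ∞) η ∧ HasCompactSupport η ∧ tsupport η ⊆ Ioo 0 T ∧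
      deriv η = ψ := by
  rcases (tsupport ψ).eq_empty_or_nonempty with he | hne
  · have : ψ = 0 := tsupport_eq_empty_iff.1 he
    subst this
    exact ⟨0, contDiff_const, HasCompactSupport.zero, by simp [tsupport], by ext; simp⟩
  obtain ⟨a, ha, ha'⟩ := hc.isCompact.exists_isLeast hne
  obtain ⟨b, hb, hb'⟩ := hc.isCompact.exists_isGreatest hne
  have hout : ∀ t, t ∉ Icc a b → ψ t = 0 := fun t ht => by
    by_contra hne
    exact ht ⟨ha' (subset_tsupport _ hne), hb' (subset_tsupport _ hne)⟩
  have hint : Integrable ψ := hψ.continuous.integrable_of_hasCompactSupport hc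
  have hd : ∀ t, HasDerivAt (fun t => ∫ s in (0)..t, ψ s) (ψ t) t := fun t =>
    hψ.continuous.integral_hasStrictDerivAt 0 t |>.hasDerivAt
  have hderiv : deriv (fun t => ∫ s in (0)..t, ψ s) = ψ := funext fun t => (hd t).deriv
  -- To the left of the support the integrand vanishes between `0` and `t`. To the right, the
  -- primitive has collected the whole integral of `ψ`, which is zero by `h0`.
  have hsupp : ∀ t, t ∉ Icc a b → ∫ s in (0)..t, ψ s = 0 := by
    intro t ht
    rw [mem_Icc, not_and_or, not_le, not_le] at ht
    have a0 : 0 < a := (hs ha).1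
    rcases ht with ht | ht
    · refine intervalIntegral.integral_zero_ae (Eventually.of_forall fun s hs' => hout s fun h => ?_)
      have h1 := uIoc_subset_uIcc hs'
      have h2 : s ≤ max 0 t := h1.2
      have h3 := h.1
      have : max 0 t < a := max_lt a0 ht
      linarith
    · have hab : a ≤ b := ha' hb
      rw [intervalIntegral.integral_of_le (by linarith), ← h0]
      refine setIntegral_eq_integral_of_forall_compl_eq_zero fun s hs' => hout s fun h => hs' ?_
      exact ⟨by linarith [h.1], by linarith [h.2]⟩
  have hts : tsupport (fun t => ∫ s in (0)..t, ψ s) ⊆ Icc a b :=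
    closure_minimal (fun t ht => by by_contra h; exact ht (hsupp t h)) isClosed_Icc
  refine ⟨fun t => ∫ s in (0)..t, ψ s, ?_, ?_, ?_, hderiv⟩
  · rw [contDiff_infty_iff_deriv, hderiv]
    exact ⟨fun t => (hd t).differentiableAt, hψ⟩
  · exact isCompact_Icc.of_isClosed_subset (isClosed_tsupport _) hts
  · exact hts.trans fun t ht => ⟨(hs ha).1.trans_le ht.1, ht.2.trans_lt (hs hb).2⟩

/-- A continuous function whose distributional derivative on `(0, T)` is the integrable function
`h` is a primitive of `h`. -/
theorem eq_primitive_of_distributional_deriv {T : ℝ} (hT : 0 < T) {g h : ℝ → ℝ}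
    (hg : ContinuousOn g (Icc 0 T)) (hh : IntervalIntegrable h volume 0 T)
    (hd : ∀ η : ℝ → ℝ, ContDiff ℝ (⊤ : ℕ∞) η → HasCompactSupport η → tsupport η ⊆ Ioo 0 T →
      ∫ t in Ioo 0 T, deriv η t * g t = - ∫ t in Ioo 0 T, η t * h t) :
    ∀ t ∈ Icc 0 T, g t = g 0 + ∫ s in (0)..t, h s := by
  have hI : uIcc 0 T = Icc 0 T := uIcc_of_le hT.le
  set W : ℝ → ℝ := fun t => ∫ s in (0)..t, h s with hW
  have hWac : AbsolutelyContinuousOnInterval W 0 T :=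
    hh.absolutelyContinuousOnInterval_intervalIntegral (c := 0) (by simp)
  have hWc : ContinuousOn W (Icc 0 T) := hI ▸ hWac.continuousOn
  -- The difference `F` has vanishing distributional derivative, by integration by parts for the
  -- absolutely continuous `W`. The du Bois-Reymond argument then shows that it is constant.
  set F : ℝ → ℝ := fun t => g t - W t with hF
  have hFc : ContinuousOn F (Icc 0 T) := hg.sub hWc
  have hFi : IntegrableOn F (Ioo 0 T) := (hFc.integrableOn_Icc).mono_set Ioo_subset_Icc_self
  have key : ∀ η : ℝ → ℝ, ContDiff ℝ (⊤ : ℕ∞) η → HasCompactSupport η → tsupport η ⊆ Ioo 0 T →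
      ∫ t in Ioo 0 T, deriv η t * F t = 0 := by
    intro η hη hc hs
    have hη' : Continuous (deriv η) := hη.continuous_deriv (by simp)
    have hηac : AbsolutelyContinuousOnInterval η 0 T :=
      (hη.of_le (by simp)).contDiffOn.absolutelyContinuousOnInterval
    have hz : ∀ t, t ∉ Ioo 0 T → η t = 0 := fun t ht => by
      by_contra hne; exact ht (hs (subset_tsupport _ hne))
    have h1 := hηac.integral_mul_deriv_eq_deriv_mul hWac
    rw [hz T (by simp), hz 0 (by simp)] at h1
    have h2 : ∫ t in (0)..T, η t * deriv W t = ∫ t in (0)..T, η t * h t := by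
      refine intervalIntegral.integral_congr_ae ?_
      filter_upwards [hh.ae_hasDerivAt_integral] with t ht htm
      rw [(ht (uIoc_subset_uIcc htm) 0 (by simp)).deriv]
    have i1 : IntegrableOn (fun t => deriv η t * g t) (Ioo 0 T) :=
      ((hη'.continuousOn.mul hg).integrableOn_Icc).mono_set Ioo_subset_Icc_self
    have i2 : IntegrableOn (fun t => deriv η t * W t) (Ioo 0 T) :=
      ((hη'.continuousOn.mul hWc).integrableOn_Icc).mono_set Ioo_subset_Icc_self
    have h3 : ∫ t in Ioo 0 T, deriv η t * F t
        = (∫ t in Ioo 0 T, deriv η t * g t) - ∫ t in Ioo 0 T, deriv η t * W t := by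
      rw [← integral_sub i1 i2]
      congr 1; ext t; simp only [hF]; ring
    rw [h3, hd η hη hc hs, integral_Ioo_eq_interval hT.le, integral_Ioo_eq_interval hT.le, ← h2, h1]
    ring
  -- A fixed bump of unit mass. Subtracting `(∫ ψ) * ψ₀` from a test function `ψ` makes its integral
  -- zero and hence makes it the derivative of a test function. The constant value of `F` must then
  -- be its mean `c` against `ψ₀`.
  obtain ⟨ψ₀, hψ₀s, hψ₀c, hψ₀d, -, hψ₀⟩ :
      ∃ ψ : ℝ → ℝ, tsupport ψ ⊆ Ioo 0 T ∧ HasCompactSupport ψ ∧ ContDiff ℝ (⊤ : ℕ∞) ψ ∧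
        (∀ t, 0 ≤ ψ t) ∧ ∫ t, ψ t = 1 := by
    let B : ContDiffBump (T / 2) := ⟨T / 8, T / 4, by linarith, by linarith⟩
    refine ⟨B.normed volume, ?_, B.hasCompactSupport_normed, B.contDiff_normed,
      B.nonneg_normed, B.integral_normed⟩
    rw [B.tsupport_normed_eq]
    intro t ht
    have ht' : |t - T / 2| ≤ T / 4 := by simpa [Real.dist_eq] using ht
    rw [abs_le] at ht'
    exact ⟨by linarith, by linarith⟩
  set c : ℝ := ∫ t in Ioo 0 T, ψ₀ t * F t with hc
  have hbdd : ∀ ψ : ℝ → ℝ, Continuous ψ → IntegrableOn (fun t => ψ t * F t) (Ioo 0 T) :=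
    fun ψ hψ => ((hψ.continuousOn.mul hFc).integrableOn_Icc).mono_set Ioo_subset_Icc_self
  have hae : ∀ᵐ t, t ∈ Ioo 0 T → F t - c = 0 := by
    refine isOpen_Ioo.ae_eq_zero_of_integral_contDiff_smul_eq_zero
      (hFi.sub (integrableOn_const (by simp))).locallyIntegrableOn fun ψ hψ hψc hψs => ?_
    obtain ⟨η, hη, hηc, hηs, hηd⟩ := exists_test_primitive (T := T)
      (ψ := ψ - fun t => (∫ s, ψ s) * ψ₀ t)
      (hψ.sub (contDiff_const.mul hψ₀d)) (hψc.sub (hψ₀c.mul_left))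
      ((tsupport_sub _ _).trans (union_subset hψs ((tsupport_mul_subset_right).trans hψ₀s))) (by
        have j1 : Integrable ψ := hψ.continuous.integrable_of_hasCompactSupport hψc
        have j2 : Integrable ψ₀ := hψ₀d.continuous.integrable_of_hasCompactSupport hψ₀c
        simp only [Pi.sub_apply]
        rw [integral_sub j1 (j2.const_mul _), integral_const_mul, hψ₀]; ring)
    have h1 := key η hη hηc hηs
    rw [hηd] at h1
    have h2 : ∫ t in Ioo 0 T, (ψ - fun t => (∫ s, ψ s) * ψ₀ t) t * F t
        = (∫ t in Ioo 0 T, ψ t * F t) - (∫ s, ψ s) * c := by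
      rw [hc, ← integral_const_mul, ← integral_sub (hbdd ψ hψ.continuous)
        ((hbdd ψ₀ hψ₀d.continuous).const_mul _)]
      congr 1; ext t; simp only [Pi.sub_apply]; ring
    have h3 : ∫ t, ψ t • (F t - c) = ∫ t in Ioo 0 T, ψ t * (F t - c) := by
      refine (setIntegral_eq_integral_of_forall_compl_eq_zero fun t ht => ?_).symm
      rw [image_eq_zero_of_notMem_tsupport fun h => ht (hψs h), zero_smul]
    have h4 : ∫ t in Ioo 0 T, ψ t = ∫ t, ψ t :=
      setIntegral_eq_integral_of_forall_compl_eq_zero fun t ht =>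
        image_eq_zero_of_notMem_tsupport fun h => ht (hψs h)
    rw [h3]
    have i1 : IntegrableOn (fun t => ψ t * c) (Ioo 0 T) :=
      ((hψ.continuous.mul continuous_const).continuousOn.integrableOn_Icc).mono_set
        Ioo_subset_Icc_self
    simp only [mul_sub]
    rw [integral_sub (hbdd ψ hψ.continuous) i1, integral_mul_const, h4]
    linarith
  -- Equality almost everywhere becomes equality at every point, endpoints included, because both
  -- sides are continuous on the closed interval.
  have hEq : EqOn F (fun _ => c) (Icc 0 T) := by
    refine Measure.eqOn_Icc_of_ae_eq volume hT.ne ?_ hFc continuousOn_const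
    rw [← restrict_Ioo_eq_restrict_Icc]
    filter_upwards [ae_restrict_of_ae hae, ae_restrict_mem measurableSet_Ioo] with t h1 h2
    linarith [h1 h2]
  intro t ht
  have e1 := hEq ht
  have e2 := hEq (left_mem_Icc.2 hT.le)
  have : W 0 = 0 := by simp [hW]
  simp only [hF] at e1 e2
  linarith

/-! ### The energy identity -/

section Energy

variable {E : Type*} [NormedAddCommGroup E]

/-- The translation `f ↦ f(· + s)` on `L²(ℝ; E)`. -/
def translateLp (s : ℝ) (f : Lp E 2 (volume : Measure ℝ)) : Lp E 2 (volume : Measure ℝ) :=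
  Lp.compMeasurePreserving (fun t => t + s) (measurePreserving_add_right volume s) f

lemma translateLp_ae (s : ℝ) (f : Lp E 2 (volume : Measure ℝ)) :
    translateLp s f =ᵐ[volume] fun t => f (t + s) :=
  Lp.coeFn_compMeasurePreserving _ _

/-- Strong continuity of translations is the limiting fact behind the energy identity. Composition
with measure-preserving maps is continuous in the map for finite exponents, and currying makes `s ↦
(t ↦ t + s)` continuous into `C(ℝ, ℝ)`. -/
lemma continuous_translateLp (f : Lp E 2 (volume : Measure ℝ)) :
    Continuous fun s => translateLp s f := by
  let F : C(ℝ, C(ℝ, ℝ)) := ContinuousMap.curry ⟨fun z : ℝ × ℝ => z.2 + z.1, by fun_prop⟩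
  exact Continuous.compMeasurePreservingLp (f := fun _ : ℝ => f) (g := F) continuous_const
    F.continuous (fun s => measurePreserving_add_right volume s) (by simp)

lemma memLp_indicator_of_restrict {X : Type*} [MeasurableSpace X] {μ : Measure X} {p : ℝ≥0∞}
    {s : Set X} (hs : MeasurableSet s) {f : X → E} (hf : MemLp f p (μ.restrict s)) :
    MemLp (s.indicator f) p μ :=
  (memLp_indicator_iff_restrict hs).2 hf

variable [NormedSpace ℝ E]

lemma stronglyMeasurable_dual_apply {X : Type*} [MeasurableSpace X] {W : X → E →L[ℝ] ℝ} {V : X → E}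
    (hW : StronglyMeasurable W) (hV : StronglyMeasurable V) :
    StronglyMeasurable fun x => W x (V x) :=
  (isBoundedBilinearMap_apply (𝕜 := ℝ) (E := E) (F := ℝ)).continuous.comp_stronglyMeasurable
    (hW.prodMk hV)

lemma integrable_dual_apply {X : Type*} [MeasurableSpace X] {μ : Measure X} {W : X → E →L[ℝ] ℝ}
    {V : X → E} (hW : MemLp W 2 μ) (hV : MemLp V 2 μ) : Integrable (fun x => W x (V x)) μ := by
  have h := hW.norm.integrable_mul hV.norm
  refine h.mono ?_ (Eventually.of_forall fun x => ?_)
  · exact (isBoundedBilinearMap_apply (𝕜 := ℝ) (E := E) (F := ℝ)).continuous.comp_aestronglyMeasurable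
      (hW.1.prodMk hV.1)
  · simpa using (W x).le_opNorm (V x)

/-- The pairing `∫_0^b W(t + σ)(V(t) + V(t + h)) dt` depends continuously on the shifts. -/
lemma continuous_shifted_pairing {W : ℝ → E →L[ℝ] ℝ} {V : ℝ → E} (hW : MemLp W 2 volume)
    (hV : MemLp V 2 volume) (b : ℝ) :
    Continuous fun z : ℝ × ℝ => ∫ t in Ioo 0 b, W (t + z.1) (V t + V (t + z.2)) := by
  -- The integral is the continuous bilinear pairing of `L²(0,b)` with values in the dual and in
  -- `E`, evaluated at restrictions of translates. The remainder of the proof matches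
  -- representatives almost everywhere.
  let R := LpToLpRestrictCLM ℝ E ℝ volume 2 (Ioo 0 b)
  let R' := LpToLpRestrictCLM ℝ (E →L[ℝ] ℝ) ℝ volume 2 (Ioo 0 b)
  let B := (ContinuousLinearMap.id ℝ (E →L[ℝ] ℝ)).lpPairing (volume.restrict (Ioo 0 b)) 2 2
  have h1 : Continuous fun z : ℝ × ℝ => B (R' (translateLp z.1 (hW.toLp W)))
      (R (hV.toLp V) + R (translateLp z.2 (hV.toLp V))) := by
    have c1 := (continuous_translateLp (hW.toLp W)).comp (continuous_fst (X := ℝ) (Y := ℝ))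
    have c2 := (continuous_translateLp (hV.toLp V)).comp (continuous_snd (X := ℝ) (Y := ℝ))
    exact (B.continuous.comp (R'.continuous.comp c1)).clm_apply
      (continuous_const.add (R.continuous.comp c2))
  refine h1.congr fun z => ?_
  rw [ContinuousLinearMap.lpPairing_eq_integral]
  refine integral_congr_ae ?_
  have q1 := (measurePreserving_add_right (volume : Measure ℝ) z.1).quasiMeasurePreserving.ae
    hW.coeFn_toLp
  have q2 := (measurePreserving_add_right (volume : Measure ℝ) z.2).quasiMeasurePreserving.ae
    hV.coeFn_toLp
  filter_upwards [LpToLpRestrictCLM_coeFn ℝ (Ioo 0 b) (translateLp z.1 (hW.toLp W)),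
    LpToLpRestrictCLM_coeFn ℝ (Ioo 0 b) (hV.toLp V),
    LpToLpRestrictCLM_coeFn ℝ (Ioo 0 b) (translateLp z.2 (hV.toLp V)),
    Lp.coeFn_add (R (hV.toLp V)) (R (translateLp z.2 (hV.toLp V))),
    ae_restrict_of_ae (translateLp_ae z.1 (hW.toLp W)),
    ae_restrict_of_ae (translateLp_ae z.2 (hV.toLp V)),
    ae_restrict_of_ae q1, ae_restrict_of_ae q2, ae_restrict_of_ae hV.coeFn_toLp]
    with t a1 a2 a3 a4 a5 a6 a7 a8 a9
  simp only [ContinuousLinearMap.coe_id', id_eq]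
  rw [a4, Pi.add_apply, a1, a2, a3, a5, a6, a7, a8, a9]

/-- This is the hypothesis for Fubini in the energy identity. The integrand is dominated by `‖W(t +
σ)‖² + ‖V(t) + V(t + h)‖²`. The first term is integrable because `(t, σ) ↦ (t, t + σ)` preserves the
product measure. Strong measurability of `W` and `V` themselves provides joint measurability. -/
lemma integrable_shifted_pairing {W : ℝ → E →L[ℝ] ℝ} {V : ℝ → E} (hW : MemLp W 2 volume)
    (hV : MemLp V 2 volume) (hWm : StronglyMeasurable W) (hVm : StronglyMeasurable V) (b h : ℝ) :
    Integrable (fun z : ℝ × ℝ => W (z.1 + z.2) (V z.1 + V (z.1 + h)))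
      ((volume.restrict (Ioo 0 b)).prod (volume.restrict (Ioo 0 h))) := by
  have hX : MemLp (fun t => V t + V (t + h)) 2 volume :=
    hV.add (hV.comp_measurePreserving (measurePreserving_add_right volume h))
  have i1 : Integrable (fun z : ℝ × ℝ => ‖V z.1 + V (z.1 + h)‖ ^ 2)
      ((volume.restrict (Ioo 0 b)).prod (volume.restrict (Ioo 0 h))) :=
    ((hX.restrict _).integrable_norm_pow (p := 2) (by norm_num)).comp_fst _
  have i2 : Integrable (fun z : ℝ × ℝ => ‖W (z.1 + z.2)‖ ^ 2)
      ((volume.restrict (Ioo 0 b)).prod (volume.restrict (Ioo 0 h))) := by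
    have j1 : Integrable ((Ioo 0 b).indicator fun _ => (1 : ℝ)) :=
      (integrableOn_const (by simp)).integrable_indicator measurableSet_Ioo
    have j2 := (measurePreserving_prod_add (volume : Measure ℝ) volume).integrable_comp_of_integrable
      (j1.mul_prod (hW.integrable_norm_pow (p := 2) (by norm_num)))
    rw [Measure.prod_restrict]
    refine (j2.integrableOn (s := Ioo 0 b ×ˢ Ioo 0 h)).congr ?_
    filter_upwards [ae_restrict_mem (measurableSet_Ioo.prod measurableSet_Ioo)] with z hz
    simp [indicator_of_mem hz.1]
  refine (i1.add i2).mono ?_ (Eventually.of_forall fun z => ?_)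
  · exact (stronglyMeasurable_dual_apply (hWm.comp_measurable (by fun_prop))
      ((hVm.comp_measurable (by fun_prop)).add (hVm.comp_measurable (by fun_prop)))).aestronglyMeasurable
  · have h1 := (W (z.1 + z.2)).le_opNorm (V z.1 + V (z.1 + h))
    simp only [Pi.add_apply, Real.norm_eq_abs] at h1 ⊢
    rw [abs_of_nonneg (by positivity : 0 ≤ ‖V z.1 + V (z.1 + h)‖ ^ 2 + ‖W (z.1 + z.2)‖ ^ 2)]
    nlinarith [sq_nonneg (‖W (z.1 + z.2)‖ - ‖V z.1 + V (z.1 + h)‖),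
      norm_nonneg (W (z.1 + z.2)), norm_nonneg (V z.1 + V (z.1 + h))]

variable {H : Type*} [NormedAddCommGroup H] [InnerProductSpace ℝ H]

/-- `w` is the distributional time derivative of `ι ∘ u`, tested with elements of `E`. -/
def IsDistribDeriv (ι : E →L[ℝ] H) (T : ℝ) (u : ℝ → E) (w : ℝ → E →L[ℝ] ℝ) : Prop :=
  ∀ (φ : E) (η : ℝ → ℝ), ContDiff ℝ (⊤ : ℕ∞) η → HasCompactSupport η → tsupport η ⊆ Ioo 0 T →
    ∫ t in Ioo 0 T, deriv η t * ⟪ι (u t), ι φ⟫ = - ∫ t in Ioo 0 T, η t * w t φ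

/-- For fixed `φ` the scalar function `⟪U, ι φ⟫` is continuous with an integrable distributional
derivative, hence is a primitive of it. As this holds for all `s` and `t`, the vector `φ` may
afterwards be chosen depending on them. -/
lemma inner_increment_eq {ι : E →L[ℝ] H} {T : ℝ} (hT : 0 < T) {u : ℝ → E} {w : ℝ → E →L[ℝ] ℝ}
    {U : ℝ → H} (hUc : ContinuousOn U (Icc 0 T)) (hU : ∀ᵐ t ∂(timeMeasure T), U t = ι (u t))
    (hw : MemLp w 2 (timeMeasure T)) (hd : IsDistribDeriv ι T u w) (φ : E) {s t : ℝ}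
    (hs : s ∈ Icc 0 T) (ht : t ∈ Icc 0 T) :
    ⟪U t - U s, ι φ⟫ = ∫ r in s..t, w r φ := by
  have hint : IntervalIntegrable (fun r => w r φ) volume 0 T := by
    rw [intervalIntegrable_iff_integrableOn_Ioo_of_le hT.le]
    exact (hw.integrable (by norm_num)).apply_continuousLinearMap φ
  have key := eq_primitive_of_distributional_deriv hT (g := fun t => ⟪U t, ι φ⟫)
    (h := fun r => w r φ) (hUc.inner continuousOn_const) hint (fun η h1 h2 h3 => by
      rw [← hd φ η h1 h2 h3]
      refine integral_congr_ae ?_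
      filter_upwards [hU] with t ht
      rw [ht])
  have hsub : ∀ {x y}, x ∈ Icc 0 T → y ∈ Icc 0 T → IntervalIntegrable (fun r => w r φ) volume x y :=
    fun hx hy => hint.mono_set (by rw [uIcc_of_le hT.le]; exact uIcc_subset_Icc hx hy)
  have h0 : (0 : ℝ) ∈ Icc 0 T := left_mem_Icc.2 hT.le
  have k1 := key t ht
  have k2 := key s hs
  rw [inner_sub_left]
  rw [k1, k2, add_sub_add_left_eq_sub,
    intervalIntegral.integral_interval_sub_left (hsub h0 ht) (hsub h0 hs)]


/-- The energy identity for functions in `L²((0,T); E)` with time derivative in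
`L²((0,T); E*)`. -/
theorem energy_identity {ι : E →L[ℝ] H} {T : ℝ} (hT : 0 < T) {u : ℝ → E} {w : ℝ → E →L[ℝ] ℝ}
    {U : ℝ → H} (hUc : ContinuousOn U (Icc 0 T)) (hU : ∀ᵐ t ∂(timeMeasure T), U t = ι (u t))
    (hu : MemLp u 2 (timeMeasure T)) (hw : MemLp w 2 (timeMeasure T)) (hum : StronglyMeasurable u)
    (hwm : StronglyMeasurable w) (hd : IsDistribDeriv ι T u w) {b : ℝ} (hb0 : 0 ≤ b) (hbT : b < T) :
    ‖U b‖ ^ 2 = ‖U 0‖ ^ 2 + 2 * ∫ t in (0)..b, w t (u t) := by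
  -- Extension by zero to the whole line, where translations act.
  obtain ⟨V, hV⟩ : ∃ V : ℝ → E, V = (Ioo 0 T).indicator u := ⟨_, rfl⟩
  obtain ⟨W, hW⟩ : ∃ W : ℝ → E →L[ℝ] ℝ, W = (Ioo 0 T).indicator w := ⟨_, rfl⟩
  have hVm : StronglyMeasurable V := hV ▸ hum.indicator measurableSet_Ioo
  have hWm : StronglyMeasurable W := hW ▸ hwm.indicator measurableSet_Ioo
  have hVL : MemLp V 2 volume := by
    rw [hV]; exact memLp_indicator_of_restrict measurableSet_Ioo hu
  have hWL : MemLp W 2 volume := by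
    rw [hW]; exact memLp_indicator_of_restrict measurableSet_Ioo hw
  -- Clamping the time to `[0, T]` makes `‖U‖²` continuous on `ℝ` without changing it on the
  -- interval.
  set n : ℝ → ℝ := fun t => ‖U (max 0 (min T t))‖ ^ 2 with hn
  have hnc : Continuous n := by
    have : Continuous fun t => U (max 0 (min T t)) := hUc.comp_continuous (by fun_prop)
      fun t => ⟨le_max_left _ _, max_le hT.le (min_le_left _ _)⟩
    exact this.norm.pow 2
  have hnU : ∀ t ∈ Icc 0 T, n t = ‖U t‖ ^ 2 := fun t ht => by
    simp only [hn]; rw [min_eq_right ht.2, max_eq_right ht.1]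
  set Θ : ℝ × ℝ → ℝ := fun z => ∫ t in Ioo 0 b, W (t + z.1) (V t + V (t + z.2)) with hΘ
  have hΘc : Continuous Θ := continuous_shifted_pairing hWL hVL b
  -- The quotient `I h / h` has two limits as `h → 0⁺`. By continuity of `Θ` it tends to `Θ (0, 0)`,
  -- which is twice the integral of the duality pairing. After exchanging the integrals it tends to
  -- the increment of `‖U‖²` over `(0, b)`. Comparing the two is the identity.
  set I : ℝ → ℝ := fun h => ∫ σ in Ioo 0 h, Θ (σ, h) with hI
  have hΘ0 : Θ (0, 0) = 2 * ∫ t in (0)..b, w t (u t) := by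
    rw [← integral_Ioo_eq_interval hb0, ← integral_const_mul]
    refine setIntegral_congr_fun measurableSet_Ioo fun t ht => ?_
    have ht' : t ∈ Ioo 0 T := ⟨ht.1, ht.2.trans hbT⟩
    simp only [hW, hV, add_zero, indicator_of_mem ht', map_add]
    ring
  have hIlim : Tendsto (fun h => h⁻¹ * I h) (𝓝[>] 0) (𝓝 (Θ (0, 0))) := by
    rw [Metric.tendsto_nhds]
    intro ε hε
    obtain ⟨δ, hδ, hball⟩ := Metric.continuous_iff.1 hΘc (0, 0) (ε / 2) (by linarith)
    filter_upwards [Ioo_mem_nhdsGT hδ] with h hh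
    have hfin : volume (Ioo 0 h) < ∞ := by simp
    have hcont : Continuous fun σ => Θ (σ, h) := hΘc.comp (by fun_prop)
    have hbound : ∀ σ ∈ Ioo 0 h, ‖Θ (σ, h) - Θ (0, 0)‖ ≤ ε / 2 := fun σ hσ => by
      rw [← dist_eq_norm]
      refine (hball (σ, h) ?_).le
      rw [Prod.dist_eq]
      simp only [dist_zero_right, Real.norm_eq_abs, abs_of_pos hσ.1, abs_of_pos hh.1]
      exact max_lt (hσ.2.trans hh.2) hh.2
    have h1 := norm_setIntegral_le_of_norm_le_const hfin hbound
    rw [integral_sub (hcont.integrableOn_Icc.mono_set Ioo_subset_Icc_self)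
      (integrableOn_const hfin.ne), setIntegral_const] at h1
    simp only [Measure.real, Real.volume_Ioo, sub_zero, ENNReal.toReal_ofReal hh.1.le,
      smul_eq_mul] at h1
    rw [Real.dist_eq]
    have h2 : h⁻¹ * I h - Θ (0, 0) = h⁻¹ * (I h - h * Θ (0, 0)) := by
      have := hh.1.ne'; field_simp
    rw [h2, abs_mul, abs_of_pos (inv_pos.2 hh.1)]
    calc h⁻¹ * |I h - h * Θ (0, 0)| ≤ h⁻¹ * (ε / 2 * h) :=
          mul_le_mul_of_nonneg_left h1 (inv_pos.2 hh.1).le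
      _ = ε / 2 := by have := hh.1.ne'; field_simp
      _ < ε := by linarith
  have hIeq : ∀ h ∈ Ioo 0 (T - b), I h = (∫ t in b..(b + h), n t) - ∫ t in (0)..h, n t := by
    intro h hh
    have hprod := integrable_shifted_pairing hWL hVL hWm hVm b h
    have hswap : I h = ∫ t in Ioo 0 b, ∫ σ in Ioo 0 h, W (t + σ) (V t + V (t + h)) :=
      (integral_integral_swap hprod).symm
    -- Here the increment formula is tested with `φ = u t + u (t + h)`. The symmetric choice turns
    -- the left-hand side into `‖U (t + h)‖² - ‖U t‖²`, since the mixed products cancel. The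
    -- condition `h < T - b` keeps `t + h` inside `(0, T)`.
    have hinner : ∀ᵐ t ∂(volume.restrict (Ioo 0 b)),
        ∫ σ in Ioo 0 h, W (t + σ) (V t + V (t + h)) = n (t + h) - n t := by
      have hU' : ∀ᵐ t ∂volume, t ∈ Ioo 0 T → U t = ι (u t) :=
        (ae_restrict_iff' measurableSet_Ioo).1 hU
      have hU'' := (measurePreserving_add_right (volume : Measure ℝ) h).quasiMeasurePreserving.ae hU'
      filter_upwards [ae_restrict_of_ae hU', ae_restrict_of_ae hU'',
        ae_restrict_mem measurableSet_Ioo] with t h1 h2 ht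
      have ht1 : t ∈ Ioo 0 T := ⟨ht.1, ht.2.trans hbT⟩
      have ht2 : t + h ∈ Ioo 0 T := ⟨by linarith [ht.1, hh.1], by linarith [ht.2, hh.2]⟩
      have e1 : ∫ σ in Ioo 0 h, W (t + σ) (V t + V (t + h))
          = ∫ σ in Ioo 0 h, w (t + σ) (u t + u (t + h)) := by
        refine setIntegral_congr_fun measurableSet_Ioo fun σ hσ => ?_
        have : t + σ ∈ Ioo 0 T := ⟨by linarith [ht.1, hσ.1], by linarith [ht2.2, hσ.2]⟩
        simp only [hW, hV, indicator_of_mem this, indicator_of_mem ht1, indicator_of_mem ht2]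
      rw [e1, integral_Ioo_eq_interval hh.1.le,
        intervalIntegral.integral_comp_add_left (fun r => w r (u t + u (t + h))) t, add_zero,
        ← inner_increment_eq hT hUc hU hw hd _ (Ioo_subset_Icc_self ht1) (Ioo_subset_Icc_self ht2),
        map_add, ← h1 ht1, ← h2 ht2, hnU _ (Ioo_subset_Icc_self ht1),
        hnU _ (Ioo_subset_Icc_self ht2), inner_add_right, inner_sub_left, inner_sub_left,
        real_inner_self_eq_norm_sq, real_inner_self_eq_norm_sq, real_inner_comm (U t)]
      ring
    have hsh : IntervalIntegrable (fun t => n (t + h)) volume 0 b :=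
      (hnc.comp (continuous_add_const h)).intervalIntegrable _ _
    rw [hswap, integral_congr_ae hinner, integral_Ioo_eq_interval hb0,
      intervalIntegral.integral_sub hsh (hnc.intervalIntegrable _ _), intervalIntegral.integral_comp_add_right n h, zero_add]
    have ii : ∀ x y, IntervalIntegrable n volume x y := fun x y => hnc.intervalIntegrable x y
    have a1 := intervalIntegral.integral_add_adjacent_intervals (ii 0 h) (ii h (b + h))
    have a2 := intervalIntegral.integral_add_adjacent_intervals (ii 0 b) (ii b (b + h))
    linarith
  -- The integral of `n (t + h) - n t` over `(0, b)` telescopes to averages of `n` near the two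
  -- endpoints.
  have hlim2 : Tendsto (fun h => h⁻¹ * I h) (𝓝[>] 0) (𝓝 (n b - n 0)) := by
    have d : ∀ x, HasDerivAt (fun y => ∫ t in (0)..y, n t) (n x) x := fun x =>
      (hnc.integral_hasStrictDerivAt 0 x).hasDerivAt
    have l1 := ((hasDerivAt_iff_tendsto_slope_zero.1 (d b)).mono_left
      (nhdsWithin_mono 0 (fun x (hx : 0 < x) => hx.ne'))).sub
      ((hasDerivAt_iff_tendsto_slope_zero.1 (d 0)).mono_left
      (nhdsWithin_mono 0 (fun x (hx : 0 < x) => hx.ne')))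
    refine l1.congr' ?_
    filter_upwards [Ioo_mem_nhdsGT (sub_pos.2 hbT)] with h hh
    rw [hIeq h hh]
    have ii : ∀ x y, IntervalIntegrable n volume x y := fun x y => hnc.intervalIntegrable x y
    have a2 := intervalIntegral.integral_add_adjacent_intervals (ii 0 b) (ii b (b + h))
    simp only [smul_eq_mul, zero_add, intervalIntegral.integral_same, sub_zero]
    rw [← a2]; ring
  have := tendsto_nhds_unique hIlim hlim2
  rw [hΘ0, hnU b ⟨hb0, hbT.le⟩, hnU 0 (left_mem_Icc.2 hT.le)] at this
  linarith

end Energy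

/-! ### The trace inequality -/

/-- These are the Fubini coordinates for lines parallel to `ν`. The orthogonal splitting preserves
volume, and the unit length of `ν` makes the parametrisation of its span an isometry. -/
lemma measurePreserving_line_add_orthogonal {N : ℕ} {ν : Euc N} (hν : ‖ν‖ = 1) :
    MeasurePreserving (fun z : ℝ × (ℝ ∙ ν)ᗮ => z.1 • ν + (z.2 : Euc N)) (volume.prod volume)
      volume := by
  have h1 := ((ℝ ∙ ν).measurePreserving_measurableEquivProd (0 : Euc N)).symm
  rw [InnerProductSpace.euclideanHausdorffMeasure_eq_volume] at h1
  have h2 := (LinearIsometryEquiv.toSpanUnitSingleton (𝕜 := ℝ) ν hν).measurePreserving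
  have h3 := h1.comp (h2.prod (MeasurePreserving.id (volume : Measure (ℝ ∙ ν)ᗮ)))
  have he : (fun z : ℝ × (ℝ ∙ ν)ᗮ => z.1 • ν + (z.2 : Euc N))
      = ⇑((ℝ ∙ ν).measurableEquivProd (0 : Euc N)).symm ∘
        Prod.map (⇑(LinearIsometryEquiv.toSpanUnitSingleton (𝕜 := ℝ) ν hν)) id := by
    funext z
    simp
  rw [he]
  exact h3

/-- The complement of `ν` has dimension `N - 1`, so its volume is the normalised Hausdorff measure
of that dimension. The normalising constant is the same on both sides, and what remains is the
scaling of Hausdorff measure under Lipschitz maps. -/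
lemma hausdorffMeasure_image_le_volume {N : ℕ} {ν : Euc N} (hν : ‖ν‖ = 1) {K : ℝ≥0}
    {G : (ℝ ∙ ν)ᗮ → Euc N} (hG : LipschitzWith K G) (S : Set (ℝ ∙ ν)ᗮ) :
    Measure.euclideanHausdorffMeasure (N - 1) (G '' S) ≤ (K : ℝ≥0∞) ^ (N - 1) * volume S := by
  have hr : Module.finrank ℝ (ℝ ∙ ν)ᗮ = N - 1 := by
    have h := (ℝ ∙ ν).finrank_add_finrank_orthogonal
    rw [finrank_span_singleton (by rintro rfl; simp at hν), finrank_euclideanSpace_fin] at h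
    omega
  rw [← InnerProductSpace.euclideanHausdorffMeasure_eq_volume, hr,
    Measure.euclideanHausdorffMeasure_def, Measure.euclideanHausdorffMeasure_def,
    Measure.smul_apply, Measure.smul_apply, ENNReal.smul_def, ENNReal.smul_def, smul_eq_mul,
    smul_eq_mul, mul_left_comm]
  refine mul_le_mul_right ?_ _
  simpa using hG.hausdorffMeasure_image_le (d := ((N - 1 : ℕ) : ℝ)) (by positivity) S

/-- Near a point of a Lipschitz boundary, the integral over the boundary of the line integrals
along a transversal direction is controlled by the volume integral. -/
lemma exists_transversal_lintegral_le {N : ℕ} {D : Set (Euc N)} (hDo : IsOpen D)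
    (hDL : IsLipschitzDomain D) {x₀ : Euc N} (hx₀ : x₀ ∈ frontier D) :
    ∃ ν : Euc N, ‖ν‖ = 1 ∧ ∃ δ > 0, ∃ C : ℝ≥0, ∀ h : Euc N → ℝ≥0∞, Measurable h →
      ∫⁻ p in Metric.ball x₀ δ, (∫⁻ s in Ioo 0 δ, h (p + s • ν)) ∂(surfMeasure D)
        ≤ C * ∫⁻ x, h x ∂(domMeasure D) := by
  obtain ⟨ν, hν, K, γ, hγ, ρ, hρ, hD⟩ := hDL x₀ hx₀
  have hνν : ⟪ν, ν⟫ = 1 := by rw [real_inner_self_eq_norm_sq, hν]; norm_num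
  have hproj : ∀ (y : Euc N) (s : ℝ), (y + s • ν) - ⟪ν, y + s • ν⟫ • ν = y - ⟪ν, y⟫ • ν := by
    intro y s
    rw [inner_add_right, inner_smul_right, hνν, mul_one, add_smul]; abel
  have hinn : ∀ (y : Euc N) (s : ℝ), ⟪ν, y + s • ν⟫ = ⟪ν, y⟫ + s := by
    intro y s
    rw [inner_add_right, inner_smul_right, hνν, mul_one]
  -- Boundary points lie on the graph. They are not above it because `D` is open and omits them, and
  -- not below it because the strict hypograph is open and contains no point of `D` in the ball.
  have hfr : ∀ p ∈ frontier D, p ∈ Metric.ball x₀ ρ → γ (p - ⟪ν, p⟫ • ν) = ⟪ν, p⟫ := by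
    intro p hp hpb
    have hpD : p ∉ D := fun h => by
      rw [frontier, hDo.interior_eq] at hp; exact hp.2 h
    refine le_antisymm ?_ (not_lt.1 fun h => hpD ((hD p hpb).2 h))
    by_contra hlt
    rw [not_le] at hlt
    have hcl : p ∈ closure D := hp.1
    have hopen : IsOpen {x : Euc N | ⟪ν, x⟫ < γ (x - ⟪ν, x⟫ • ν)} :=
      isOpen_lt (by fun_prop) (hγ.continuous.comp (by fun_prop))
    obtain ⟨x, ⟨hx1, hx2⟩, hxD⟩ := mem_closure_iff.1 hcl _ (hopen.inter Metric.isOpen_ball)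
      ⟨hlt, hpb⟩
    exact absurd ((hD x hx2).1 hxD) (not_lt.2 (le_of_lt hx1))
  set G : (ℝ ∙ ν)ᗮ → Euc N := fun y => (y : Euc N) + γ y • ν with hGdef
  have hG : LipschitzWith (1 + K) G := by
    refine LipschitzWith.add (LipschitzWith.subtype_val _) ?_
    refine LipschitzWith.of_dist_le_mul fun y z => ?_
    rw [dist_eq_norm, ← sub_smul, norm_smul, hν, mul_one, ← dist_eq_norm]
    exact hγ.dist_le_mul _ _
  -- Half the radius is kept in reserve: a base point within `ρ / 2` moved by less than `ρ / 2`
  -- along `ν` stays in the ball where `D` is an epigraph.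
  set Fr : Set (Euc N) := Metric.ball x₀ (ρ / 2) ∩ frontier D with hFr
  set A : Set (ℝ ∙ ν)ᗮ := G ⁻¹' Fr with hA
  have hFrm : MeasurableSet Fr := Metric.isOpen_ball.measurableSet.inter isClosed_frontier.measurableSet
  have hAm : MeasurableSet A := hG.continuous.measurable hFrm
  have hcover : ∀ p ∈ Fr, ∃ y ∈ A, G y = p := by
    intro p hp
    have hpb : p ∈ Metric.ball x₀ ρ := Metric.ball_subset_ball (by linarith) hp.1
    have hmem : p - ⟪ν, p⟫ • ν ∈ (ℝ ∙ ν)ᗮ := by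
      rw [Submodule.mem_orthogonal_singleton_iff_inner_right, inner_sub_right, inner_smul_right,
        hνν]; ring
    have hGy : G ⟨_, hmem⟩ = p := by
      simp only [hGdef]; rw [hfr p hp.2 hpb]; abel
    exact ⟨⟨_, hmem⟩, by rw [hA, mem_preimage, hGy]; exact hp, hGy⟩
  set L : ℝ≥0 := (1 + K) ^ (N - 1) with hL
  -- The local surface measure is dominated by the image of Lebesgue measure on the parameter set
  -- under the graph map `G`. Only this one-sided comparison is needed, so no area formula enters.
  have hmeas : (surfMeasure D).restrict (Metric.ball x₀ (ρ / 2))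
      ≤ (L : ℝ≥0∞) • (volume.restrict A).map G := by
    rw [surfMeasure, Measure.restrict_restrict Metric.isOpen_ball.measurableSet]
    refine Measure.le_iff.2 fun B hB => ?_
    rw [Measure.restrict_apply hB, Measure.smul_apply, Measure.map_apply hG.continuous.measurable hB,
      Measure.restrict_apply (hG.continuous.measurable hB), smul_eq_mul]
    refine (measure_mono ?_).trans ((hausdorffMeasure_image_le_volume hν hG (G ⁻¹' B ∩ A)).trans
      (le_of_eq (by simp [hL])))
    rintro p ⟨hpB, hp⟩
    obtain ⟨y, hyA, rfl⟩ := hcover p hp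
    exact ⟨y, ⟨hpB, hyA⟩, rfl⟩
  refine ⟨ν, hν, ρ / 2, by linarith, L, fun h hh => ?_⟩
  have hHm : Measurable fun p : Euc N => ∫⁻ s in Ioo 0 (ρ / 2), h (p + s • ν) :=
    Measurable.lintegral_prod_right' (f := fun z : Euc N × ℝ => h (z.1 + z.2 • ν))
      (hh.comp (by fun_prop))
  refine (lintegral_mono' hmeas le_rfl).trans ?_
  rw [lintegral_smul_measure, lintegral_map hHm hG.continuous.measurable, smul_eq_mul]
  refine mul_le_mul_right ?_ _
  have hDm : MeasurableSet D := hDo.measurableSet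
  have hh' : Measurable (D.indicator h) := hh.indicator hDm
  calc ∫⁻ y in A, ∫⁻ s in Ioo 0 (ρ / 2), h (G y + s • ν)
      ≤ ∫⁻ y in A, ∫⁻ s, D.indicator h (s • ν + (y : Euc N)) := by
        refine setLIntegral_mono' hAm fun y hy => ?_
        -- Translation by `γ y` makes the line over `y` start at the graph. For positive `s` the
        -- point `G y + s • ν` then lies in `D`.
        rw [← lintegral_add_left_eq_self (μ := volume)
          (fun s : ℝ => D.indicator h (s • ν + (y : Euc N))) (γ y)]
        refine (setLIntegral_mono' measurableSet_Ioo fun s hs => ?_).trans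
          (setLIntegral_le_lintegral (Ioo 0 (ρ / 2)) _)
        have hyb : G y ∈ Metric.ball x₀ ρ := Metric.ball_subset_ball (by linarith) hy.1
        have hsb : G y + s • ν ∈ Metric.ball x₀ ρ := by
          have h1 : dist (G y) x₀ < ρ / 2 := hy.1
          have h2 : dist (G y + s • ν) (G y) = s := by
            rw [dist_eq_norm, add_sub_cancel_left, norm_smul, hν, mul_one, Real.norm_eq_abs,
              abs_of_pos hs.1]
          rw [Metric.mem_ball]
          linarith [dist_triangle (G y + s • ν) (G y) x₀, hs.2]
        have hmem : G y + s • ν ∈ D := by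
          rw [hD _ hsb, hproj, hinn (G y) s, hfr _ hy.2 hyb]
          linarith [hs.1]
        have he : (γ y + s) • ν + (y : Euc N) = G y + s • ν := by
          simp only [hGdef]; rw [add_smul]; abel
        rw [he, indicator_of_mem hmem]
    _ ≤ ∫⁻ y : (ℝ ∙ ν)ᗮ, ∫⁻ s, D.indicator h (s • ν + (y : Euc N)) := setLIntegral_le_lintegral _ _
    _ = ∫⁻ z : ℝ × (ℝ ∙ ν)ᗮ, D.indicator h (z.1 • ν + (z.2 : Euc N)) ∂(volume.prod volume) :=
        (lintegral_prod_symm (fun z : ℝ × (ℝ ∙ ν)ᗮ => D.indicator h (z.1 • ν + (z.2 : Euc N)))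
          (hh'.comp (measurePreserving_line_add_orthogonal hν).measurable).aemeasurable).symm
    _ = ∫⁻ x, D.indicator h x := (measurePreserving_line_add_orthogonal hν).lintegral_comp hh'
    _ = ∫⁻ x in D, h x := lintegral_indicator hDm _

/-- The value of a squared smooth function is controlled by line integrals. -/
lemma sq_le_lintegral_line {N : ℕ} {w : Euc N → ℝ} (hw : ContDiff ℝ (⊤ : ℕ∞) w) {ν : Euc N}
    (hν : ‖ν‖ = 1) {δ : ℝ} (hδ : 0 < δ) (p : Euc N) :
    ‖w p‖ₑ ^ 2 ≤ ENNReal.ofReal ((1 + δ) / δ) *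
      ∫⁻ s in Ioo 0 δ, (‖w (p + s • ν)‖ₑ ^ 2 + ‖gradient w (p + s • ν)‖ₑ ^ 2) := by
  have hwd : Differentiable ℝ w := hw.differentiable (by simp)
  have hgc : Continuous (gradient w) := by
    have : Continuous (fderiv ℝ w) := hw.continuous_fderiv (by simp)
    exact (InnerProductSpace.toDual ℝ (Euc N)).symm.continuous.comp this
  set q : ℝ → ℝ := fun s => w (p + s • ν) with hq
  set q' : ℝ → ℝ := fun s => ⟪gradient w (p + s • ν), ν⟫ with hq'
  have hqd : ∀ s, HasDerivAt q (q' s) s := by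
    intro s
    have h1 : HasDerivAt (fun s : ℝ => p + s • ν) ν s := by
      simpa using ((hasDerivAt_id s).smul_const ν).const_add p
    have h2 := (hwd (p + s • ν)).hasFDerivAt.comp_hasDerivAt s h1
    exact (h2 : HasDerivAt q _ s).congr_deriv (by simp [hq', inner_gradient_left])
  have hqc : Continuous q := hwd.continuous.comp (by fun_prop)
  have hgl : Continuous fun s : ℝ => gradient w (p + s • ν) := hgc.comp (by fun_prop)
  have hq'c : Continuous q' := hgl.inner continuous_const
  set k : ℝ → ℝ := fun s => q s ^ 2 + ‖gradient w (p + s • ν)‖ ^ 2 with hk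
  have hkc : Continuous k := (hqc.pow 2).add (hgl.norm.pow 2)
  -- The weight `s - δ` vanishes at the far end and equals `-δ` at the boundary point, so the
  -- boundary terms reduce to `δ * (w p)²`.
  have hint := intervalIntegral.integral_eq_sub_of_hasDerivAt (a := 0) (b := δ)
    (f := fun s => (s - δ) * q s ^ 2)
    (f' := fun s => q s ^ 2 + (s - δ) * (2 * q s * q' s))
    (fun s _ => by
      have := ((hasDerivAt_id s).sub_const δ).mul ((hqd s).pow 2)
      convert! this using 1
      simp)
    (Continuous.intervalIntegrable (by fun_prop) _ _)
  have hle : ∫ s in (0)..δ, (q s ^ 2 + (s - δ) * (2 * q s * q' s))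
      ≤ ∫ s in (0)..δ, (1 + δ) * k s := by
    refine intervalIntegral.integral_mono_on hδ.le
      (Continuous.intervalIntegrable (by fun_prop) _ _)
      (Continuous.intervalIntegrable (by fun_prop) _ _) fun s hs => ?_
    have h1 : |q' s| ≤ ‖gradient w (p + s • ν)‖ := by
      have := abs_real_inner_le_norm (gradient w (p + s • ν)) ν
      rwa [hν, mul_one] at this
    have h2 : q' s ^ 2 ≤ ‖gradient w (p + s • ν)‖ ^ 2 := by
      rw [← sq_abs (q' s)]; exact pow_le_pow_left₀ (abs_nonneg _) h1 2
    have h3 : -(2 * q s * q' s) ≤ k s := by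
      simp only [hk]; nlinarith [sq_nonneg (q s + q' s)]
    have h4 : 0 ≤ k s := by simp only [hk]; positivity
    have h5 : q s ^ 2 ≤ k s := by simp only [hk]; nlinarith [sq_nonneg ‖gradient w (p + s • ν)‖]
    have h6 : (s - δ) * (2 * q s * q' s) ≤ δ * k s := by
      have : (δ - s) * (-(2 * q s * q' s)) ≤ (δ - s) * k s :=
        mul_le_mul_of_nonneg_left h3 (by linarith [hs.2])
      nlinarith [hs.1]
    linarith
  rw [hint, intervalIntegral.integral_const_mul] at hle
  have hp : w p ^ 2 ≤ (1 + δ) / δ * ∫ s in Ioo 0 δ, k s := by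
    rw [integral_Ioo_eq_interval hδ.le, div_mul_eq_mul_div, le_div_iff₀ hδ]
    have : q 0 = w p := by simp [hq]
    rw [this] at hle
    linarith
  have hen : ‖w p‖ₑ ^ 2 = ENNReal.ofReal (w p ^ 2) := by
    rw [← ofReal_norm, ← ENNReal.ofReal_pow (norm_nonneg _), Real.norm_eq_abs, sq_abs]
  rw [hen]
  refine (ENNReal.ofReal_le_ofReal hp).trans ?_
  rw [ENNReal.ofReal_mul (by positivity)]
  refine mul_le_mul_right (le_of_eq ?_) _
  rw [ofReal_integral_eq_lintegral_ofReal (hkc.integrableOn_Icc.mono_set Ioo_subset_Icc_self)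
    (Eventually.of_forall fun s => by simp only [hk, Pi.zero_apply]; positivity)]
  refine lintegral_congr fun s => ?_
  simp only [hk]
  rw [ENNReal.ofReal_add (by positivity) (by positivity), ENNReal.ofReal_pow (norm_nonneg _),
    ofReal_norm, ← sq_abs, ENNReal.ofReal_pow (abs_nonneg _), ← Real.norm_eq_abs, ofReal_norm]

/-- The trace inequality for smooth functions. -/
theorem exists_lintegral_boundary_le {N : ℕ} {D : Set (Euc N)} (hDo : IsOpen D)
    (hDb : Bornology.IsBounded D) (hDL : IsLipschitzDomain D) :
    ∃ C : ℝ≥0, ∀ w : Euc N → ℝ, ContDiff ℝ (⊤ : ℕ∞) w →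
      ∫⁻ p, ‖w p‖ₑ ^ 2 ∂(surfMeasure D)
        ≤ C * ∫⁻ x, (‖w x‖ₑ ^ 2 + ‖gradient w x‖ₑ ^ 2) ∂(domMeasure D) := by
  have hcomp : IsCompact (frontier D) :=
    Metric.isCompact_of_isClosed_isBounded isClosed_frontier
      (hDb.closure.subset frontier_subset_closure)
  suffices h : ∃ C : ℝ≥0, ∀ w : Euc N → ℝ, ContDiff ℝ (⊤ : ℕ∞) w →
      ∫⁻ p in frontier D, ‖w p‖ₑ ^ 2 ∂(surfMeasure D)
        ≤ C * ∫⁻ x, (‖w x‖ₑ ^ 2 + ‖gradient w x‖ₑ ^ 2) ∂(domMeasure D) by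
    simpa [surfMeasure, Measure.restrict_restrict isClosed_frontier.measurableSet] using h
  -- The property passes to subsets and to unions of two sets. By compactness of the boundary it
  -- suffices to have it near each boundary point.
  refine hcomp.induction_on (p := fun S => ∃ C : ℝ≥0, ∀ w : Euc N → ℝ, ContDiff ℝ (⊤ : ℕ∞) w →
      ∫⁻ p in S, ‖w p‖ₑ ^ 2 ∂(surfMeasure D)
        ≤ C * ∫⁻ x, (‖w x‖ₑ ^ 2 + ‖gradient w x‖ₑ ^ 2) ∂(domMeasure D)) ?_ ?_ ?_ ?_
  · exact ⟨0, fun w _ => by simp⟩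
  · rintro s t hst ⟨C, hC⟩
    exact ⟨C, fun w hw => (lintegral_mono_set hst).trans (hC w hw)⟩
  · rintro s t ⟨C, hC⟩ ⟨C', hC'⟩
    refine ⟨C + C', fun w hw => (lintegral_union_le _ _ _).trans ?_⟩
    rw [ENNReal.coe_add, add_mul]
    exact add_le_add (hC w hw) (hC' w hw)
  · intro x₀ hx₀
    obtain ⟨ν, hν, δ, hδ, C, hC⟩ := exists_transversal_lintegral_le hDo hDL hx₀
    refine ⟨Metric.ball x₀ δ, mem_nhdsWithin_of_mem_nhds (Metric.ball_mem_nhds x₀ hδ),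
      Real.toNNReal ((1 + δ) / δ) * C, fun w hw => ?_⟩
    have hgc : Continuous (gradient w) :=
      (InnerProductSpace.toDual ℝ (Euc N)).symm.continuous.comp (hw.continuous_fderiv (by simp))
    have hm : Measurable fun x => ‖w x‖ₑ ^ 2 + ‖gradient w x‖ₑ ^ 2 := by
      have := hw.continuous
      fun_prop
    calc ∫⁻ p in Metric.ball x₀ δ, ‖w p‖ₑ ^ 2 ∂(surfMeasure D)
        ≤ ∫⁻ p in Metric.ball x₀ δ, (ENNReal.ofReal ((1 + δ) / δ) *
          ∫⁻ s in Ioo 0 δ, (‖w (p + s • ν)‖ₑ ^ 2 + ‖gradient w (p + s • ν)‖ₑ ^ 2))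
            ∂(surfMeasure D) := lintegral_mono fun p => sq_le_lintegral_line hw hν hδ p
      _ = ENNReal.ofReal ((1 + δ) / δ) * ∫⁻ p in Metric.ball x₀ δ, (∫⁻ s in Ioo 0 δ,
          (‖w (p + s • ν)‖ₑ ^ 2 + ‖gradient w (p + s • ν)‖ₑ ^ 2)) ∂(surfMeasure D) :=
          lintegral_const_mul' _ _ ENNReal.ofReal_ne_top
      _ ≤ ENNReal.ofReal ((1 + δ) / δ) * (C * ∫⁻ x, (‖w x‖ₑ ^ 2 + ‖gradient w x‖ₑ ^ 2)
          ∂(domMeasure D)) := mul_le_mul_right (hC _ hm) _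
      _ = _ := by rw [← mul_assoc, ENNReal.coe_mul]; rfl

/-- The trace inequality applied to the constant function one bounds the surface area by a multiple
of the volume. -/
lemma isFiniteMeasure_surfMeasure {N : ℕ} {D : Set (Euc N)} (hDo : IsOpen D)
    (hDb : Bornology.IsBounded D) (hDL : IsLipschitzDomain D) : IsFiniteMeasure (surfMeasure D) := by
  obtain ⟨C, hC⟩ := exists_lintegral_boundary_le hDo hDb hDL
  have h := hC (fun _ => 1) contDiff_const
  refine ⟨lt_of_le_of_lt (le_of_eq (by simp)) (h.trans_lt ?_)⟩
  simpa using ENNReal.mul_lt_top ENNReal.coe_lt_top hDb.measure_lt_top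

lemma norm_W1_eq {N : ℕ} {D : Set (Euc N)} {p : ℝ≥0∞} [Fact (1 ≤ p)] (u : W1 D p) :
    ‖u‖ = ‖val u‖ + ‖grad u‖ := by
  have := WithLp.prod_norm_eq_add (p := 1) (by norm_num) u.1
  simpa using this

/-- The trace inequality. -/
theorem exists_norm_trace_le {N : ℕ} {D : Set (Euc N)} (hDo : IsOpen D)
    (hDb : Bornology.IsBounded D) (hDL : IsLipschitzDomain D) :
    ∃ C : ℝ, 0 ≤ C ∧ ∀ (u : H1 D) (v : Lp ℝ 2 (surfMeasure D)), IsTrace D u v →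
      ‖v‖ ≤ C * ‖u‖ := by
  obtain ⟨C, hC⟩ := exists_lintegral_boundary_le hDo hDb hDL
  have hL2 : ∀ {X F : Type} [MeasurableSpace X] [NormedAddCommGroup F] (μ : Measure X) (f : X → F),
      eLpNorm f 2 μ = (∫⁻ x, ‖f x‖ₑ ^ 2 ∂μ) ^ (1 / 2 : ℝ) := fun μ f => by
    rw [eLpNorm_eq_lintegral_rpow_enorm_toReal (by simp) (by simp)]; simp
  have hsm : ∀ w : Euc N → ℝ, ContDiff ℝ (⊤ : ℕ∞) w → eLpNorm w 2 (surfMeasure D)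
      ≤ ENNReal.ofReal (Real.sqrt C) * (eLpNorm w 2 (domMeasure D)
        + eLpNorm (gradient w) 2 (domMeasure D)) := by
    intro w hw
    rw [hL2, hL2, hL2]
    refine (ENNReal.rpow_le_rpow (hC w hw) (by norm_num)).trans ?_
    rw [ENNReal.mul_rpow_of_nonneg _ _ (by norm_num), Real.sqrt_eq_rpow,
      ← ENNReal.ofReal_rpow_of_nonneg C.coe_nonneg (by norm_num), ENNReal.ofReal_coe_nnreal,
      lintegral_add_left (by have := hw.continuous; fun_prop)]
    exact mul_le_mul_right (ENNReal.rpow_add_le_add_rpow _ _ (by norm_num) (by norm_num)) _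
  refine ⟨Real.sqrt C, Real.sqrt_nonneg _, fun u v huv => ?_⟩
  obtain ⟨w, hw, h1, h2, h3⟩ := huv
  set c := ENNReal.ofReal (Real.sqrt C) with hc
  have hgc : ∀ n, Continuous (gradient (w n)) := fun n =>
    (InnerProductSpace.toDual ℝ (Euc N)).symm.continuous.comp ((hw n).continuous_fderiv (by simp))
  -- The inequality for the smooth approximants is combined with triangle inequalities on the
  -- boundary and in the interior. All error terms tend to zero by the definition of a trace.
  have key : ∀ n, eLpNorm v 2 (surfMeasure D) ≤
      eLpNorm (fun x => w n x - v x) 2 (surfMeasure D) +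
      c * ((eLpNorm (fun x => w n x - val u x) 2 (domMeasure D) + eLpNorm (val u) 2 (domMeasure D))
        + (eLpNorm (fun x => gradient (w n) x - grad u x) 2 (domMeasure D)
          + eLpNorm (grad u) 2 (domMeasure D))) := by
    intro n
    have m1 : AEStronglyMeasurable (w n) (surfMeasure D) := (hw n).continuous.aestronglyMeasurable
    have m2 : AEStronglyMeasurable (w n) (domMeasure D) := (hw n).continuous.aestronglyMeasurable
    have m3 : AEStronglyMeasurable (gradient (w n)) (domMeasure D) :=
      (hgc n).aestronglyMeasurable
    have e1 : eLpNorm v 2 (surfMeasure D) ≤ eLpNorm (fun x => w n x - v x) 2 (surfMeasure D)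
        + eLpNorm (w n) 2 (surfMeasure D) := by
      have := eLpNorm_sub_le (p := 2) m1 (m1.sub (Lp.aestronglyMeasurable v)) (by norm_num)
      rw [sub_sub_cancel, add_comm] at this
      exact this
    have e2 : eLpNorm (w n) 2 (domMeasure D) ≤ eLpNorm (fun x => w n x - val u x) 2 (domMeasure D)
        + eLpNorm (val u) 2 (domMeasure D) := by
      have := eLpNorm_add_le (p := 2) (m2.sub (Lp.aestronglyMeasurable (val u)))
        (Lp.aestronglyMeasurable (val u)) (by norm_num)
      rw [sub_add_cancel] at this
      exact this
    have e3 : eLpNorm (gradient (w n)) 2 (domMeasure D) ≤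
        eLpNorm (fun x => gradient (w n) x - grad u x) 2 (domMeasure D)
        + eLpNorm (grad u) 2 (domMeasure D) := by
      have := eLpNorm_add_le (p := 2) (m3.sub (Lp.aestronglyMeasurable (grad u)))
        (Lp.aestronglyMeasurable (grad u)) (by norm_num)
      rw [sub_add_cancel] at this
      exact this
    exact e1.trans (add_le_add_right ((hsm _ (hw n)).trans
      (mul_le_mul_right (add_le_add e2 e3) _)) _)
  have hlim : Tendsto (fun n => eLpNorm (fun x => w n x - v x) 2 (surfMeasure D) +
      c * ((eLpNorm (fun x => w n x - val u x) 2 (domMeasure D) + eLpNorm (val u) 2 (domMeasure D))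
        + (eLpNorm (fun x => gradient (w n) x - grad u x) 2 (domMeasure D)
          + eLpNorm (grad u) 2 (domMeasure D)))) atTop
      (𝓝 (0 + c * ((0 + eLpNorm (val u) 2 (domMeasure D))
        + (0 + eLpNorm (grad u) 2 (domMeasure D))))) :=
    h3.add (ENNReal.Tendsto.const_mul ((h1.add tendsto_const_nhds).add
      (h2.add tendsto_const_nhds)) (Or.inr ENNReal.ofReal_ne_top))
  have hfin := ge_of_tendsto' hlim key
  simp only [zero_add, ← Lp.enorm_def] at hfin
  rw [← ofReal_norm, ← ofReal_norm, ← ofReal_norm, ← ENNReal.ofReal_add (norm_nonneg _)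
    (norm_nonneg _), hc, ← ENNReal.ofReal_mul (Real.sqrt_nonneg _),
    ENNReal.ofReal_le_ofReal_iff (by positivity)] at hfin
  rw [norm_W1_eq]
  exact hfin

/-! ### Elementary facts on Lebesgue spaces -/

lemma norm_sq_eq_integral {X F : Type*} [MeasurableSpace X] {μ : Measure X} [NormedAddCommGroup F]
    (h : Lp F 2 μ) : ‖h‖ ^ 2 = ∫ x, ‖h x‖ ^ 2 ∂μ := by
  rw [Lp.norm_def, (Lp.memLp h).eLpNorm_eq_integral_rpow_norm (by simp) (by simp),
    ENNReal.toReal_ofReal (by positivity), ← Real.rpow_natCast, ← Real.rpow_mul (by positivity)]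
  simp

lemma integrable_norm_sq {X F : Type*} [MeasurableSpace X] {μ : Measure X} [NormedAddCommGroup F]
    (h : Lp F 2 μ) : Integrable (fun x => ‖h x‖ ^ 2) μ :=
  (Lp.memLp h).integrable_norm_pow (p := 2) (by norm_num)

lemma ae_norm_le_norm {X F : Type*} [MeasurableSpace X] {μ : Measure X} [NormedAddCommGroup F]
    (h : Lp F ∞ μ) : ∀ᵐ x ∂μ, ‖h x‖ ≤ ‖h‖ := by
  have hfin := (Lp.memLp h).2.ne
  filter_upwards [ae_le_eLpNormEssSup (f := h) (μ := μ)] with x hx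
  rw [Lp.norm_def, ← toReal_enorm]
  refine ENNReal.toReal_mono hfin ?_
  rwa [eLpNorm_exponent_top]

lemma ae_ae_norm_le_norm {X Y : Type*} [MeasurableSpace X] [MeasurableSpace Y] {μ : Measure X}
    {ν : Measure Y} [SFinite ν] (h : Lp ℝ ∞ (μ.prod ν)) :
    ∀ᵐ t ∂μ, ∀ᵐ x ∂ν, |h (t, x)| ≤ ‖h‖ :=
  Measure.ae_ae_of_ae_prod (ae_norm_le_norm h)

lemma ae_ae_sub_le_norm {X Y : Type*} [MeasurableSpace X] [MeasurableSpace Y] {μ : Measure X}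
    {ν : Measure Y} [SFinite ν] (h k : Lp ℝ ∞ (μ.prod ν)) :
    ∀ᵐ t ∂μ, ∀ᵐ x ∂ν, |h (t, x) - k (t, x)| ≤ ‖h - k‖ := by
  refine Measure.ae_ae_of_ae_prod (p := fun z => |h z - k z| ≤ ‖h - k‖) ?_
  filter_upwards [ae_norm_le_norm (h - k), Lp.coeFn_sub h k] with z h1 h2
  rwa [h2] at h1

/-- The canonical representative is strongly measurable on the product itself. Its sections are
therefore measurable for every `t`, with respect to any measure, and not merely for almost every
`t`. -/
lemma aestronglyMeasurable_section {X Y F : Type*} [MeasurableSpace X] [MeasurableSpace Y]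
    [NormedAddCommGroup F] {μ : Measure X} {ν : Measure Y} {p : ℝ≥0∞} (h : Lp F p (μ.prod ν))
    (t : X) (ρ : Measure Y) : AEStronglyMeasurable (fun x => h (t, x)) ρ :=
  ((Lp.stronglyMeasurable h).comp_measurable measurable_prodMk_left).aestronglyMeasurable

lemma integrable_Lp_dual_apply {X E : Type*} [MeasurableSpace X] {μ : Measure X} [IsFiniteMeasure μ]
    [NormedAddCommGroup E] [NormedSpace ℝ E] (w : Lp (E →L[ℝ] ℝ) 2 μ) (φ : E) :
    Integrable (fun t => w t φ) μ :=
  ((Lp.memLp w).integrable (by norm_num)).apply_continuousLinearMap φ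

lemma Lp_dual_sub_apply_ae {X E : Type*} [MeasurableSpace X] {μ : Measure X}
    [NormedAddCommGroup E] [NormedSpace ℝ E] (w w' : Lp (E →L[ℝ] ℝ) 2 μ) :
    ∀ᵐ t ∂μ, ∀ φ, (w - w') t φ = w t φ - w' t φ := by
  filter_upwards [Lp.coeFn_sub w w'] with t ht φ
  rw [ht]; rfl

lemma integrable_bdd_mul_mul {X : Type*} [MeasurableSpace X] {μ : Measure X} {b p q : X → ℝ} {c : ℝ}
    (hb : AEStronglyMeasurable b μ) (hc : ∀ᵐ x ∂μ, |b x| ≤ c) (hp : MemLp p 2 μ)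
    (hq : MemLp q 2 μ) : Integrable (fun x => b x * p x * q x) μ := by
  have := (hp.integrable_mul hq).bdd_mul hb hc
  refine this.congr (Eventually.of_forall fun x => ?_)
  simp only [Pi.mul_apply]; ring

lemma IsDistribDeriv.sub {E H : Type*} [NormedAddCommGroup E] [NormedSpace ℝ E]
    [NormedAddCommGroup H] [InnerProductSpace ℝ H] {ι : E →L[ℝ] H} {T : ℝ}
    {u u' : Lp E 2 (timeMeasure T)} {w w' : Lp (E →L[ℝ] ℝ) 2 (timeMeasure T)}
    (h : IsDistribDeriv ι T u w) (h' : IsDistribDeriv ι T u' w') :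
    IsDistribDeriv ι T ⇑(u - u') ⇑(w - w') := by
  intro φ η hη hc hs
  have hb : ∀ {ζ : ℝ → ℝ}, Continuous ζ → HasCompactSupport ζ → ∀ {q : ℝ → ℝ},
      Integrable q (timeMeasure T) → Integrable (fun t => ζ t * q t) (timeMeasure T) := by
    intro ζ hζ hζc q hq
    obtain ⟨c, hc⟩ := hζ.bounded_above_of_compact_support hζc
    exact hq.bdd_mul hζ.aestronglyMeasurable (Eventually.of_forall hc)
  have hη' : Continuous (deriv η) := hη.continuous_deriv (by simp)
  have i1 : ∀ u : Lp E 2 (timeMeasure T), Integrable (fun t => ⟪ι (u t), ι φ⟫) (timeMeasure T) :=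
    fun u => ((ι.integrable_comp ((Lp.memLp u).integrable (by norm_num)))).inner_const _
  have s1 : ∫ t, deriv η t * ⟪ι ((u - u') t), ι φ⟫ ∂(timeMeasure T)
      = ∫ t, (deriv η t * ⟪ι (u t), ι φ⟫ - deriv η t * ⟪ι (u' t), ι φ⟫) ∂(timeMeasure T) := by
    refine integral_congr_ae ?_
    filter_upwards [Lp.coeFn_sub u u'] with t ht
    rw [ht, Pi.sub_apply, map_sub, inner_sub_left]; ring
  have s2 : ∫ t, η t * (w - w') t φ ∂(timeMeasure T)
      = ∫ t, (η t * w t φ - η t * w' t φ) ∂(timeMeasure T) := by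
    refine integral_congr_ae ?_
    filter_upwards [Lp_dual_sub_apply_ae w w'] with t ht
    rw [ht]; ring
  rw [s1, s2, integral_sub (hb hη' hc.deriv (i1 u)) (hb hη' hc.deriv (i1 u')),
    integral_sub (hb hη.continuous hc (integrable_Lp_dual_apply w φ))
      (hb hη.continuous hc (integrable_Lp_dual_apply w' φ)), h φ η hη hc hs, h' φ η hη hc hs]
  ring

/-! ### Spatial Sobolev spaces -/

section Sobolev

variable {N : ℕ} {D : Set (Euc N)}

/-- The embedding `W^{1,p}(D) → L^p(D)`. -/
def valL (D : Set (Euc N)) (p : ℝ≥0∞) [Fact (1 ≤ p)] : W1 D p →L[ℝ] Lp ℝ p (domMeasure D) :=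
  (WithLp.fstL 1 ℝ _ _).comp (sobolev D p).subtypeL

/-- The weak gradient as a continuous linear map. -/
def gradL (D : Set (Euc N)) (p : ℝ≥0∞) [Fact (1 ≤ p)] :
    W1 D p →L[ℝ] Lp (Euc N) p (domMeasure D) :=
  (WithLp.sndL 1 ℝ _ _).comp (sobolev D p).subtypeL

@[simp] lemma valL_apply {p : ℝ≥0∞} [Fact (1 ≤ p)] (u : W1 D p) : valL D p u = val u := rfl

@[simp] lemma gradL_apply {p : ℝ≥0∞} [Fact (1 ≤ p)] (u : W1 D p) : gradL D p u = grad u := rfl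

lemma norm_grad_le {p : ℝ≥0∞} [Fact (1 ≤ p)] (u : W1 D p) : ‖grad u‖ ≤ ‖u‖ := by
  rw [norm_W1_eq]; linarith [norm_nonneg (val u)]

lemma norm_val_le {p : ℝ≥0∞} [Fact (1 ≤ p)] (u : W1 D p) : ‖val u‖ ≤ ‖u‖ := by
  rw [norm_W1_eq]; linarith [norm_nonneg (grad u)]

lemma norm_sq_H1_le (u : H1 D) : ‖u‖ ^ 2 ≤ 2 * (‖val u‖ ^ 2 + ‖grad u‖ ^ 2) := by
  rw [norm_W1_eq]; nlinarith [sq_nonneg (‖val u‖ - ‖grad u‖)]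

lemma integral_mul_eq_inner (u φ : H1 D) :
    ∫ x, val u x * val φ x ∂(domMeasure D) = ⟪valL D 2 u, valL D 2 φ⟫ := by
  rw [L2.inner_def]
  refine integral_congr_ae (Eventually.of_forall fun x => ?_)
  simp [mul_comm]

lemma val_sub_ae {p : ℝ≥0∞} [Fact (1 ≤ p)] (u v : W1 D p) :
    ∀ᵐ x ∂(domMeasure D), val (u - v) x = val u x - val v x :=
  Lp.coeFn_sub (val u) (val v)

lemma grad_sub_ae {p : ℝ≥0∞} [Fact (1 ≤ p)] (u v : W1 D p) :
    ∀ᵐ x ∂(domMeasure D), grad (u - v) x = grad u x - grad v x :=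
  Lp.coeFn_sub (grad u) (grad v)

/-- This makes `(u₁ - u₂, v₁ - v₂)` a legitimate test pair in both boundary value problems. The
approximating sequences are simply subtracted, so uniqueness of traces plays no role. -/
lemma IsTrace.sub {u u' : H1 D} {v v' : Lp ℝ 2 (surfMeasure D)} (h : IsTrace D u v)
    (h' : IsTrace D u' v') : IsTrace D (u - u') (v - v') := by
  obtain ⟨w, hw, h1, h2, h3⟩ := h
  obtain ⟨w', hw', h1', h2', h3'⟩ := h'
  have aux : ∀ {X F : Type} [MeasurableSpace X] [NormedAddCommGroup F] {μ : Measure X}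
      {a b c : ℕ → X → F} (_ : ∀ n, AEStronglyMeasurable (a n) μ)
      (_ : ∀ n, AEStronglyMeasurable (b n) μ) (_ : ∀ n, c n =ᵐ[μ] a n - b n)
      (_ : Tendsto (fun n => eLpNorm (a n) 2 μ) atTop (𝓝 0))
      (_ : Tendsto (fun n => eLpNorm (b n) 2 μ) atTop (𝓝 0)),
      Tendsto (fun n => eLpNorm (c n) 2 μ) atTop (𝓝 0) := by
    intro X F _ _ μ a b c ha hb hc la lb
    have hab := la.add lb
    rw [add_zero] at hab
    refine tendsto_of_tendsto_of_tendsto_of_le_of_le tendsto_const_nhds hab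
      (fun n => zero_le) fun n => ?_
    rw [eLpNorm_congr_ae (hc n)]
    exact eLpNorm_sub_le (ha n) (hb n) (by norm_num)
  have hgc : ∀ {w : Euc N → ℝ}, ContDiff ℝ (⊤ : ℕ∞) w → Continuous (gradient w) := fun hw =>
    (InnerProductSpace.toDual ℝ (Euc N)).symm.continuous.comp (hw.continuous_fderiv (by simp))
  have hgsub : ∀ n x, gradient (w n - w' n) x = gradient (w n) x - gradient (w' n) x := by
    intro n x
    simp only [gradient]
    rw [fderiv_sub ((hw n).differentiable (by simp) x) ((hw' n).differentiable (by simp) x), map_sub]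
  refine ⟨fun n => w n - w' n, fun n => (hw n).sub (hw' n), aux (fun n => ?_) (fun n => ?_)
    (fun n => ?_) h1 h1', aux (fun n => ?_) (fun n => ?_) (fun n => ?_) h2 h2',
    aux (fun n => ?_) (fun n => ?_) (fun n => ?_) h3 h3'⟩
  · exact (hw n).continuous.aestronglyMeasurable.sub (Lp.aestronglyMeasurable _)
  · exact (hw' n).continuous.aestronglyMeasurable.sub (Lp.aestronglyMeasurable _)
  · filter_upwards [val_sub_ae u u'] with x hx
    simp only [Pi.sub_apply]; rw [hx]; ring
  · exact (hgc (hw n)).aestronglyMeasurable.sub (Lp.aestronglyMeasurable _)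
  · exact (hgc (hw' n)).aestronglyMeasurable.sub (Lp.aestronglyMeasurable _)
  · filter_upwards [grad_sub_ae u u'] with x hx
    simp only [Pi.sub_apply]; rw [hx, hgsub]; abel
  · exact (hw n).continuous.aestronglyMeasurable.sub (Lp.aestronglyMeasurable _)
  · exact (hw' n).continuous.aestronglyMeasurable.sub (Lp.aestronglyMeasurable _)
  · filter_upwards [Lp.coeFn_sub v v'] with x hx
    simp only [Pi.sub_apply]; rw [hx, Pi.sub_apply]; ring

end Sobolev

/-! ### The evolution estimate -/

section Evolution

variable {N : ℕ} {D : Set (Euc N)} {T : ℝ}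

lemma IsTimeDeriv.isDistribDeriv {u : L2H1 D T} {w : Lp (H1Dual D) 2 (timeMeasure T)}
    (h : IsTimeDeriv u w) : IsDistribDeriv (valL D 2) T u w := by
  intro φ η h1 h2 h3
  rw [← h φ η h1 h2 h3]
  simp only [integral_mul_eq_inner]

lemma IsTimeDeriv.sub {u u' : L2H1 D T} {w w' : Lp (H1Dual D) 2 (timeMeasure T)}
    (h : IsTimeDeriv u w) (h' : IsTimeDeriv u' w') : IsTimeDeriv (u - u') (w - w') := by
  intro φ η hη hc hs
  simp only [integral_mul_eq_inner]
  exact IsDistribDeriv.sub h.isDistribDeriv h'.isDistribDeriv φ η hη hc hs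

lemma HasInitialValue.sub {u u' : L2H1 D T} {a a' : Lp ℝ 2 (domMeasure D)}
    (h : HasInitialValue u a) (h' : HasInitialValue u' a') : HasInitialValue (u - u') (a - a') := by
  obtain ⟨U, h1, h2, h3⟩ := h
  obtain ⟨U', h1', h2', h3'⟩ := h'
  refine ⟨fun t => U t - U' t, h1.sub h1', by simp only [h2, h2'], ?_⟩
  filter_upwards [h3, h3', Lp.coeFn_sub u u'] with t k1 k2 k3
  rw [k1, k2, k3]; rfl

/-- The parabolic energy estimate. -/
theorem norm_sq_le_of_energy_inequality (hT : 0 < T) {u : L2H1 D T} {a : Lp ℝ 2 (domMeasure D)}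
    {w : Lp (H1Dual D) 2 (timeMeasure T)} (ha : HasInitialValue u a) (hw : IsTimeDeriv u w)
    {m k : ℝ → ℝ} (hm : Integrable m (timeMeasure T)) (hk : Integrable k (timeMeasure T))
    (hm0 : ∀ t, 0 ≤ m t) (hk0 : ∀ t, 0 ≤ k t)
    (h : ∀ᵐ t ∂(timeMeasure T),
      2 * w t (u t) ≤ -(1 / 2 * ‖grad (u t)‖ ^ 2) + m t * ‖val (u t)‖ ^ 2 + k t) :
    ‖u‖ ^ 2 ≤ 2 * (T + 2) * (Real.exp (∫ t, m t ∂(timeMeasure T)) *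
      (‖a‖ ^ 2 + ∫ t, k t ∂(timeMeasure T))) := by
  obtain ⟨U, hUc, rfl, hU⟩ := ha
  set Q : ℝ := Real.exp (∫ t, m t ∂(timeMeasure T)) * (‖U 0‖ ^ 2 + ∫ t, k t ∂(timeMeasure T))
    with hQ
  have hIk : 0 ≤ ∫ t, k t ∂(timeMeasure T) := integral_nonneg hk0
  have hQ0 : 0 ≤ Q := by positivity
  have hum := Lp.stronglyMeasurable u
  have hi : ∀ {q : ℝ → ℝ}, Integrable q (timeMeasure T) → ∀ b ∈ Icc 0 T,
      IntervalIntegrable q volume 0 b := fun hq b hb => by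
    rw [intervalIntegrable_iff_integrableOn_Ioo_of_le hb.1]
    exact IntegrableOn.mono_set hq (Ioo_subset_Ioo_right hb.2)
  have hGi : Integrable (fun t => ‖grad (u t)‖ ^ 2) (timeMeasure T) := by
    have := ((Lp.memLp u).continuousLinearMap_comp (gradL D 2)).integrable_norm_pow
      (p := 2) (by norm_num)
    simpa using this
  have hwi : Integrable (fun t => w t (u t)) (timeMeasure T) :=
    integrable_dual_apply (Lp.memLp w) (Lp.memLp u)
  have hsub : ∀ {q : ℝ → ℝ}, Integrable q (timeMeasure T) → (∀ t, 0 ≤ q t) → ∀ b ∈ Icc 0 T,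
      ∫ t in (0)..b, q t ≤ ∫ t, q t ∂(timeMeasure T) := fun hq h0 b hb => by
    rw [← integral_Ioo_eq_interval hb.1]
    exact setIntegral_mono_set hq (Eventually.of_forall h0)
      (Eventually.of_forall (Ioo_subset_Ioo_right hb.2))
  have hae : ∀ b ∈ Icc 0 T, ∀ {p : ℝ → Prop}, (∀ᵐ t ∂(timeMeasure T), p t) →
      ∀ᵐ t ∂(volume.restrict (Icc 0 b)), p t := fun b hb p hp => by
    rw [← restrict_Ioo_eq_restrict_Icc]
    exact ae_restrict_of_ae_restrict_of_subset (Ioo_subset_Ioo_right hb.2) hp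
  have hyc : ContinuousOn (fun t => ‖U t‖ ^ 2) (Icc 0 T) := hUc.norm.pow 2
  -- Gronwall's inequality is applied to `‖U‖²`, keeping half of the gradient term as the
  -- dissipation `G`. It is used on `[0, b]` with `b < T`, the range covered by the energy identity.
  have hbound : ∀ b, 0 ≤ b → b < T → ‖U b‖ ^ 2 + ∫ t in (0)..b, 1 / 2 * ‖grad (u t)‖ ^ 2 ≤ Q := by
    intro b hb0 hbT
    have hb : b ∈ Icc 0 T := ⟨hb0, hbT.le⟩
    have hsubI : Icc 0 b ⊆ Icc 0 T := Icc_subset_Icc_right hbT.le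
    have hgr := gronwall_integral hb0 (hyc.mono hsubI) (hi hm b hb) (hi hk b hb) hm0 hk0
      (G := fun t => 1 / 2 * ‖grad (u t)‖ ^ 2) (fun t => by positivity) (fun s hs => by
        have hs' : s ∈ Icc 0 T := hsubI hs
        have hen := energy_identity hT hUc (ι := valL D 2) hU (Lp.memLp u) (Lp.memLp w) hum
          (Lp.stronglyMeasurable w) hw.isDistribDeriv hs.1 (hs.2.trans_lt hbT)
        have my : IntervalIntegrable (fun t => m t * ‖U t‖ ^ 2 + k t) volume 0 s :=
          ((hi hm s hs').mul_continuousOn (by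
            rw [uIcc_of_le hs.1]; exact hyc.mono (Icc_subset_Icc_right hs'.2))).add (hi hk s hs')
        rw [hen, ← intervalIntegral.integral_const_mul, add_assoc,
          ← intervalIntegral.integral_add ((hi hwi s hs').const_mul 2)
            ((hi hGi s hs').const_mul (1 / 2))]
        refine add_le_add_right (intervalIntegral.integral_mono_ae_restrict hs.1
          (((hi hwi s hs').const_mul 2).add ((hi hGi s hs').const_mul (1 / 2))) my ?_) _
        filter_upwards [hae s hs' h, hae s hs' hU] with t h1 h2
        rw [h2]
        linarith)
    refine hgr.trans ?_
    have e1 := hsub hm hm0 b hb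
    have e2 := hsub hk hk0 b hb
    have e3 : 0 ≤ ∫ t in (0)..b, k t := intervalIntegral.integral_nonneg hb0 fun t _ => hk0 t
    exact mul_le_mul (Real.exp_le_exp.2 e1) (by linarith) (by positivity) (by positivity)
  have hui : Integrable (fun t => ‖u t‖ ^ 2) (timeMeasure T) := integrable_norm_sq u
  -- The factor `2 (T + 2)` arises from `‖u‖² ≤ 2 (‖val u‖² + ‖grad u‖²)`: the first part
  -- contributes `2 T Q` by the pointwise bound, the second `4 Q` by the dissipation bound.
  have hb2 : ∀ b ∈ Ico 0 T, ∫ t in (0)..b, ‖u t‖ ^ 2 ≤ 2 * (T + 2) * Q := by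
    intro b hb
    have hb' : b ∈ Icc 0 T := ⟨hb.1, hb.2.le⟩
    have iG := (hi hGi b hb').const_mul 2
    have hle : ∫ t in (0)..b, ‖u t‖ ^ 2 ≤ ∫ t in (0)..b, (2 * Q + 2 * ‖grad (u t)‖ ^ 2) := by
      refine intervalIntegral.integral_mono_ae_restrict hb.1 (hi hui b hb')
        (intervalIntegrable_const.add iG) ?_
      filter_upwards [hae b hb' hU, ae_restrict_mem measurableSet_Icc] with t h1 h2
      have h3 := hbound t h2.1 (h2.2.trans_lt hb.2)
      have h4 : 0 ≤ ∫ s in (0)..t, 1 / 2 * ‖grad (u s)‖ ^ 2 :=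
        intervalIntegral.integral_nonneg h2.1 fun s _ => by positivity
      rw [h1] at h3
      have h5 := norm_sq_H1_le (u t)
      linarith
    rw [intervalIntegral.integral_add intervalIntegrable_const iG,
      intervalIntegral.integral_const, intervalIntegral.integral_const_mul] at hle
    have h3 := hbound b hb.1 hb.2
    rw [intervalIntegral.integral_const_mul] at h3
    have h4 : 0 ≤ ‖U b‖ ^ 2 := by positivity
    have h5 : b * Q ≤ T * Q := mul_le_mul_of_nonneg_right hb.2.le hQ0
    simp only [sub_zero, smul_eq_mul] at hle
    nlinarith
  rw [norm_sq_eq_integral, integral_Ioo_eq_interval hT.le]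
  -- Letting `b` increase to `T` extends the bound to the full interval.
  have hcont := intervalIntegral.continuousOn_primitive_interval (a := 0) (b := T)
    (f := fun t => ‖u t‖ ^ 2) (μ := volume) (by
      rw [uIcc_of_le hT.le, integrableOn_Icc_iff_integrableOn_Ioo]; exact hui)
  rw [uIcc_of_le hT.le] at hcont
  have hlim : Tendsto (fun b => ∫ t in (0)..b, ‖u t‖ ^ 2) (𝓝[<] T)
      (𝓝 (∫ t in (0)..T, ‖u t‖ ^ 2)) :=
    (hcont T (right_mem_Icc.2 hT.le)).mono_left (nhdsWithin_le_of_mem (by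
      filter_upwards [Ioo_mem_nhdsLT hT] with x hx using Ioo_subset_Icc_self hx))
  refine le_of_tendsto hlim ?_
  filter_upwards [Ioo_mem_nhdsLT hT] with b hb using hb2 b ⟨hb.1.le, hb.2⟩

end Evolution

/-! ### Estimates of the spatial terms -/

lemma integrable_inner_of_memLp {X F : Type*} [MeasurableSpace X] {μ : Measure X}
    [NormedAddCommGroup F] [InnerProductSpace ℝ F] {a b : X → F} (ha : MemLp a 2 μ)
    (hb : MemLp b 2 μ) : Integrable (fun x => ⟪a x, b x⟫) μ := by
  refine (ha.norm.integrable_mul hb.norm).mono (ha.1.inner hb.1) (Eventually.of_forall fun x => ?_)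
  simpa using norm_inner_le_norm (𝕜 := ℝ) (a x) (b x)

section Spatial

variable {N : ℕ} {D : Set (Euc N)} [IsFiniteMeasure (domMeasure D)]

lemma memLp_flux {f : ℝ → ℝ} {B : ℝ} (hfB : ∀ s, |f s| ≤ B) (hfc : Continuous f) (u : H1 D)
    (V : W1 D ∞) :
    MemLp (fun x => -grad u x + f (val u x) • grad V x) 2 (domMeasure D) := by
  refine (Lp.memLp (grad u)).neg.add (MemLp.of_bound ?_ (B * ‖grad V‖) ?_)
  · exact (hfc.comp_aestronglyMeasurable (Lp.aestronglyMeasurable _)).smul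
      (Lp.aestronglyMeasurable _)
  · filter_upwards [ae_norm_le_norm (grad V)] with x hx
    rw [norm_smul]
    exact mul_le_mul (hfB _) hx (norm_nonneg _) ((abs_nonneg _).trans (hfB 0))

/-- The flux difference is `-∇(u₁ - u₂) + (f(u₁) - f(u₂)) ∇V₁ + f(u₂) ∇(V₁ - V₂)`. The Lipschitz
constant of `f` controls the second term and its bound `B` the third, which keeps the size of `u₂`
out of the estimate. Young's inequality spends half of the gradient. -/
lemma flux_estimate {f : ℝ → ℝ} {B : ℝ} {K : ℝ≥0} (hfB : ∀ s, |f s| ≤ B) (hfK : LipschitzWith K f)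
    (u₁ u₂ : H1 D) (V₁ V₂ : W1 D ∞) :
    (∫ x, ⟪-grad u₁ x + f (val u₁ x) • grad V₁ x, grad (u₁ - u₂) x⟫ ∂(domMeasure D))
      - (∫ x, ⟪-grad u₂ x + f (val u₂ x) • grad V₂ x, grad (u₁ - u₂) x⟫ ∂(domMeasure D))
      ≤ -(1 / 2 * ‖grad (u₁ - u₂)‖ ^ 2) + K ^ 2 * ‖V₁‖ ^ 2 * ‖val (u₁ - u₂)‖ ^ 2
        + B ^ 2 * ‖V₁ - V₂‖ ^ 2 * (domMeasure D).real univ := by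
  have hg := Lp.memLp (grad (u₁ - u₂))
  have i1 := integrable_inner_of_memLp (memLp_flux hfB hfK.continuous u₁ V₁) hg
  have i2 := integrable_inner_of_memLp (memLp_flux hfB hfK.continuous u₂ V₂) hg
  have j1 := integrable_norm_sq (grad (u₁ - u₂))
  have j2 := integrable_norm_sq (val (u₁ - u₂))
  have k1 : Integrable (fun x => -(1 / 2 * ‖grad (u₁ - u₂) x‖ ^ 2)) (domMeasure D) :=
    (j1.const_mul _).neg
  have k2 : Integrable (fun x => -(1 / 2 * ‖grad (u₁ - u₂) x‖ ^ 2)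
      + K ^ 2 * ‖V₁‖ ^ 2 * ‖val (u₁ - u₂) x‖ ^ 2) (domMeasure D) := k1.add (j2.const_mul _)
  have hR : -(1 / 2 * ‖grad (u₁ - u₂)‖ ^ 2) + K ^ 2 * ‖V₁‖ ^ 2 * ‖val (u₁ - u₂)‖ ^ 2
        + B ^ 2 * ‖V₁ - V₂‖ ^ 2 * (domMeasure D).real univ
      = ∫ x, (-(1 / 2 * ‖grad (u₁ - u₂) x‖ ^ 2) + K ^ 2 * ‖V₁‖ ^ 2 * ‖val (u₁ - u₂) x‖ ^ 2
        + B ^ 2 * ‖V₁ - V₂‖ ^ 2) ∂(domMeasure D) := by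
    rw [integral_add k2 (integrable_const _), integral_add k1 (j2.const_mul _), integral_neg,
      integral_const_mul, integral_const_mul, ← norm_sq_eq_integral, ← norm_sq_eq_integral,
      integral_const, smul_eq_mul]
    ring
  rw [← integral_sub i1 i2, hR]
  refine integral_mono_ae (i1.sub i2) (k2.add (integrable_const _)) ?_
  filter_upwards [val_sub_ae u₁ u₂, grad_sub_ae u₁ u₂, grad_sub_ae V₁ V₂,
    ae_norm_le_norm (grad V₁), ae_norm_le_norm (grad (V₁ - V₂))] with x h1 h2 h3 h4 h5
  rw [h3] at h5
  simp only [h1, h2]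
  have m1 : ‖grad V₁ x‖ ≤ ‖V₁‖ := h4.trans (norm_grad_le V₁)
  have m2 : ‖grad V₁ x - grad V₂ x‖ ≤ ‖V₁ - V₂‖ := h5.trans (norm_grad_le _)
  have hF : |f (val u₁ x) - f (val u₂ x)| ≤ K * |val u₁ x - val u₂ x| := by
    have := hfK.dist_le_mul (val u₁ x) (val u₂ x)
    rwa [Real.dist_eq, Real.dist_eq] at this
  set φ := grad u₁ x - grad u₂ x with hφ
  set q := val u₁ x - val u₂ x with hq
  have e : ⟪-grad u₁ x + f (val u₁ x) • grad V₁ x, φ⟫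
      - ⟪-grad u₂ x + f (val u₂ x) • grad V₂ x, φ⟫
      = -‖φ‖ ^ 2 + ⟪(f (val u₁ x) - f (val u₂ x)) • grad V₁ x
        + f (val u₂ x) • (grad V₁ x - grad V₂ x), φ⟫ := by
    rw [← inner_sub_left, ← real_inner_self_eq_norm_sq, ← inner_neg_left, ← inner_add_left]
    congr 1
    rw [hφ, sub_smul, smul_sub]; abel
  have hn : ‖(f (val u₁ x) - f (val u₂ x)) • grad V₁ x
        + f (val u₂ x) • (grad V₁ x - grad V₂ x)‖ ≤ K * |q| * ‖V₁‖ + B * ‖V₁ - V₂‖ := by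
    refine (norm_add_le _ _).trans ?_
    rw [norm_smul, norm_smul, Real.norm_eq_abs, Real.norm_eq_abs]
    exact add_le_add (mul_le_mul hF m1 (norm_nonneg _) (by positivity))
      (mul_le_mul (hfB _) m2 (norm_nonneg _) ((abs_nonneg _).trans (hfB 0)))
  have hin := (real_inner_le_norm ((f (val u₁ x) - f (val u₂ x)) • grad V₁ x
        + f (val u₂ x) • (grad V₁ x - grad V₂ x)) φ).trans
    (mul_le_mul_of_nonneg_right hn (norm_nonneg φ))
  rw [e, Real.norm_eq_abs, sq_abs]
  have hs : (K * |q| * ‖V₁‖) ^ 2 = K ^ 2 * ‖V₁‖ ^ 2 * q ^ 2 := by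
    rw [mul_pow, mul_pow, sq_abs]; ring
  -- The first square is Young's inequality for the product with `‖φ‖`; the second is `(x + y)² ≤
  -- 2x² + 2y²`.
  nlinarith [sq_nonneg (‖φ‖ - (K * |q| * ‖V₁‖ + B * ‖V₁ - V₂‖)),
    sq_nonneg (K * |q| * ‖V₁‖ - B * ‖V₁ - V₂‖)]

/-- Each difference of products is split with the coefficient of the first datum on the diagonal
part. The diagonal part of the removal term has a sign, that of the creation term is Lipschitz. The
cross terms `(b₁ - b₂) p₂` and `(a₁ - a₂) f₂` each cost half a square of `p₁ - p₂`, which gives the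
`+ 1`. A factor `p₂²` survives because the removal term is unbounded in the solution. -/
lemma reaction_pointwise {a₁ a₂ b₁ b₂ p₁ p₂ f₁ f₂ M εα εβ B K : ℝ} (h2 : |a₁| ≤ M) (h3 : 0 ≤ b₁)
    (h4 : |a₁ - a₂| ≤ εα) (h5 : |b₁ - b₂| ≤ εβ) (hF : |f₁ - f₂| ≤ K * |p₁ - p₂|) (hB : |f₂| ≤ B) :
    -(b₁ * p₁ * (p₁ - p₂) - b₂ * p₂ * (p₁ - p₂)) + (a₁ * f₁ * (p₁ - p₂) - a₂ * f₂ * (p₁ - p₂))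
      ≤ (M * K + 1) * (p₁ - p₂) ^ 2 + 1 / 2 * εβ ^ 2 * p₂ ^ 2 + 1 / 2 * (εα ^ 2 * B ^ 2) := by
  have t1 : 0 ≤ b₁ * (p₁ - p₂) ^ 2 := mul_nonneg h3 (sq_nonneg _)
  have t2 : a₁ * (f₁ - f₂) * (p₁ - p₂) ≤ M * K * (p₁ - p₂) ^ 2 := by
    calc a₁ * (f₁ - f₂) * (p₁ - p₂) ≤ |a₁ * (f₁ - f₂) * (p₁ - p₂)| := le_abs_self _
      _ = |a₁| * |f₁ - f₂| * |p₁ - p₂| := by rw [abs_mul, abs_mul]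
      _ ≤ M * (K * |p₁ - p₂|) * |p₁ - p₂| := by
          have : 0 ≤ M := (abs_nonneg _).trans h2
          gcongr
      _ = M * K * (p₁ - p₂) ^ 2 := by rw [← sq_abs (p₁ - p₂)]; ring
  have s0 : (b₁ - b₂) ^ 2 ≤ εβ ^ 2 := sq_le_sq' (by linarith [(abs_le.1 h5).1]) (abs_le.1 h5).2
  have s1 : (a₁ - a₂) ^ 2 ≤ εα ^ 2 := sq_le_sq' (by linarith [(abs_le.1 h4).1]) (abs_le.1 h4).2
  have s2 : f₂ ^ 2 ≤ B ^ 2 := sq_le_sq' (by linarith [(abs_le.1 hB).1]) (abs_le.1 hB).2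
  have s3 := mul_le_mul s1 s2 (sq_nonneg _) (sq_nonneg _)
  have s4 := mul_le_mul_of_nonneg_right s0 (sq_nonneg p₂)
  have t3 := sq_nonneg ((b₁ - b₂) * p₂ + (p₁ - p₂))
  have t4 := sq_nonneg ((a₁ - a₂) * f₂ - (p₁ - p₂))
  linarith

lemma reaction_estimate {f : ℝ → ℝ} {B M εα εβ : ℝ} {K : ℝ≥0} (hfB : ∀ s, |f s| ≤ B)
    (hfK : LipschitzWith K f) (u₁ u₂ : H1 D) {α₁ α₂ β₁ β₂ : Euc N → ℝ}
    (mα₁ : AEStronglyMeasurable α₁ (domMeasure D)) (mα₂ : AEStronglyMeasurable α₂ (domMeasure D))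
    (mβ₁ : AEStronglyMeasurable β₁ (domMeasure D)) (mβ₂ : AEStronglyMeasurable β₂ (domMeasure D))
    (hα₁ : ∀ᵐ x ∂(domMeasure D), |α₁ x| ≤ M) (hβ₁ : ∀ᵐ x ∂(domMeasure D), |β₁ x| ≤ M)
    (hβ₀ : ∀ᵐ x ∂(domMeasure D), 0 ≤ β₁ x)
    (hα : ∀ᵐ x ∂(domMeasure D), |α₁ x - α₂ x| ≤ εα)
    (hβ : ∀ᵐ x ∂(domMeasure D), |β₁ x - β₂ x| ≤ εβ) :
    -((∫ x, β₁ x * val u₁ x * val (u₁ - u₂) x ∂(domMeasure D))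
        - (∫ x, β₂ x * val u₂ x * val (u₁ - u₂) x ∂(domMeasure D)))
      + ((∫ x, α₁ x * f (val u₁ x) * val (u₁ - u₂) x ∂(domMeasure D))
        - (∫ x, α₂ x * f (val u₂ x) * val (u₁ - u₂) x ∂(domMeasure D)))
      ≤ (M * K + 1) * ‖val (u₁ - u₂)‖ ^ 2 + 1 / 2 * εβ ^ 2 * ‖val u₂‖ ^ 2
        + 1 / 2 * (εα ^ 2 * B ^ 2) * (domMeasure D).real univ := by
  have hφ := Lp.memLp (val (u₁ - u₂))
  have hf : ∀ u : H1 D, MemLp (fun x => f (val u x)) 2 (domMeasure D) := fun u =>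
    MemLp.of_bound (hfK.continuous.comp_aestronglyMeasurable (Lp.aestronglyMeasurable _)) B
      (Eventually.of_forall fun x => hfB _)
  -- Bounds for the second pair of rates, obtained from the first pair and the distances. They serve
  -- only to establish integrability and do not enter the constants.
  have hα₂ : ∀ᵐ x ∂(domMeasure D), |α₂ x| ≤ M + εα := by
    filter_upwards [hα₁, hα] with x h1 h2
    rw [abs_le] at *; constructor <;> linarith [h1.1, h1.2, h2.1, h2.2]
  have hβ₂ : ∀ᵐ x ∂(domMeasure D), |β₂ x| ≤ M + εβ := by
    filter_upwards [hβ₁, hβ] with x h1 h2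
    rw [abs_le] at *; constructor <;> linarith [h1.1, h1.2, h2.1, h2.2]
  have i1 := integrable_bdd_mul_mul mβ₁ hβ₁ (Lp.memLp (val u₁)) hφ
  have i2 := integrable_bdd_mul_mul mβ₂ hβ₂ (Lp.memLp (val u₂)) hφ
  have i3 := integrable_bdd_mul_mul mα₁ hα₁ (hf u₁) hφ
  have i4 := integrable_bdd_mul_mul mα₂ hα₂ (hf u₂) hφ
  have j1 := integrable_norm_sq (val (u₁ - u₂))
  have j2 := integrable_norm_sq (val u₂)
  have i12 : Integrable (fun x => -(β₁ x * val u₁ x * val (u₁ - u₂) x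
      - β₂ x * val u₂ x * val (u₁ - u₂) x)) (domMeasure D) := (i1.sub i2).neg
  have i34 : Integrable (fun x => α₁ x * f (val u₁ x) * val (u₁ - u₂) x
      - α₂ x * f (val u₂ x) * val (u₁ - u₂) x) (domMeasure D) := i3.sub i4
  have k2 : Integrable (fun x => (M * K + 1) * ‖val (u₁ - u₂) x‖ ^ 2
      + 1 / 2 * εβ ^ 2 * ‖val u₂ x‖ ^ 2) (domMeasure D) := (j1.const_mul _).add (j2.const_mul _)
  have hR : (M * K + 1) * ‖val (u₁ - u₂)‖ ^ 2 + 1 / 2 * εβ ^ 2 * ‖val u₂‖ ^ 2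
        + 1 / 2 * (εα ^ 2 * B ^ 2) * (domMeasure D).real univ
      = ∫ x, ((M * K + 1) * ‖val (u₁ - u₂) x‖ ^ 2 + 1 / 2 * εβ ^ 2 * ‖val u₂ x‖ ^ 2
        + 1 / 2 * (εα ^ 2 * B ^ 2)) ∂(domMeasure D) := by
    rw [integral_add k2 (integrable_const _), integral_add (j1.const_mul _) (j2.const_mul _),
      integral_const_mul, integral_const_mul, ← norm_sq_eq_integral, ← norm_sq_eq_integral,
      integral_const, smul_eq_mul]
    ring
  rw [← integral_sub i1 i2, ← integral_sub i3 i4, ← integral_neg, ← integral_add i12 i34, hR]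
  refine integral_mono_ae (i12.add i34) (k2.add (integrable_const _)) ?_
  filter_upwards [val_sub_ae u₁ u₂, hα₁, hβ₀, hα, hβ] with x h1 h2 h3 h4 h5
  simp only [h1, Real.norm_eq_abs, sq_abs]
  have hF : |f (val u₁ x) - f (val u₂ x)| ≤ K * |val u₁ x - val u₂ x| := by
    have := hfK.dist_le_mul (val u₁ x) (val u₂ x)
    rwa [Real.dist_eq, Real.dist_eq] at this
  have hB := hfB (val u₂ x)
  exact reaction_pointwise h2 h3 h4 h5 hF hB

end Spatial

/-- The diagonal terms are nonpositive: on the outflow part because `b₁ ≥ 0`, on the inflow part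
because `a₁ ≥ 0` and `g` is decreasing. Only differences of coefficients remain. Young's inequality
with the free parameter `lam` spends `lam / 2` of `‖v₁ - v₂‖²` on each of the two parts, so that
`lam` can later be chosen small enough for the trace to be absorbed into the gradient. -/
lemma boundary_estimate {N : ℕ} {D Γin Γout : Set (Euc N)} [IsFiniteMeasure (surfMeasure D)]
    {g : ℝ → ℝ} {B εa εb lam : ℝ} {L : ℝ≥0} (hlam : 0 < lam) (hgB : ∀ s, |g s| ≤ B)
    (hgL : LipschitzWith L g) (hga : Antitone g) (v₁ v₂ : Lp ℝ 2 (surfMeasure D))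
    {a₁ a₂ b₁ b₂ : Euc N → ℝ}
    (ma₁ : AEStronglyMeasurable a₁ ((surfMeasure D).restrict Γin))
    (ma₂ : AEStronglyMeasurable a₂ ((surfMeasure D).restrict Γin))
    (mb₁ : AEStronglyMeasurable b₁ ((surfMeasure D).restrict Γout))
    (mb₂ : AEStronglyMeasurable b₂ ((surfMeasure D).restrict Γout))
    (ha₁ : ∀ᵐ x ∂((surfMeasure D).restrict Γin), 0 ≤ a₁ x ∧ a₁ x ≤ 1)
    (hb₁ : ∀ᵐ x ∂((surfMeasure D).restrict Γout), 0 ≤ b₁ x ∧ b₁ x ≤ 1)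
    (ha : ∀ᵐ x ∂((surfMeasure D).restrict Γin), |a₁ x - a₂ x| ≤ εa)
    (hb : ∀ᵐ x ∂((surfMeasure D).restrict Γout), |b₁ x - b₂ x| ≤ εb) :
    -((∫ x, b₁ x * v₁ x * (v₁ - v₂) x ∂((surfMeasure D).restrict Γout))
        - (∫ x, b₂ x * v₂ x * (v₁ - v₂) x ∂((surfMeasure D).restrict Γout)))
      + ((∫ x, a₁ x * g (v₁ x) * (v₁ - v₂) x ∂((surfMeasure D).restrict Γin))
        - (∫ x, a₂ x * g (v₂ x) * (v₁ - v₂) x ∂((surfMeasure D).restrict Γin)))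
      ≤ lam * ‖v₁ - v₂‖ ^ 2 + 1 / (2 * lam) * (εb ^ 2 * ‖v₂‖ ^ 2
        + εa ^ 2 * B ^ 2 * (surfMeasure D).real univ) := by
  have young : ∀ x y : ℝ, x * y ≤ 1 / (2 * lam) * x ^ 2 + lam / 2 * y ^ 2 := by
    intro x y
    have h : 1 / (2 * lam) * x ^ 2 + lam / 2 * y ^ 2 - x * y
        = 1 / (2 * lam) * (x - lam * y) ^ 2 := by field_simp; ring
    have : 0 ≤ 1 / (2 * lam) * (x - lam * y) ^ 2 := by positivity
    linarith
  have hr : ∀ (v : Lp ℝ 2 (surfMeasure D)) (Γ : Set (Euc N)),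
      MemLp v 2 ((surfMeasure D).restrict Γ) := fun v Γ => (Lp.memLp v).restrict Γ
  have hg : ∀ v : Lp ℝ 2 (surfMeasure D), MemLp (fun x => g (v x)) 2
      ((surfMeasure D).restrict Γin) := fun v =>
    MemLp.of_bound (hgL.continuous.comp_aestronglyMeasurable (hr v Γin).1) B
      (Eventually.of_forall fun x => hgB _)
  have ha₁' : ∀ᵐ x ∂((surfMeasure D).restrict Γin), |a₁ x| ≤ 1 := by
    filter_upwards [ha₁] with x hx; rw [abs_of_nonneg hx.1]; exact hx.2
  have hb₁' : ∀ᵐ x ∂((surfMeasure D).restrict Γout), |b₁ x| ≤ 1 := by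
    filter_upwards [hb₁] with x hx; rw [abs_of_nonneg hx.1]; exact hx.2
  have ha₂ : ∀ᵐ x ∂((surfMeasure D).restrict Γin), |a₂ x| ≤ 1 + εa := by
    filter_upwards [ha₁', ha] with x h1 h2
    rw [abs_le] at *; constructor <;> linarith [h1.1, h1.2, h2.1, h2.2]
  have hb₂ : ∀ᵐ x ∂((surfMeasure D).restrict Γout), |b₂ x| ≤ 1 + εb := by
    filter_upwards [hb₁', hb] with x h1 h2
    rw [abs_le] at *; constructor <;> linarith [h1.1, h1.2, h2.1, h2.2]
  have i1 := integrable_bdd_mul_mul mb₁ hb₁' (hr v₁ Γout) (hr (v₁ - v₂) Γout)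
  have i2 := integrable_bdd_mul_mul mb₂ hb₂ (hr v₂ Γout) (hr (v₁ - v₂) Γout)
  have i3 := integrable_bdd_mul_mul ma₁ ha₁' (hg v₁) (hr (v₁ - v₂) Γin)
  have i4 := integrable_bdd_mul_mul ma₂ ha₂ (hg v₂) (hr (v₁ - v₂) Γin)
  have j1 := integrable_norm_sq (v₁ - v₂)
  have j2 := integrable_norm_sq v₂
  have hsub := Lp.coeFn_sub v₁ v₂
  have hout : -((∫ x, b₁ x * v₁ x * (v₁ - v₂) x ∂((surfMeasure D).restrict Γout))
        - (∫ x, b₂ x * v₂ x * (v₁ - v₂) x ∂((surfMeasure D).restrict Γout)))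
      ≤ lam / 2 * ‖v₁ - v₂‖ ^ 2 + 1 / (2 * lam) * (εb ^ 2 * ‖v₂‖ ^ 2) := by
    have j3 : Integrable (fun x => lam / 2 * ‖(v₁ - v₂) x‖ ^ 2
        + 1 / (2 * lam) * (εb ^ 2 * ‖v₂ x‖ ^ 2)) (surfMeasure D) :=
      (j1.const_mul _).add ((j2.const_mul _).const_mul _)
    calc _ = ∫ x, -(b₁ x * v₁ x * (v₁ - v₂) x - b₂ x * v₂ x * (v₁ - v₂) x)
          ∂((surfMeasure D).restrict Γout) := by rw [integral_neg, integral_sub i1 i2]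
      _ ≤ ∫ x, (lam / 2 * ‖(v₁ - v₂) x‖ ^ 2 + 1 / (2 * lam) * (εb ^ 2 * ‖v₂ x‖ ^ 2))
          ∂((surfMeasure D).restrict Γout) := by
          refine integral_mono_ae (i1.sub i2).neg j3.restrict ?_
          filter_upwards [ae_restrict_of_ae hsub, hb₁, hb] with x h1 h2 h3
          simp only [h1, Pi.sub_apply, Real.norm_eq_abs, sq_abs]
          have t1 : 0 ≤ b₁ x * (v₁ x - v₂ x) ^ 2 := mul_nonneg h2.1 (sq_nonneg _)
          have t2 := young (-(b₁ x - b₂ x) * v₂ x) (v₁ x - v₂ x)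
          have t3 : (-(b₁ x - b₂ x) * v₂ x) ^ 2 ≤ εb ^ 2 * v₂ x ^ 2 := by
            rw [mul_pow, neg_sq]
            exact mul_le_mul_of_nonneg_right
              (sq_le_sq' (by linarith [(abs_le.1 h3).1]) (abs_le.1 h3).2) (sq_nonneg _)
          have t4 := mul_le_mul_of_nonneg_left t3 (by positivity : 0 ≤ 1 / (2 * lam))
          nlinarith
      _ ≤ ∫ x, (lam / 2 * ‖(v₁ - v₂) x‖ ^ 2 + 1 / (2 * lam) * (εb ^ 2 * ‖v₂ x‖ ^ 2))
          ∂(surfMeasure D) :=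
          integral_mono_measure Measure.restrict_le_self
            (Eventually.of_forall fun x => by simp only [Pi.zero_apply]; positivity) j3
      _ = _ := by
          rw [integral_add (j1.const_mul _) ((j2.const_mul _).const_mul _), integral_const_mul,
            integral_const_mul, integral_const_mul, ← norm_sq_eq_integral, ← norm_sq_eq_integral]
  have hin : (∫ x, a₁ x * g (v₁ x) * (v₁ - v₂) x ∂((surfMeasure D).restrict Γin))
        - (∫ x, a₂ x * g (v₂ x) * (v₁ - v₂) x ∂((surfMeasure D).restrict Γin))
      ≤ lam / 2 * ‖v₁ - v₂‖ ^ 2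
        + 1 / (2 * lam) * (εa ^ 2 * B ^ 2 * (surfMeasure D).real univ) := by
    have j3 : Integrable (fun x => lam / 2 * ‖(v₁ - v₂) x‖ ^ 2
        + 1 / (2 * lam) * (εa ^ 2 * B ^ 2)) (surfMeasure D) :=
      (j1.const_mul _).add (integrable_const _)
    calc _ = ∫ x, (a₁ x * g (v₁ x) * (v₁ - v₂) x - a₂ x * g (v₂ x) * (v₁ - v₂) x)
          ∂((surfMeasure D).restrict Γin) := by rw [integral_sub i3 i4]
      _ ≤ ∫ x, (lam / 2 * ‖(v₁ - v₂) x‖ ^ 2 + 1 / (2 * lam) * (εa ^ 2 * B ^ 2))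
          ∂((surfMeasure D).restrict Γin) := by
          refine integral_mono_ae (i3.sub i4) j3.restrict ?_
          filter_upwards [ae_restrict_of_ae hsub, ha₁, ha] with x h1 h2 h3
          simp only [h1, Pi.sub_apply, Real.norm_eq_abs, sq_abs]
          have t1 : (g (v₁ x) - g (v₂ x)) * (v₁ x - v₂ x) ≤ 0 := by
            rcases le_total (v₁ x) (v₂ x) with hle | hle
            · exact mul_nonpos_of_nonneg_of_nonpos (sub_nonneg.2 (hga hle)) (sub_nonpos.2 hle)
            · exact mul_nonpos_of_nonpos_of_nonneg (sub_nonpos.2 (hga hle)) (sub_nonneg.2 hle)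
          have t1' := mul_nonneg h2.1 (neg_nonneg.2 t1)
          have t2 := young ((a₁ x - a₂ x) * g (v₂ x)) (v₁ x - v₂ x)
          have t3 : ((a₁ x - a₂ x) * g (v₂ x)) ^ 2 ≤ εa ^ 2 * B ^ 2 := by
            rw [mul_pow]
            have hB := hgB (v₂ x)
            exact mul_le_mul (sq_le_sq' (by linarith [(abs_le.1 h3).1]) (abs_le.1 h3).2)
              (sq_le_sq' (by linarith [(abs_le.1 hB).1]) (abs_le.1 hB).2) (sq_nonneg _)
              (sq_nonneg _)
          have t4 := mul_le_mul_of_nonneg_left t3 (by positivity : 0 ≤ 1 / (2 * lam))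
          nlinarith
      _ ≤ ∫ x, (lam / 2 * ‖(v₁ - v₂) x‖ ^ 2 + 1 / (2 * lam) * (εa ^ 2 * B ^ 2))
          ∂(surfMeasure D) :=
          integral_mono_measure Measure.restrict_le_self
            (Eventually.of_forall fun x => by simp only [Pi.zero_apply]; positivity) j3
      _ = _ := by
          rw [integral_add (j1.const_mul _) (integrable_const _), integral_const_mul,
            ← norm_sq_eq_integral, integral_const, smul_eq_mul]
          ring
  have : lam * ‖v₁ - v₂‖ ^ 2 = lam / 2 * ‖v₁ - v₂‖ ^ 2 + lam / 2 * ‖v₁ - v₂‖ ^ 2 := by ring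
  rw [mul_add, this]
  linarith

/-! ### Continuous dependence of weak solutions on the data -/

lemma integral_const_timeMeasure {T : ℝ} (hT : 0 ≤ T) (c : ℝ) :
    ∫ _, c ∂(timeMeasure T) = T * c := by
  rw [integral_const, smul_eq_mul, measureReal_restrict_apply_univ, Real.volume_real_Ioo_of_le hT,
    sub_zero]

section

variable {N : ℕ} {D : Set (Euc N)} {T : ℝ}

lemma isFiniteMeasure_domMeasure (hDb : Bornology.IsBounded D) : IsFiniteMeasure (domMeasure D) :=
  ⟨by simpa using hDb.measure_lt_top⟩

lemma zero_ae {X F : Type*} [MeasurableSpace X] {μ : Measure X} [NormedAddCommGroup F]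
    (p : ℝ≥0∞) : ∀ᵐ x ∂μ, (0 : Lp F p μ) x = 0 :=
  Lp.coeFn_zero F p μ

lemma hasInitialValue_zero : HasInitialValue (0 : L2H1 D T) 0 := by
  refine ⟨fun _ => 0, continuousOn_const, rfl, ?_⟩
  filter_upwards [zero_ae (F := H1 D) (μ := timeMeasure T) 2] with t ht
  rw [ht]; rfl

lemma isTimeDeriv_zero : IsTimeDeriv (0 : L2H1 D T) 0 := by
  intro φ η _ _ _
  have h1 : ∫ t, deriv η t * ⟪valL D 2 ((0 : L2H1 D T) t), valL D 2 φ⟫ ∂(timeMeasure T) = 0 := by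
    refine integral_eq_zero_of_ae ?_
    filter_upwards [zero_ae (F := H1 D) (μ := timeMeasure T) 2] with t ht
    rw [ht, map_zero, inner_zero_left, mul_zero]; rfl
  have h2 : ∫ t, η t * (0 : Lp (H1Dual D) 2 (timeMeasure T)) t φ ∂(timeMeasure T) = 0 := by
    refine integral_eq_zero_of_ae ?_
    filter_upwards [zero_ae (F := H1Dual D) (μ := timeMeasure T) 2] with t ht
    rw [ht]; simp
  simp only [integral_mul_eq_inner]
  rw [h1, h2, neg_zero]

lemma integral_flux_zero {f : ℝ → ℝ} (hf0 : f 0 = 0) (V : W1 D ∞) (φ : H1 D) :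
    ∫ x, ⟪-grad (0 : H1 D) x + f (val (0 : H1 D) x) • grad V x, grad φ x⟫ ∂(domMeasure D) = 0 := by
  refine integral_eq_zero_of_ae ?_
  filter_upwards [zero_ae (F := ℝ) (μ := domMeasure D) 2,
    zero_ae (F := Euc N) (μ := domMeasure D) 2] with x h1 h2
  have h1' : val (0 : H1 D) x = 0 := h1
  have h2' : grad (0 : H1 D) x = 0 := h2
  rw [h1', h2', hf0]; simp

lemma isTrace_zero : IsTrace D 0 0 := by
  refine ⟨fun _ _ => 0, fun _ => contDiff_const, ?_, ?_, ?_⟩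
  · refine tendsto_const_nhds.congr fun n => ?_
    rw [eLpNorm_congr_ae (g := fun _ => (0 : ℝ)), eLpNorm_zero']
    filter_upwards [zero_ae (F := ℝ) (μ := domMeasure D) 2] with x hx
    rw [show val (0 : H1 D) x = 0 from hx, sub_zero]
  · refine tendsto_const_nhds.congr fun n => ?_
    rw [eLpNorm_congr_ae (g := fun _ => (0 : Euc N)), eLpNorm_zero']
    filter_upwards [zero_ae (F := Euc N) (μ := domMeasure D) 2] with x hx
    rw [show grad (0 : H1 D) x = 0 from hx, sub_zero]
    simp [gradient]
  · refine tendsto_const_nhds.congr fun n => ?_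
    rw [eLpNorm_congr_ae (g := fun _ => (0 : ℝ)), eLpNorm_zero']
    filter_upwards [zero_ae (F := ℝ) (μ := surfMeasure D) 2] with x hx
    rw [hx, sub_zero]

/-- All terms vanish at zero since `f 0 = 0`, so rates and potential can be kept. Stability against
this solution is the a priori bound for an arbitrary one, with only the initial values contributing
to the distance. -/
lemma isWeakSolution1_zero {f : ℝ → ℝ} (hf0 : f 0 = 0) (ξ : Data1 D T) :
    IsWeakSolution1 f ⟨ξ.α, ξ.β, ξ.V, 0⟩ 0 := by
  refine ⟨hasInitialValue_zero, 0, isTimeDeriv_zero, ?_⟩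
  filter_upwards [zero_ae (F := H1 D) (μ := timeMeasure T) 2,
    zero_ae (F := H1Dual D) (μ := timeMeasure T) 2] with t h1 h2 φ
  rw [h1, h2, integral_flux_zero hf0, integral_eq_zero_of_ae, integral_eq_zero_of_ae]
  · simp
  · filter_upwards [zero_ae (F := ℝ) (μ := domMeasure D) 2] with x hx
    rw [show val (0 : H1 D) x = 0 from hx, hf0]; simp
  · filter_upwards [zero_ae (F := ℝ) (μ := domMeasure D) 2] with x hx
    rw [show val (0 : H1 D) x = 0 from hx]; simp

/-- An inflow term `a g(u)` need not vanish at `u = 0`, as `g 0 = 1` for an inflow limiter. The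
comparison datum therefore has zero inflow rate as well as zero initial value. -/
lemma isWeakSolution2_zero {Γin Γout : Set (Euc N)} [SFinite ((surfMeasure D).restrict Γin)]
    {f g : ℝ → ℝ} (hf0 : f 0 = 0) (ξ : Data2 D Γin Γout T) :
    IsWeakSolution2 f g (⟨0, ξ.b, ξ.V, 0⟩ : Data2 D Γin Γout T) 0 := by
  refine ⟨hasInitialValue_zero, 0, isTimeDeriv_zero, ?_⟩
  have ha := Measure.ae_ae_of_ae_prod
    (zero_ae (F := ℝ) (μ := (timeMeasure T).prod ((surfMeasure D).restrict Γin)) ∞)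
  filter_upwards [zero_ae (F := H1 D) (μ := timeMeasure T) 2,
    zero_ae (F := H1Dual D) (μ := timeMeasure T) 2, ha] with t h1 h2 h3
  refine ⟨0, by rw [h1]; exact isTrace_zero, fun φ ψ _ => ?_⟩
  rw [h1, h2, integral_flux_zero hf0, integral_eq_zero_of_ae, integral_eq_zero_of_ae]
  · simp
  · filter_upwards [h3] with x hx
    simp only [hx]; simp
  · filter_upwards [ae_restrict_of_ae (zero_ae (F := ℝ) (μ := surfMeasure D) 2)] with x hx
    rw [hx]; simp

/-- The parabolic energy estimate for the difference of two functions. -/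
theorem norm_sq_sub_le_of_energy_inequality (hT : 0 < T) {u₁ u₂ : L2H1 D T}
    {a₁ a₂ : Lp ℝ 2 (domMeasure D)} {w₁ w₂ : Lp (H1Dual D) 2 (timeMeasure T)}
    (i₁ : HasInitialValue u₁ a₁) (i₂ : HasInitialValue u₂ a₂) (d₁ : IsTimeDeriv u₁ w₁)
    (d₂ : IsTimeDeriv u₂ w₂)
    {m k : ℝ → ℝ} (hm : Integrable m (timeMeasure T)) (hk : Integrable k (timeMeasure T))
    (hm0 : ∀ t, 0 ≤ m t) (hk0 : ∀ t, 0 ≤ k t)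
    (h : ∀ᵐ t ∂(timeMeasure T),
      2 * (w₁ t (u₁ t - u₂ t) - w₂ t (u₁ t - u₂ t)) ≤ -(1 / 2 * ‖grad (u₁ t - u₂ t)‖ ^ 2)
        + m t * ‖val (u₁ t - u₂ t)‖ ^ 2 + k t) :
    ‖u₁ - u₂‖ ^ 2 ≤ 2 * (T + 2) * (Real.exp (∫ t, m t ∂(timeMeasure T)) *
      (‖a₁ - a₂‖ ^ 2 + ∫ t, k t ∂(timeMeasure T))) := by
  refine norm_sq_le_of_energy_inequality hT (i₁.sub i₂) (d₁.sub d₂) hm hk hm0 hk0 ?_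
  have e1 := Lp.coeFn_sub u₁ u₂
  have e2 := Lp_dual_sub_apply_ae w₁ w₂
  refine (h.and (e1.and e2)).mono fun t ht => ?_
  obtain ⟨p, q, r⟩ := ht
  have q' : (u₁ - u₂ : L2H1 D T) t = u₁ t - u₂ t := q
  have r' := r (u₁ t - u₂ t)
  rw [q', r']
  exact p

/-- The estimate at a fixed time: `w₁` and `w₂` stand for the time derivatives applied to `u₁ - u₂`,
and `h₁`, `h₂` are the two equations with this test function. Doubling the flux estimate leaves a
full squared gradient, of which half is given away; the problem with boundary terms needs that half
for the trace. -/
lemma energy_inequality1 [IsFiniteMeasure (domMeasure D)] {f : ℝ → ℝ} {B M εα εβ εV w₁ w₂ : ℝ}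
    {K : ℝ≥0} (hfB : ∀ s, |f s| ≤ B)
    (hfK : LipschitzWith K f) {u₁ u₂ : H1 D} {V₁ V₂ : W1 D ∞} {α₁ α₂ β₁ β₂ : Euc N → ℝ}
    (mα₁ : AEStronglyMeasurable α₁ (domMeasure D)) (mα₂ : AEStronglyMeasurable α₂ (domMeasure D))
    (mβ₁ : AEStronglyMeasurable β₁ (domMeasure D)) (mβ₂ : AEStronglyMeasurable β₂ (domMeasure D))
    (hα₁ : ∀ᵐ x ∂(domMeasure D), |α₁ x| ≤ M) (hβ₁ : ∀ᵐ x ∂(domMeasure D), |β₁ x| ≤ M)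
    (hβ₀ : ∀ᵐ x ∂(domMeasure D), 0 ≤ β₁ x)
    (hα : ∀ᵐ x ∂(domMeasure D), |α₁ x - α₂ x| ≤ εα)
    (hβ : ∀ᵐ x ∂(domMeasure D), |β₁ x - β₂ x| ≤ εβ) (hV₁ : ‖V₁‖ ≤ M) (hV : ‖V₁ - V₂‖ ≤ εV)
    (h₁ : w₁ - (∫ x, ⟪-grad u₁ x + f (val u₁ x) • grad V₁ x, grad (u₁ - u₂) x⟫ ∂(domMeasure D))
      + (∫ x, β₁ x * val u₁ x * val (u₁ - u₂) x ∂(domMeasure D))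
      - (∫ x, α₁ x * f (val u₁ x) * val (u₁ - u₂) x ∂(domMeasure D)) = 0)
    (h₂ : w₂ - (∫ x, ⟪-grad u₂ x + f (val u₂ x) • grad V₂ x, grad (u₁ - u₂) x⟫ ∂(domMeasure D))
      + (∫ x, β₂ x * val u₂ x * val (u₁ - u₂) x ∂(domMeasure D))
      - (∫ x, α₂ x * f (val u₂ x) * val (u₁ - u₂) x ∂(domMeasure D)) = 0) :
    2 * (w₁ - w₂) ≤ -(1 / 2 * ‖grad (u₁ - u₂)‖ ^ 2)
      + (2 * K ^ 2 * M ^ 2 + 2 * (M * K + 1)) * ‖val (u₁ - u₂)‖ ^ 2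
      + (2 * B ^ 2 * (domMeasure D).real univ * (εV ^ 2 + εα ^ 2) + εβ ^ 2 * ‖u₂‖ ^ 2) := by
  have hfl := flux_estimate hfB hfK u₁ u₂ V₁ V₂
  have hre := reaction_estimate hfB hfK u₁ u₂ mα₁ mα₂ mβ₁ mβ₂ hα₁ hβ₁ hβ₀ hα hβ
  have s1 : ‖V₁‖ ^ 2 ≤ M ^ 2 := pow_le_pow_left₀ (norm_nonneg _) hV₁ 2
  have s2 : ‖V₁ - V₂‖ ^ 2 ≤ εV ^ 2 := pow_le_pow_left₀ (norm_nonneg _) hV 2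
  have s3 : ‖val u₂‖ ^ 2 ≤ ‖u₂‖ ^ 2 := pow_le_pow_left₀ (norm_nonneg _) (norm_val_le _) 2
  have s4 : K ^ 2 * ‖V₁‖ ^ 2 * ‖val (u₁ - u₂)‖ ^ 2 ≤ K ^ 2 * M ^ 2 * ‖val (u₁ - u₂)‖ ^ 2 := by
    gcongr
  have s5 : B ^ 2 * ‖V₁ - V₂‖ ^ 2 * (domMeasure D).real univ
      ≤ B ^ 2 * εV ^ 2 * (domMeasure D).real univ := by gcongr
  have s6 : εβ ^ 2 * ‖val u₂‖ ^ 2 ≤ εβ ^ 2 * ‖u₂‖ ^ 2 := by gcongr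
  have s7 : 0 ≤ ‖grad (u₁ - u₂)‖ ^ 2 := by positivity
  have s8 : 0 ≤ εα ^ 2 * B ^ 2 * (domMeasure D).real univ := by positivity
  linarith

lemma energy_inequality2 [IsFiniteMeasure (domMeasure D)] [IsFiniteMeasure (surfMeasure D)]
    {Ct : ℝ} (htr : ∀ (u : H1 D) (v : Lp ℝ 2 (surfMeasure D)), IsTrace D u v →
      ‖v‖ ≤ Ct * ‖u‖) {f g : ℝ → ℝ} {B Bg εa εb w₁ w₂ : ℝ} {K L : ℝ≥0}
    (hfB : ∀ s, |f s| ≤ B) (hfK : LipschitzWith K f) (hgB : ∀ s, |g s| ≤ Bg)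
    (hgL : LipschitzWith L g) (hga : Antitone g) {Γin Γout : Set (Euc N)}
    {u₁ u₂ : H1 D} {V₁ V₂ : W1 D ∞} {v₁ v₂ : Lp ℝ 2 (surfMeasure D)}
    (tr₁ : IsTrace D u₁ v₁) (tr₂ : IsTrace D u₂ v₂) {a₁ a₂ b₁ b₂ : Euc N → ℝ}
    (ma₁ : AEStronglyMeasurable a₁ ((surfMeasure D).restrict Γin))
    (ma₂ : AEStronglyMeasurable a₂ ((surfMeasure D).restrict Γin))
    (mb₁ : AEStronglyMeasurable b₁ ((surfMeasure D).restrict Γout))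
    (mb₂ : AEStronglyMeasurable b₂ ((surfMeasure D).restrict Γout))
    (ha₁ : ∀ᵐ x ∂((surfMeasure D).restrict Γin), 0 ≤ a₁ x ∧ a₁ x ≤ 1)
    (hb₁ : ∀ᵐ x ∂((surfMeasure D).restrict Γout), 0 ≤ b₁ x ∧ b₁ x ≤ 1)
    (ha : ∀ᵐ x ∂((surfMeasure D).restrict Γin), |a₁ x - a₂ x| ≤ εa)
    (hb : ∀ᵐ x ∂((surfMeasure D).restrict Γout), |b₁ x - b₂ x| ≤ εb)
    (h₁ : w₁ - (∫ x, ⟪-grad u₁ x + f (val u₁ x) • grad V₁ x, grad (u₁ - u₂) x⟫ ∂(domMeasure D))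
      + (∫ x, b₁ x * v₁ x * (v₁ - v₂) x ∂((surfMeasure D).restrict Γout))
      = ∫ x, a₁ x * g (v₁ x) * (v₁ - v₂) x ∂((surfMeasure D).restrict Γin))
    (h₂ : w₂ - (∫ x, ⟪-grad u₂ x + f (val u₂ x) • grad V₂ x, grad (u₁ - u₂) x⟫ ∂(domMeasure D))
      + (∫ x, b₂ x * v₂ x * (v₁ - v₂) x ∂((surfMeasure D).restrict Γout))
      = ∫ x, a₂ x * g (v₂ x) * (v₁ - v₂) x ∂((surfMeasure D).restrict Γin)) :
    2 * (w₁ - w₂) ≤ -(1 / 2 * ‖grad (u₁ - u₂)‖ ^ 2)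
      + (2 * K ^ 2 * ‖V₁‖ ^ 2 + 1 / 2) * ‖val (u₁ - u₂)‖ ^ 2
      + (8 * (Ct ^ 2 + 1) * Bg ^ 2 * (surfMeasure D).real univ * εa ^ 2
        + 8 * (Ct ^ 2 + 1) * Ct ^ 2 * εb ^ 2 * ‖u₂‖ ^ 2
        + 2 * B ^ 2 * (domMeasure D).real univ * ‖V₁ - V₂‖ ^ 2) := by
  have tr := tr₁.sub tr₂
  have hfl := flux_estimate hfB hfK u₁ u₂ V₁ V₂
  -- With this `lam` the trace inequality turns `2 * lam * ‖v₁ - v₂‖²` into at most half of `‖val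
  -- (u₁ - u₂)‖² + ‖grad (u₁ - u₂)‖²`, exactly the gradient that can be spared. The summand `1`
  -- keeps the denominator positive.
  have hbo := boundary_estimate (lam := 1 / (8 * (Ct ^ 2 + 1))) (by positivity) hgB hgL hga
    v₁ v₂ ma₁ ma₂ mb₁ mb₂ ha₁ hb₁ ha hb
  have hlam : 1 / (2 * (1 / (8 * (Ct ^ 2 + 1)))) = 4 * (Ct ^ 2 + 1) := by
    field_simp; norm_num
  rw [hlam] at hbo
  have s1 : 1 / (8 * (Ct ^ 2 + 1)) * ‖v₁ - v₂‖ ^ 2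
      ≤ 1 / 4 * (‖val (u₁ - u₂)‖ ^ 2 + ‖grad (u₁ - u₂)‖ ^ 2) := by
    have p1 : ‖v₁ - v₂‖ ^ 2 ≤ (Ct * ‖u₁ - u₂‖) ^ 2 :=
      pow_le_pow_left₀ (norm_nonneg _) (htr _ _ tr) 2
    have p2 := norm_sq_H1_le (u₁ - u₂)
    have p3 : Ct ^ 2 * ‖u₁ - u₂‖ ^ 2 ≤ Ct ^ 2 *
        (2 * (‖val (u₁ - u₂)‖ ^ 2 + ‖grad (u₁ - u₂)‖ ^ 2)) := by gcongr
    rw [one_div_mul_eq_div, div_le_iff₀ (by positivity)]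
    have p4 : 0 ≤ ‖val (u₁ - u₂)‖ ^ 2 + ‖grad (u₁ - u₂)‖ ^ 2 := by positivity
    rw [mul_pow] at p1
    linarith
  have s2 : ‖v₂‖ ^ 2 ≤ Ct ^ 2 * ‖u₂‖ ^ 2 := by
    rw [← mul_pow]; exact pow_le_pow_left₀ (norm_nonneg _) (htr _ _ tr₂) 2
  have s3 : (Ct ^ 2 + 1) * εb ^ 2 * ‖v₂‖ ^ 2
      ≤ (Ct ^ 2 + 1) * εb ^ 2 * (Ct ^ 2 * ‖u₂‖ ^ 2) := by gcongr
  linarith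

/-- Stability for the problem with reaction terms, in terms of the size of the second solution. -/
theorem norm_sq_sub_le_of_isWeakSolution1 (hDb : Bornology.IsBounded D) (hT : 0 < T) {f : ℝ → ℝ}
    {B M : ℝ} {K : ℝ≥0} (hfB : ∀ s, |f s| ≤ B) (hfK : LipschitzWith K f) {ξ₁ ξ₂ : Data1 D T}
    (hβ₀ : ∀ᵐ z ∂((timeMeasure T).prod (domMeasure D)), 0 ≤ ξ₁.β z) (hα : ‖ξ₁.α‖ ≤ M)
    (hβ : ‖ξ₁.β‖ ≤ M) (hV : ‖ξ₁.V‖ ≤ M) {u₁ u₂ : L2H1 D T} (h₁ : IsWeakSolution1 f ξ₁ u₁)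
    (h₂ : IsWeakSolution1 f ξ₂ u₂) :
    ‖u₁ - u₂‖ ^ 2 ≤ 2 * (T + 2) * (Real.exp (T * (2 * K ^ 2 * M ^ 2 + 2 * (M * K + 1))) *
      (‖ξ₁.u₀ - ξ₂.u₀‖ ^ 2 + (T * (2 * B ^ 2 * (domMeasure D).real univ *
        (‖ξ₁.V - ξ₂.V‖ ^ 2 + ‖ξ₁.α - ξ₂.α‖ ^ 2)) + ‖ξ₁.β - ξ₂.β‖ ^ 2 * ‖u₂‖ ^ 2))) := by
  have := isFiniteMeasure_domMeasure hDb
  have hM : 0 ≤ M := (norm_nonneg _).trans hα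
  obtain ⟨i₁, w₁, d₁, e₁⟩ := h₁
  obtain ⟨i₂, w₂, d₂, e₂⟩ := h₂
  obtain ⟨κ, hκ⟩ : ∃ κ, κ = 2 * B ^ 2 * (domMeasure D).real univ *
    (‖ξ₁.V - ξ₂.V‖ ^ 2 + ‖ξ₁.α - ξ₂.α‖ ^ 2) := ⟨_, rfl⟩
  have hκ0 : 0 ≤ κ := by rw [hκ]; positivity
  have ju := integrable_norm_sq u₂
  -- Here the potential is bounded uniformly in time, so the Gronwall coefficient is constant. The
  -- source term depends on time through `‖u₂ t‖²`.
  have key := norm_sq_sub_le_of_energy_inequality hT i₁ i₂ d₁ d₂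
    (m := fun _ => 2 * K ^ 2 * M ^ 2 + 2 * (M * K + 1))
    (k := fun t => κ + ‖ξ₁.β - ξ₂.β‖ ^ 2 * ‖u₂ t‖ ^ 2) (integrable_const _)
    ((integrable_const _).add (ju.const_mul _)) (fun _ => by positivity) (fun _ => by positivity) (by
      filter_upwards [e₁, e₂, Lp.coeFn_sub ξ₁.V ξ₂.V, ae_norm_le_norm ξ₁.V,
        ae_norm_le_norm (ξ₁.V - ξ₂.V), ae_ae_norm_le_norm ξ₁.α, ae_ae_norm_le_norm ξ₁.β,
        ae_ae_sub_le_norm ξ₁.α ξ₂.α, ae_ae_sub_le_norm ξ₁.β ξ₂.β, Measure.ae_ae_of_ae_prod hβ₀]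
        with t q₁ q₂ hV' hV₁ hVd hα₁ hβ₁ hαd hβd hβp
      rw [hV', Pi.sub_apply] at hVd
      have := energy_inequality1 hfB hfK (aestronglyMeasurable_section ξ₁.α t _)
        (aestronglyMeasurable_section ξ₂.α t _) (aestronglyMeasurable_section ξ₁.β t _)
        (aestronglyMeasurable_section ξ₂.β t _) (hα₁.mono fun x hx => hx.trans hα)
        (hβ₁.mono fun x hx => hx.trans hβ) hβp hαd hβd (hV₁.trans hV) hVd
        (q₁ (u₁ t - u₂ t)) (q₂ (u₁ t - u₂ t))
      rw [← hκ] at this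
      exact this)
  rw [integral_add (integrable_const _) (ju.const_mul _), integral_const_mul, ← norm_sq_eq_integral,
    integral_const_timeMeasure hT.le, integral_const_timeMeasure hT.le, hκ] at key
  exact key

set_option maxHeartbeats 1000000 in
/-- Stability for the problem with in- and outflow, in terms of the size of the second
solution. -/
theorem norm_sq_sub_le_of_isWeakSolution2 (hDb : Bornology.IsBounded D)
    [IsFiniteMeasure (surfMeasure D)] {Ct : ℝ}
    (htr : ∀ (u : H1 D) (v : Lp ℝ 2 (surfMeasure D)), IsTrace D u v →
      ‖v‖ ≤ Ct * ‖u‖) (hT : 0 < T) {f g : ℝ → ℝ} {B Bg M : ℝ} {K L : ℝ≥0}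
    (hfB : ∀ s, |f s| ≤ B) (hfK : LipschitzWith K f) (hgB : ∀ s, |g s| ≤ Bg)
    (hgL : LipschitzWith L g) (hga : Antitone g) {Γin Γout : Set (Euc N)}
    {ξ₁ ξ₂ : Data2 D Γin Γout T}
    (ha : ∀ᵐ z ∂((timeMeasure T).prod ((surfMeasure D).restrict Γin)), 0 ≤ ξ₁.a z ∧ ξ₁.a z ≤ 1)
    (hb : ∀ᵐ z ∂((timeMeasure T).prod ((surfMeasure D).restrict Γout)), 0 ≤ ξ₁.b z ∧ ξ₁.b z ≤ 1)
    (hV : ‖ξ₁.V‖ ≤ M) {u₁ u₂ : L2H1 D T} (h₁ : IsWeakSolution2 f g ξ₁ u₁)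
    (h₂ : IsWeakSolution2 f g ξ₂ u₂) :
    ‖u₁ - u₂‖ ^ 2 ≤ 2 * (T + 2) * (Real.exp (2 * K ^ 2 * M ^ 2 + T * (1 / 2)) *
      (‖ξ₁.u₀ - ξ₂.u₀‖ ^ 2 + (T * (8 * (Ct ^ 2 + 1) * Bg ^ 2 * (surfMeasure D).real univ *
        ‖ξ₁.a - ξ₂.a‖ ^ 2) + 8 * (Ct ^ 2 + 1) * Ct ^ 2 * ‖ξ₁.b - ξ₂.b‖ ^ 2 * ‖u₂‖ ^ 2
        + 2 * B ^ 2 * (domMeasure D).real univ * ‖ξ₁.V - ξ₂.V‖ ^ 2))) := by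
  have := isFiniteMeasure_domMeasure hDb
  obtain ⟨i₁, w₁, d₁, e₁⟩ := h₁
  obtain ⟨i₂, w₂, d₂, e₂⟩ := h₂
  have ju := integrable_norm_sq u₂
  have jV := integrable_norm_sq ξ₁.V
  have jd := integrable_norm_sq (ξ₁.V - ξ₂.V)
  obtain ⟨cb, hcb⟩ : ∃ c, c = 8 * (Ct ^ 2 + 1) * Ct ^ 2 * ‖ξ₁.b - ξ₂.b‖ ^ 2 := ⟨_, rfl⟩
  obtain ⟨cv, hcv⟩ : ∃ c, c = 2 * B ^ 2 * (domMeasure D).real univ := ⟨_, rfl⟩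
  obtain ⟨κ, hκ⟩ : ∃ c, c = 8 * (Ct ^ 2 + 1) * Bg ^ 2 * (surfMeasure D).real univ *
    ‖ξ₁.a - ξ₂.a‖ ^ 2 := ⟨_, rfl⟩
  have hcb0 : 0 ≤ cb := by rw [hcb]; positivity
  have hcv0 : 0 ≤ cv := by rw [hcv]; positivity
  have hκ0 : 0 ≤ κ := by rw [hκ]; positivity
  have jk1 : Integrable (fun t => κ + cb * ‖u₂ t‖ ^ 2) (timeMeasure T) :=
    (integrable_const _).add (ju.const_mul _)
  -- Here the potential is only square integrable in time, so the Gronwall coefficient is merely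
  -- integrable. The integral of its `‖V‖²` part is at most `2 K² M²`, independently of `T`.
  have key := norm_sq_sub_le_of_energy_inequality hT i₁ i₂ d₁ d₂
    (m := fun t => 2 * K ^ 2 * ‖ξ₁.V t‖ ^ 2 + 1 / 2)
    (k := fun t => κ + cb * ‖u₂ t‖ ^ 2 + cv * ‖(ξ₁.V - ξ₂.V) t‖ ^ 2)
    ((jV.const_mul _).add (integrable_const _)) (jk1.add (jd.const_mul _))
    (fun _ => by positivity) (fun _ => by positivity) (by
      filter_upwards [e₁, e₂, Lp.coeFn_sub ξ₁.V ξ₂.V, ae_ae_sub_le_norm ξ₁.a ξ₂.a,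
        ae_ae_sub_le_norm ξ₁.b ξ₂.b, Measure.ae_ae_of_ae_prod ha, Measure.ae_ae_of_ae_prod hb]
        with t q₁ q₂ hV' had hbd hap hbp
      obtain ⟨v₁, tr₁, q₁⟩ := q₁
      obtain ⟨v₂, tr₂, q₂⟩ := q₂
      -- Both equations are tested with the same pair, formed from whichever traces the weak
      -- formulations provide.
      have tr := tr₁.sub tr₂
      have := energy_inequality2 htr hfB hfK hgB hgL hga tr₁ tr₂
        (aestronglyMeasurable_section ξ₁.a t _) (aestronglyMeasurable_section ξ₂.a t _)
        (aestronglyMeasurable_section ξ₁.b t _) (aestronglyMeasurable_section ξ₂.b t _) hap hbp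
        had hbd (q₁ (u₁ t - u₂ t) (v₁ - v₂) tr) (q₂ (u₁ t - u₂ t) (v₁ - v₂) tr)
      rw [← hκ, ← hcb, ← hcv] at this
      rw [hV', Pi.sub_apply]
      exact this)
  rw [integral_add jk1 (jd.const_mul _), integral_add (integrable_const _) (ju.const_mul _),
    integral_add (jV.const_mul _) (integrable_const _), integral_const_mul, integral_const_mul,
    integral_const_mul, ← norm_sq_eq_integral, ← norm_sq_eq_integral, ← norm_sq_eq_integral,
    integral_const_timeMeasure hT.le, integral_const_timeMeasure hT.le, hκ, hcb, hcv] at key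
  refine key.trans ?_
  have hV0 : 0 ≤ ‖ξ₁.V‖ := norm_nonneg ξ₁.V
  have : ‖ξ₁.V‖ ^ 2 ≤ M ^ 2 := pow_le_pow_left₀ hV0 hV 2
  gcongr

end

/-! ### Lipschitz functionals of random data -/

section Coupling

variable {Ω X : Type*} [TopologicalSpace Ω] [PseudoMetricSpace X] {j : Ω → X} {Ψ Ψ' : Ω → ℝ}
  {G G' : Set Ω} {A : ℝ≥0}

/-- McShane's extension for the pseudometric pulled back along `j`. Its topology need not be the
given one on `Ω`, hence continuity is checked again through `j`. The extension supplies
measurability for functionals of solutions that were selected without any measurability. -/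
lemma exists_continuous_eqOn_of_lipschitz (hj : Continuous j)
    (h : ∀ ξ ∈ G, ∀ η ∈ G, |Ψ ξ - Ψ η| ≤ A * dist (j ξ) (j η)) :
    ∃ F : Ω → ℝ, Continuous F ∧ EqOn Ψ F G := by
  let m : PseudoMetricSpace Ω := PseudoMetricSpace.induced j inferInstance
  have hL : @LipschitzOnWith Ω ℝ m.toPseudoEMetricSpace _ A Ψ G := by
    let := m
    exact LipschitzOnWith.of_dist_le_mul fun ξ hξ η hη => h ξ hξ η hη
  obtain ⟨F, hF, hE⟩ := @LipschitzOnWith.extend_real Ω m Ψ G A hL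
  refine ⟨F, ?_, hE⟩
  have hd : ∀ ξ η, dist (F ξ) (F η) ≤ A * dist (j ξ) (j η) := fun ξ η =>
    @LipschitzWith.dist_le_mul Ω ℝ m _ A F hF ξ η
  refine continuous_iff_continuousAt.2 fun η => tendsto_iff_dist_tendsto_zero.2 ?_
  have h1 : Tendsto (fun ξ => A * dist (j ξ) (j η)) (𝓝 η) (𝓝 0) := by
    have := (tendsto_iff_dist_tendsto_zero.1 (hj.tendsto η)).const_mul (A : ℝ)
    rwa [mul_zero] at this
  exact squeeze_zero (fun _ => dist_nonneg) (fun ξ => hd ξ η) h1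

variable [mΩ : MeasurableSpace Ω] [BorelSpace Ω] {P P' : Measure Ω}

/-- Almost everywhere agreement with a continuous function gives measurability, and a Lipschitz
function on a bounded set of data is bounded. -/
lemma integrable_of_lipschitz [IsProbabilityMeasure P] (hj : Continuous j)
    (hG : ∀ᵐ ξ ∂P, ξ ∈ G) (hb : Bornology.IsBounded (j '' G))
    (h : ∀ ξ ∈ G, ∀ η ∈ G, |Ψ ξ - Ψ η| ≤ A * dist (j ξ) (j η)) : Integrable Ψ P := by
  obtain ⟨F, hF, hE⟩ := exists_continuous_eqOn_of_lipschitz hj h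
  obtain ⟨ξ₀, h₀⟩ := hG.exists
  obtain ⟨R, hR⟩ := Metric.isBounded_iff.1 hb
  have hm : AEStronglyMeasurable Ψ P :=
    ⟨F, hF.measurable.stronglyMeasurable, hG.mono fun ξ hξ => hE hξ⟩
  refine Integrable.of_bound hm (|Ψ ξ₀| + A * R) (hG.mono fun ξ hξ => ?_)
  have h1 := h ξ hξ ξ₀ h₀
  have h2 := hR (mem_image_of_mem j hξ) (mem_image_of_mem j h₀)
  have h3 : A * dist (j ξ) (j ξ₀) ≤ A * R := by gcongr
  have h4 := abs_sub_abs_le_abs_sub (Ψ ξ) (Ψ ξ₀)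
  rw [Real.norm_eq_abs]
  linarith

end Coupling

/-- The marginal conditions rewrite the difference of expectations as one integral over `π`, and the
`L¹` norm is at most the `L²` norm because `π` is a probability measure. The cost `c` need not be
measurable: only monotonicity of the lower integral and extraction of a finite constant are used. -/
lemma ofReal_abs_integral_sub_le_of_coupling {Ω Ω' : Type*} [MeasurableSpace Ω]
    [MeasurableSpace Ω'] {P : Measure Ω} {P' : Measure Ω'} {π : Measure (Ω × Ω')}
    (hπ : IsCoupling P P' π) {Ψ : Ω → ℝ} {Ψ' : Ω' → ℝ} (hΨ : Integrable Ψ P)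
    (hΨ' : Integrable Ψ' P') {c : Ω → Ω' → ℝ≥0∞} {q : ℝ≥0∞} (hq : q ≠ ∞) {G : Set Ω} {G' : Set Ω'}
    (hG : ∀ᵐ ξ ∂P, ξ ∈ G) (hG' : ∀ᵐ ξ ∂P', ξ ∈ G')
    (h : ∀ ξ ∈ G, ∀ η ∈ G', ENNReal.ofReal |Ψ ξ - Ψ' η| ≤ q * c ξ η) :
    ENNReal.ofReal |∫ ξ, Ψ ξ ∂P - ∫ η, Ψ' η ∂P'|
      ≤ q * (∫⁻ z, c z.1 z.2 ^ (2 : ℝ) ∂π) ^ (1 / (2 : ℝ)) := by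
  obtain ⟨_, rfl, rfl⟩ := hπ
  have i1 : Integrable (fun z : Ω × Ω' => Ψ z.1) π := hΨ.comp_measurable measurable_fst
  have i2 : Integrable (fun z : Ω × Ω' => Ψ' z.2) π := hΨ'.comp_measurable measurable_snd
  have g1 := ae_of_ae_map measurable_fst.aemeasurable hG
  have g2 := ae_of_ae_map measurable_snd.aemeasurable hG'
  rw [integral_map measurable_fst.aemeasurable hΨ.1, integral_map measurable_snd.aemeasurable hΨ'.1,
    ← integral_sub i1 i2, ← Real.norm_eq_abs, ofReal_norm]
  calc ‖∫ z, (Ψ z.1 - Ψ' z.2) ∂π‖ₑ ≤ ∫⁻ z, ‖Ψ z.1 - Ψ' z.2‖ₑ ∂π := enorm_integral_le_lintegral_enorm _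
    _ = eLpNorm (fun z : Ω × Ω' => Ψ z.1 - Ψ' z.2) 1 π := eLpNorm_one_eq_lintegral_enorm.symm
    _ ≤ eLpNorm (fun z : Ω × Ω' => Ψ z.1 - Ψ' z.2) 2 π :=
        eLpNorm_le_eLpNorm_of_exponent_le (by norm_num) (i1.sub i2).1
    _ = (∫⁻ z, ‖Ψ z.1 - Ψ' z.2‖ₑ ^ (2 : ℝ) ∂π) ^ (1 / (2 : ℝ)) := by
        rw [eLpNorm_eq_lintegral_rpow_enorm_toReal (by norm_num) (by norm_num)]; simp
    _ ≤ (∫⁻ z, q ^ (2 : ℝ) * c z.1 z.2 ^ (2 : ℝ) ∂π) ^ (1 / (2 : ℝ)) := by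
        refine ENNReal.rpow_le_rpow (lintegral_mono_ae ?_) (by norm_num)
        filter_upwards [g1, g2] with z h1 h2
        rw [← ENNReal.mul_rpow_of_nonneg _ _ (by norm_num)]
        refine ENNReal.rpow_le_rpow ?_ (by norm_num)
        rw [← ofReal_norm, Real.norm_eq_abs]
        exact h _ h1 _ h2
    _ = q * (∫⁻ z, c z.1 z.2 ^ (2 : ℝ) ∂π) ^ (1 / (2 : ℝ)) := by
        rw [lintegral_const_mul' _ _ (ENNReal.rpow_ne_top_of_nonneg (by norm_num) hq),
          ENNReal.mul_rpow_of_nonneg _ _ (by norm_num), ← ENNReal.rpow_mul]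
        norm_num

/-- Expectations of two functions which are jointly Lipschitz for the cost `c` differ by at most
the Lipschitz constant times the nested distance. -/
theorem ofReal_abs_integral_sub_le_nestedDist {Ω Ω' : Type*} [mΩ : MeasurableSpace Ω]
    [mΩ' : MeasurableSpace Ω'] {P : Measure Ω} {P' : Measure Ω'} [IsProbabilityMeasure P]
    [IsProbabilityMeasure P'] {Ψ : Ω → ℝ} {Ψ' : Ω' → ℝ} (hΨ : Integrable Ψ P)
    (hΨ' : Integrable Ψ' P') {c : Ω → Ω' → ℝ≥0∞} {q : ℝ≥0∞} (hq : q ≠ ∞) {G : Set Ω} {G' : Set Ω'}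
    (hG : ∀ᵐ ξ ∂P, ξ ∈ G) (hG' : ∀ᵐ ξ ∂P', ξ ∈ G')
    (h : ∀ ξ ∈ G, ∀ η ∈ G', ENNReal.ofReal |Ψ ξ - Ψ' η| ≤ q * c ξ η) (T : ℝ)
    (F : Filtration ℝ mΩ) (F' : Filtration ℝ mΩ') :
    ENNReal.ofReal |∫ ξ, Ψ ξ ∂P - ∫ η, Ψ' η ∂P'| ≤ q * nestedDist c 2 T P F P' F' := by
  -- For `q = 0` division is impossible, and the right-hand side is zero even when the nested
  -- distance is infinite. In this case both functions equal one common constant almost surely.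
  rcases eq_or_ne q 0 with rfl | hq0
  · obtain ⟨ξ₀, h₀⟩ := hG.exists
    obtain ⟨η₀, h₀'⟩ := hG'.exists
    have heq : ∀ ξ ∈ G, ∀ η ∈ G', Ψ ξ = Ψ' η := fun ξ hξ η hη => by
      have := h ξ hξ η hη
      rw [zero_mul, nonpos_iff_eq_zero, ENNReal.ofReal_eq_zero] at this
      exact sub_eq_zero.1 (abs_nonpos_iff.1 this)
    rw [integral_congr_ae (hG.mono fun ξ hξ => heq ξ hξ η₀ h₀'),
      integral_congr_ae (hG'.mono fun η hη => ((heq ξ₀ h₀ η hη).symm.trans (heq ξ₀ h₀ η₀ h₀')))]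
    simp
  -- The factor `q` and the square root are moved to the left so that the infimum stands alone. The
  -- claim is then checked for each nested coupling.
  · rw [mul_comm, ← ENNReal.div_le_iff hq0 hq, nestedDist, one_div, ENNReal.le_rpow_inv_iff two_pos]
    refine le_iInf₂ fun π hπ => ?_
    rw [← ENNReal.le_rpow_inv_iff two_pos, ENNReal.div_le_iff hq0 hq, mul_comm, ← one_div]
    exact ofReal_abs_integral_sub_le_of_coupling hπ.coupling hΨ hΨ' hq hG hG' h

/-! ### Stability for admissible data -/

section

variable {N : ℕ} {D : Set (Euc N)} {T : ℝ}

lemma norm_sq_le_of_mem_unitInterval (hDb : Bornology.IsBounded D) {u₀ : Lp ℝ 2 (domMeasure D)}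
    (h : ∀ᵐ x ∂(domMeasure D), 0 ≤ u₀ x ∧ u₀ x ≤ 1) : ‖u₀‖ ^ 2 ≤ (domMeasure D).real univ := by
  have := isFiniteMeasure_domMeasure hDb
  rw [norm_sq_eq_integral]
  refine (integral_mono_ae (integrable_norm_sq u₀) (integrable_const (1 : ℝ)) ?_).trans (by simp)
  filter_upwards [h] with x hx
  rw [Real.norm_eq_abs, sq_abs]
  nlinarith [hx.1, hx.2]

lemma norm_le_of_ae_norm_le {X : Type*} [MeasurableSpace X] {μ : Measure X} [IsFiniteMeasure μ]
    {h : Lp ℝ ∞ μ} {c : ℝ} (hc : 0 ≤ c) (hh : ∀ᵐ x ∂μ, ‖h x‖ ≤ c) : ‖h‖ ≤ c := by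
  simpa using Lp.norm_le_of_ae_bound hc hh

lemma one_le_exp_and_add_two_le {T : ℝ} (hT : 0 < T) :
    1 ≤ Real.exp T ∧ T ≤ Real.exp T ∧ T + 2 ≤ 2 * Real.exp T := by
  have := Real.add_one_le_exp T
  exact ⟨by linarith, by linarith, by linarith⟩

/-- From a bound of the energy type to an exponential stability bound. -/
lemma stability_of_energy_bounds {T G E c₀ c₁ c₂ c₃ X Y d p : ℝ} (hT : 0 < T)
    (hE : Real.exp T ≤ E) (hG : 0 ≤ G) (h₀ : 0 ≤ c₀)
    (h₁ : 0 ≤ c₁) (h₂ : 0 ≤ c₂) (h₃ : 0 ≤ c₃) (hd : 0 ≤ d) (hp : p ≤ G * E)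
    (hp0 : 0 ≤ p) (hY : Y ≤ 2 * (T + 2) * (p * (c₀ + T * c₁)))
    (h : X ^ 2 ≤ 2 * (T + 2) * (p * (d ^ 2 + (T * (c₁ * d ^ 2) + c₂ * d ^ 2 * Y + c₃ * d ^ 2)))) :
    X ≤ Real.sqrt (4 * G * (1 + c₁ + c₂ * (4 * G * (c₀ + c₁)) + c₃)) * E ^ 3 * d := by
  obtain ⟨e1, e2, e3⟩ := one_le_exp_and_add_two_le hT
  have hE1 : 1 ≤ E := e1.trans hE
  have hTE : T ≤ E := e2.trans hE
  have q1 : 2 * (T + 2) ≤ 4 * E := by linarith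
  have q2 : 2 * (T + 2) * p ≤ 4 * G * E ^ 2 := by
    calc 2 * (T + 2) * p ≤ 4 * E * (G * E) := by gcongr
      _ = _ := by ring
  have r1 : c₀ + T * c₁ ≤ (c₀ + c₁) * E := by nlinarith
  have hY' : Y ≤ 4 * G * (c₀ + c₁) * E ^ 3 := by
    calc Y ≤ 2 * (T + 2) * p * (c₀ + T * c₁) := by linarith
      _ ≤ 4 * G * E ^ 2 * ((c₀ + c₁) * E) := by gcongr
      _ = _ := by ring
  have E3 : E ≤ E ^ 3 := le_self_pow₀ hE1 (by norm_num)
  have E4 : 1 ≤ E ^ 3 := one_le_pow₀ hE1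
  -- The powers of `E` are collected as follows: two from `2 (T + 2) p` and three from the bracket
  -- through the bound for `Y`. Rounding five up to six gives the square root `E ^ 3`.
  have E5 : E ^ 5 ≤ E ^ 6 := pow_le_pow_right₀ hE1 (by norm_num)
  have r2 : d ^ 2 + (T * (c₁ * d ^ 2) + c₂ * d ^ 2 * Y + c₃ * d ^ 2)
      ≤ (1 + c₁ + c₂ * (4 * G * (c₀ + c₁)) + c₃) * E ^ 3 * d ^ 2 := by
    have s1 : d ^ 2 ≤ E ^ 3 * d ^ 2 := le_mul_of_one_le_left (by positivity) E4
    have s2 : T * (c₁ * d ^ 2) ≤ E ^ 3 * (c₁ * d ^ 2) := by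
      have := hTE.trans E3
      gcongr
    have s3 : c₂ * d ^ 2 * Y ≤ c₂ * d ^ 2 * (4 * G * (c₀ + c₁) * E ^ 3) := by gcongr
    have s4 : c₃ * d ^ 2 ≤ c₃ * (E ^ 3 * d ^ 2) := by gcongr
    linarith
  have key : X ^ 2 ≤ 4 * G * (1 + c₁ + c₂ * (4 * G * (c₀ + c₁)) + c₃) * E ^ 6 * d ^ 2 := by
    calc X ^ 2 ≤ 2 * (T + 2) * p * (d ^ 2 + (T * (c₁ * d ^ 2) + c₂ * d ^ 2 * Y + c₃ * d ^ 2)) := by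
          linarith
      _ ≤ 2 * (T + 2) * p * ((1 + c₁ + c₂ * (4 * G * (c₀ + c₁)) + c₃) * E ^ 3 * d ^ 2) := by gcongr
      _ ≤ 4 * G * E ^ 2 * ((1 + c₁ + c₂ * (4 * G * (c₀ + c₁)) + c₃) * E ^ 3 * d ^ 2) := by gcongr
      _ = 4 * G * (1 + c₁ + c₂ * (4 * G * (c₀ + c₁)) + c₃) * d ^ 2 * E ^ 5 := by ring
      _ ≤ 4 * G * (1 + c₁ + c₂ * (4 * G * (c₀ + c₁)) + c₃) * d ^ 2 * E ^ 6 := by gcongr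
      _ = _ := by ring
  refine abs_le_of_sq_le_sq' ?_ (by positivity) |>.2
  rw [mul_pow, mul_pow, Real.sq_sqrt (by positivity)]
  calc X ^ 2 ≤ _ := key
    _ = _ := by ring

set_option maxHeartbeats 1000000 in
/-- Weak solutions of the problem with reaction terms depend Lipschitz continuously on admissible
data. -/
theorem exists_stability1 (hDb : Bornology.IsBounded D) {f : ℝ → ℝ} (hf : IsMobility f) (M : ℝ) :
    ∃ C > 0, ∃ C' > 0, ∀ T > 0, ∀ ξ η : Data1 D T, Admissible1 M ξ → Admissible1 M η →
      ∀ u v : L2H1 D T, IsWeakSolution1 f ξ u → IsWeakSolution1 f η v →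
      ‖u - v‖ ≤ C * Real.exp (C' * T / 2) *
        (‖ξ.α - η.α‖ + ‖ξ.β - η.β‖ + ‖ξ.V - η.V‖ + ‖ξ.u₀ - η.u₀‖) := by
  obtain ⟨B, hB⟩ := hf.bounded
  obtain ⟨K, hK⟩ := hf.lipschitz
  obtain ⟨μ, hμ⟩ : ∃ μ, μ = (domMeasure D).real univ := ⟨_, rfl⟩
  have hμ0 : 0 ≤ μ := hμ ▸ measureReal_nonneg
  -- The constants are fixed before any admissible datum is at hand, so the sign of `M` is not yet
  -- known; `|M|` guarantees `0 ≤ c`.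
  obtain ⟨c, hc⟩ : ∃ c, c = 2 * (K : ℝ) ^ 2 * M ^ 2 + 2 * (|M| * K + 1) := ⟨_, rfl⟩
  have hc0 : 0 ≤ c := by rw [hc]; positivity
  obtain ⟨k, hk⟩ : ∃ k, k = 2 * (2 * B ^ 2 * μ) := ⟨_, rfl⟩
  have hk0 : 0 ≤ k := by rw [hk]; positivity
  -- The choice corresponds to `G = 1`, `c₀ = μ`, `c₁ = k`, `c₂ = 1`, `c₃ = 0` and `E = exp ((1 + c)
  -- T)`, which dominates both `exp T` and `exp (T c)`. The exponent `6 (1 + c) T / 2` is that of `E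
  -- ^ 3`.
  refine ⟨Real.sqrt (4 * 1 * (1 + k + 1 * (4 * 1 * (μ + k)) + 0)), Real.sqrt_pos.2 (by positivity),
    6 * (1 + c), by positivity, fun T hT ξ η hξ hη u v hu hv => ?_⟩
  have hM : |M| = M := abs_of_nonneg ((norm_nonneg _).trans hξ.α_le)
  have hβ : ∀ {ζ : Data1 D T}, Admissible1 M ζ →
      ∀ᵐ z ∂((timeMeasure T).prod (domMeasure D)), 0 ≤ ζ.β z := fun hζ => by
    obtain ⟨β₀, h0, h⟩ := hζ.β_pos
    exact h.mono fun z hz => h0.le.trans hz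
  -- Comparison with the zero solution bounds `‖v‖²`, the quantity left over on the right-hand side
  -- of `huv`.
  have hv2 := norm_sq_sub_le_of_isWeakSolution1 hDb hT hB hK (hβ hη) hη.α_le hη.β_le hη.V_le hv
    (isWeakSolution1_zero hf.zero η)
  have huv := norm_sq_sub_le_of_isWeakSolution1 hDb hT hB hK (hβ hξ) hξ.α_le hξ.β_le hξ.V_le hu hv
  have hη0 := norm_sq_le_of_mem_unitInterval hDb hη.u₀_mem
  simp only [sub_self, Lp.norm_zero, sub_zero] at hv2
  rw [← hμ] at hv2 huv hη0
  obtain ⟨xα, hα⟩ : ∃ x, x = ‖ξ.α - η.α‖ := ⟨_, rfl⟩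
  obtain ⟨xβ, hβ'⟩ : ∃ x, x = ‖ξ.β - η.β‖ := ⟨_, rfl⟩
  obtain ⟨xV, hV⟩ : ∃ x, x = ‖ξ.V - η.V‖ := ⟨_, rfl⟩
  obtain ⟨xu, hu₀⟩ : ∃ x, x = ‖ξ.u₀ - η.u₀‖ := ⟨_, rfl⟩
  have a1 : 0 ≤ xα := hα ▸ norm_nonneg _
  have a2 : 0 ≤ xβ := hβ' ▸ norm_nonneg _
  have a3 : 0 ≤ xV := hV ▸ norm_nonneg (ξ.V - η.V)
  have a4 : 0 ≤ xu := hu₀ ▸ norm_nonneg _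
  rw [← hα, ← hβ', ← hV, ← hu₀] at huv ⊢
  have hexp : Real.exp (T * (2 * K ^ 2 * M ^ 2 + 2 * (M * K + 1))) = Real.exp (T * c) := by
    rw [hc, hM]
  rw [hexp] at hv2 huv
  obtain ⟨d, hd⟩ : ∃ d, d = xα + xβ + xV + xu := ⟨_, rfl⟩
  have b1 : xα ^ 2 ≤ d ^ 2 := by gcongr; linarith
  have b2 : xβ ^ 2 ≤ d ^ 2 := by gcongr; linarith
  have b3 : xV ^ 2 ≤ d ^ 2 := by gcongr; linarith
  have b4 : xu ^ 2 ≤ d ^ 2 := by gcongr; linarith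
  have hE3 : Real.exp (6 * (1 + c) * T / 2) = Real.exp ((1 + c) * T) ^ 3 := by
    rw [← Real.exp_nat_mul]; congr 1; push_cast; ring
  rw [← hd, hE3]
  refine stability_of_energy_bounds hT (p := Real.exp (T * c)) (Y := ‖v‖ ^ 2) ?_ zero_le_one hμ0
    hk0 zero_le_one le_rfl (by rw [hd]; positivity) ?_ (Real.exp_pos _).le ?_ ?_
  · exact Real.exp_le_exp.2 (by nlinarith)
  · rw [one_mul]; exact Real.exp_le_exp.2 (by nlinarith)
  · refine hv2.trans ?_
    have : ‖η.u₀‖ ^ 2 + (T * (2 * B ^ 2 * μ * (0 ^ 2 + 0 ^ 2)) + 0 ^ 2 * 0 ^ 2) ≤ μ + T * k := by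
      have : 0 ≤ T * k := by positivity
      linarith
    gcongr
  · refine huv.trans ?_
    have t1 : 2 * B ^ 2 * μ * (xV ^ 2 + xα ^ 2) ≤ k * d ^ 2 := by
      rw [hk]
      calc 2 * B ^ 2 * μ * (xV ^ 2 + xα ^ 2) ≤ 2 * B ^ 2 * μ * (d ^ 2 + d ^ 2) := by gcongr
        _ = _ := by ring
    rw [one_mul, zero_mul, add_zero]
    gcongr

set_option maxHeartbeats 1000000 in
/-- Weak solutions of the problem with in- and outflow depend Lipschitz continuously on admissible
data. -/
theorem exists_stability2 (hDo : IsOpen D) (hDb : Bornology.IsBounded D) (hDL : IsLipschitzDomain D)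
    {f g : ℝ → ℝ} (hf : IsMobility f) (hg : IsInflowLimiter g) (M : ℝ) (Γin Γout : Set (Euc N)) :
    ∃ C > 0, ∃ C' > 0, ∀ T > 0, ∀ ξ η : Data2 D Γin Γout T, Admissible2 M ξ → Admissible2 M η →
      ∀ u v : L2H1 D T, IsWeakSolution2 f g ξ u → IsWeakSolution2 f g η v →
      ‖u - v‖ ≤ C * Real.exp (C' * T / 2) *
        (‖ξ.a - η.a‖ + ‖ξ.b - η.b‖ + ‖ξ.V - η.V‖ + ‖ξ.u₀ - η.u₀‖) := by
  have := isFiniteMeasure_surfMeasure hDo hDb hDL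
  obtain ⟨Ct, -, htr⟩ := exists_norm_trace_le hDo hDb hDL
  obtain ⟨B, hB⟩ := hf.bounded
  obtain ⟨K, hK⟩ := hf.lipschitz
  obtain ⟨Bg, hBg⟩ := hg.bounded
  obtain ⟨L, hL⟩ := hg.lipschitz
  obtain ⟨μ, hμ⟩ : ∃ μ, μ = (domMeasure D).real univ := ⟨_, rfl⟩
  have hμ0 : 0 ≤ μ := hμ ▸ measureReal_nonneg
  obtain ⟨σ, hσ⟩ : ∃ μ, μ = (surfMeasure D).real univ := ⟨_, rfl⟩
  have hσ0 : 0 ≤ σ := hσ ▸ measureReal_nonneg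
  obtain ⟨ka, hka⟩ : ∃ k, k = 8 * (Ct ^ 2 + 1) * Bg ^ 2 * σ := ⟨_, rfl⟩
  obtain ⟨kb, hkb⟩ : ∃ k, k = 8 * (Ct ^ 2 + 1) * Ct ^ 2 := ⟨_, rfl⟩
  obtain ⟨kV, hkV⟩ : ∃ k, k = 2 * B ^ 2 * μ := ⟨_, rfl⟩
  have ka0 : 0 ≤ ka := by rw [hka]; positivity
  have kb0 : 0 ≤ kb := by rw [hkb]; positivity
  have kV0 : 0 ≤ kV := by rw [hkV]; positivity
  -- The part of the Gronwall exponent that does not grow with `T` goes into the prefactor. This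
  -- allows `E = exp T` and the absolute constant `6` in the exponent.
  obtain ⟨G, hG⟩ : ∃ G, G = Real.exp (2 * K ^ 2 * M ^ 2) := ⟨_, rfl⟩
  have hG0 : 0 < G := by rw [hG]; positivity
  refine ⟨Real.sqrt (4 * G * (1 + ka + kb * (4 * G * (μ + ka)) + kV)),
    Real.sqrt_pos.2 (by positivity), 6, by norm_num, fun T hT ξ η hξ hη u v hu hv => ?_⟩
  have ha : ∀ {ζ : Data2 D Γin Γout T}, Admissible2 M ζ →
      ∀ᵐ z ∂((timeMeasure T).prod ((surfMeasure D).restrict Γin)), 0 ≤ ζ.a z ∧ ζ.a z ≤ 1 :=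
    fun hζ => by
      obtain ⟨a₀, h0, h⟩ := hζ.a_mem
      exact h.mono fun z hz => ⟨h0.le.trans hz.1, hz.2⟩
  have hb : ∀ {ζ : Data2 D Γin Γout T}, Admissible2 M ζ →
      ∀ᵐ z ∂((timeMeasure T).prod ((surfMeasure D).restrict Γout)), 0 ≤ ζ.b z ∧ ζ.b z ≤ 1 :=
    fun hζ => by
      obtain ⟨a₀, h0, h⟩ := hζ.b_mem
      exact h.mono fun z hz => ⟨h0.le.trans hz.1, hz.2⟩
  -- In the comparison with zero the inflow rate itself is the distance of the rates, so its bound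
  -- by one enters the a priori estimate.
  have ha1 : ‖η.a‖ ≤ 1 := norm_le_of_ae_norm_le zero_le_one ((ha hη).mono fun z hz => by
    rw [Real.norm_eq_abs, abs_of_nonneg hz.1]; exact hz.2)
  have hv2 := norm_sq_sub_le_of_isWeakSolution2 hDb htr hT hB hK hBg hL hg.antitone (ha hη) (hb hη)
    hη.V_le hv (isWeakSolution2_zero hf.zero η)
  have huv := norm_sq_sub_le_of_isWeakSolution2 hDb htr hT hB hK hBg hL hg.antitone (ha hξ) (hb hξ)
    hξ.V_le hu hv
  have hη0 := norm_sq_le_of_mem_unitInterval hDb hη.u₀_mem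
  simp only [sub_self, Lp.norm_zero, sub_zero] at hv2
  rw [← hμ, ← hσ, ← hka, ← hkb, ← hkV] at hv2 huv
  rw [← hμ] at hη0
  obtain ⟨xα, hα⟩ : ∃ x, x = ‖ξ.a - η.a‖ := ⟨_, rfl⟩
  obtain ⟨xβ, hβ'⟩ : ∃ x, x = ‖ξ.b - η.b‖ := ⟨_, rfl⟩
  obtain ⟨xV, hV⟩ : ∃ x, x = ‖ξ.V - η.V‖ := ⟨_, rfl⟩
  obtain ⟨xu, hu₀⟩ : ∃ x, x = ‖ξ.u₀ - η.u₀‖ := ⟨_, rfl⟩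
  have a1 : 0 ≤ xα := hα ▸ norm_nonneg _
  have a2 : 0 ≤ xβ := hβ' ▸ norm_nonneg _
  have a3 : 0 ≤ xV := hV ▸ norm_nonneg (ξ.V - η.V)
  have a4 : 0 ≤ xu := hu₀ ▸ norm_nonneg _
  rw [← hα, ← hβ', ← hV, ← hu₀] at huv ⊢
  obtain ⟨d, hd⟩ : ∃ d, d = xα + xβ + xV + xu := ⟨_, rfl⟩
  have b1 : xα ^ 2 ≤ d ^ 2 := by gcongr; linarith
  have b2 : xβ ^ 2 ≤ d ^ 2 := by gcongr; linarith
  have b3 : xV ^ 2 ≤ d ^ 2 := by gcongr; linarith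
  have b4 : xu ^ 2 ≤ d ^ 2 := by gcongr; linarith
  have hE3 : Real.exp (6 * T / 2) = Real.exp T ^ 3 := by
    rw [← Real.exp_nat_mul]; congr 1; push_cast; ring
  rw [← hd, hE3]
  have hp : Real.exp (2 * K ^ 2 * M ^ 2 + T * (1 / 2)) ≤ G * Real.exp T := by
    rw [hG, ← Real.exp_add]; exact Real.exp_le_exp.2 (by linarith)
  refine stability_of_energy_bounds hT (p := Real.exp (2 * K ^ 2 * M ^ 2 + T * (1 / 2)))
    (Y := ‖v‖ ^ 2) le_rfl hG0.le hμ0 ka0 kb0 kV0 (by rw [hd]; positivity) hp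
    (Real.exp_pos _).le ?_ ?_
  · refine hv2.trans ?_
    have h1 : ‖η.a‖ ^ 2 ≤ 1 := pow_le_one₀ (norm_nonneg _) ha1
    have h2 : ka * ‖η.a‖ ^ 2 ≤ ka * 1 := by gcongr
    have : ‖η.u₀‖ ^ 2 + (T * (ka * ‖η.a‖ ^ 2) + kb * 0 ^ 2 * 0 ^ 2 + kV * 0 ^ 2) ≤ μ + T * ka := by
      have : T * (ka * ‖η.a‖ ^ 2) ≤ T * (ka * 1) := by gcongr
      linarith
    gcongr
  · refine huv.trans ?_
    gcongr

end

/-! ### Gluing -/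

/-- The distance of data is a sum of four norms, whereas the product carries the maximum. The factor
four enters only the proof of integrability, not the final constant. -/
lemma add_add_add_norm_le {E₁ E₂ E₃ E₄ : Type*} [NormedAddCommGroup E₁] [NormedAddCommGroup E₂]
    [NormedAddCommGroup E₃] [NormedAddCommGroup E₄] (x y : E₁ × E₂ × E₃ × E₄) :
    ‖x.1 - y.1‖ + ‖x.2.1 - y.2.1‖ + ‖x.2.2.1 - y.2.2.1‖ + ‖x.2.2.2 - y.2.2.2‖ ≤ 4 * dist x y := by
  rw [dist_eq_norm]
  have h1 := norm_fst_le (x - y)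
  have h2 := norm_snd_le (x - y)
  have h3 := norm_fst_le (x - y).2
  have h4 := norm_snd_le (x - y).2
  have h5 := norm_fst_le (x - y).2.2
  have h6 := norm_snd_le (x - y).2.2
  simp only [Prod.fst_sub, Prod.snd_sub] at *
  linarith

lemma ofReal_add_add_add_norm {E₁ E₂ E₃ E₄ : Type*} [NormedAddCommGroup E₁] [NormedAddCommGroup E₂]
    [NormedAddCommGroup E₃] [NormedAddCommGroup E₄] (x : E₁ × E₂ × E₃ × E₄) :
    ENNReal.ofReal (‖x.1‖ + ‖x.2.1‖ + ‖x.2.2.1‖ + ‖x.2.2.2‖)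
      = ‖x.1‖ₑ + ‖x.2.1‖ₑ + ‖x.2.2.1‖ₑ + ‖x.2.2.2‖ₑ := by
  rw [ENNReal.ofReal_add (by positivity) (by positivity),
    ENNReal.ofReal_add (by positivity) (by positivity),
    ENNReal.ofReal_add (by positivity) (by positivity), ofReal_norm, ofReal_norm, ofReal_norm,
    ofReal_norm]

lemma isBounded_prod_of_norm_le {E₁ E₂ E₃ E₄ : Type*} [NormedAddCommGroup E₁]
    [NormedAddCommGroup E₂] [NormedAddCommGroup E₃] [NormedAddCommGroup E₄]
    {s : Set (E₁ × E₂ × E₃ × E₄)} {R : ℝ}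
    (h : ∀ x ∈ s, ‖x.1‖ ≤ R ∧ ‖x.2.1‖ ≤ R ∧ ‖x.2.2.1‖ ≤ R ∧ ‖x.2.2.2‖ ≤ R) :
    Bornology.IsBounded s := by
  refine isBounded_iff_forall_norm_le.2 ⟨R, fun x hx => ?_⟩
  obtain ⟨h1, h2, h3, h4⟩ := h x hx
  exact max_le h1 (max_le h2 (max_le h3 h4))

/-- If solutions depend Lipschitz continuously on data in a product of four normed spaces, then the
expectations of a Lipschitz functional of the solution under two laws of the data differ by at most
a multiple of the nested distance of these laws. -/
theorem gluing_of_stability {E₁ E₂ E₃ E₄ H Ω : Type*} [NormedAddCommGroup E₁]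
    [NormedAddCommGroup E₂] [NormedAddCommGroup E₃] [NormedAddCommGroup E₄] [NormedAddCommGroup H]
    [TopologicalSpace Ω] [mΩ : MeasurableSpace Ω] [BorelSpace Ω] {j₁ : Ω → E₁} {j₂ : Ω → E₂}
    {j₃ : Ω → E₃} {j₄ : Ω → E₄} (hj : Continuous fun ξ => (j₁ ξ, j₂ ξ, j₃ ξ, j₄ ξ))
    {c : Ω → Ω → ℝ≥0∞}
    (hc : ∀ ξ η, c ξ η = ‖j₁ ξ - j₁ η‖ₑ + ‖j₂ ξ - j₂ η‖ₑ + ‖j₃ ξ - j₃ η‖ₑ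
      + ‖j₄ ξ - j₄ η‖ₑ)
    {P P' : Measure Ω} [IsProbabilityMeasure P] [IsProbabilityMeasure P'] {Adm : Ω → Prop}
    {Sol : Ω → H → Prop} {Z : Set H} (hZ : ∀ ξ u, Sol ξ u → u ∈ Z) {C m : ℝ} (hC : 0 ≤ C)
    (hm : 1 ≤ m)
    (hst : ∀ ξ η, Adm ξ → Adm η → ∀ u v, Sol ξ u → Sol η v → ‖u - v‖ ≤ C *
      (‖j₁ ξ - j₁ η‖ + ‖j₂ ξ - j₂ η‖ + ‖j₃ ξ - j₃ η‖ + ‖j₄ ξ - j₄ η‖))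
    {R : ℝ} (hR : ∀ ξ, Adm ξ → ‖j₁ ξ‖ ≤ R ∧ ‖j₂ ξ‖ ≤ R ∧ ‖j₃ ξ‖ ≤ R ∧
      ‖j₄ ξ‖ ≤ R)
    (hP : ∀ᵐ ξ ∂P, Adm ξ) (hP' : ∀ᵐ ξ ∂P', Adm ξ) {S S' : Ω → H} (hS : ∀ᵐ ξ ∂P, Sol ξ (S ξ))
    (hS' : ∀ᵐ ξ ∂P', Sol ξ (S' ξ)) {Φ : H → ℝ} {L : ℝ≥0} (hΦ : LipschitzOnWith L Φ Z) (T : ℝ)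
    (F F' : Filtration ℝ mΩ) :
    Integrable (fun ξ => Φ (S ξ)) P ∧ Integrable (fun ξ => Φ (S' ξ)) P' ∧
      ENNReal.ofReal |∫ ξ, Φ (S ξ) ∂P - ∫ ξ, Φ (S' ξ) ∂P'| ≤
        ENNReal.ofReal (L * C * m) * nestedDist c 2 T P F P' F' := by
  have key : ∀ ξ η, Adm ξ → Adm η → ∀ u v, Sol ξ u → Sol η v → |Φ u - Φ v| ≤ L * C *
      (‖j₁ ξ - j₁ η‖ + ‖j₂ ξ - j₂ η‖ + ‖j₃ ξ - j₃ η‖ + ‖j₄ ξ - j₄ η‖) := by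
    intro ξ η hξ hη u v hu hv
    have h1 := hΦ.dist_le_mul u (hZ _ _ hu) v (hZ _ _ hv)
    rw [Real.dist_eq, dist_eq_norm] at h1
    refine h1.trans ?_
    rw [mul_assoc]
    exact mul_le_mul_of_nonneg_left (hst ξ η hξ hη u v hu hv) L.2
  have hint : ∀ (Q : Measure Ω) [IsProbabilityMeasure Q] (U : Ω → H), (∀ᵐ ξ ∂Q, Adm ξ) →
      (∀ᵐ ξ ∂Q, Sol ξ (U ξ)) → Integrable (fun ξ => Φ (U ξ)) Q := by
    intro Q _ U hQ hU
    refine integrable_of_lipschitz (G := {ξ | Adm ξ ∧ Sol ξ (U ξ)}) (A := L * C.toNNReal * 4) hj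
      (hQ.and hU) (isBounded_prod_of_norm_le (R := R) ?_) fun ξ hξ η hη => ?_
    · rintro _ ⟨ξ, hξ, rfl⟩
      exact hR ξ hξ.1
    · refine (key ξ η hξ.1 hη.1 _ _ hξ.2 hη.2).trans ?_
      refine (mul_le_mul_of_nonneg_left (add_add_add_norm_le (j₁ ξ, j₂ ξ, j₃ ξ, j₄ ξ)
        (j₁ η, j₂ η, j₃ η, j₄ η)) (mul_nonneg L.2 hC)).trans (le_of_eq ?_)
      rw [NNReal.coe_mul, NNReal.coe_mul, Real.coe_toNNReal C hC, NNReal.coe_ofNat,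
        NNReal.val_eq_coe]
      ring
  refine ⟨hint P S hP hS, hint P' S' hP' hS',
    ofReal_abs_integral_sub_le_nestedDist (G := {ξ | Adm ξ ∧ Sol ξ (S ξ)})
      (G' := {ξ | Adm ξ ∧ Sol ξ (S' ξ)}) (hint P S hP hS) (hint P' S' hP' hS')
      ENNReal.ofReal_ne_top (hP.and hS) (hP'.and hS') (fun ξ hξ η hη => ?_) T F F'⟩
  rw [hc, ← ofReal_add_add_add_norm (j₁ ξ - j₁ η, j₂ ξ - j₂ η, j₃ ξ - j₃ η, j₄ ξ - j₄ η),
    ← ENNReal.ofReal_mul (by positivity)]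
  refine ENNReal.ofReal_le_ofReal ((key ξ η hξ.1 hη.1 _ _ hξ.2 hη.2).trans ?_)
  -- Any factor `m ≥ 1` can be inserted here; it is later taken to be the maximum in the theorem.
  have : L * C ≤ L * C * m := le_mul_of_one_le_right (by positivity) hm
  gcongr

lemma IsWeakSolution1.mem_solutionSpace {N : ℕ} {D : Set (Euc N)} {T : ℝ} {f : ℝ → ℝ}
    {ξ : Data1 D T} {u : L2H1 D T} (h : IsWeakSolution1 f ξ u) : u ∈ solutionSpace D T := by
  obtain ⟨-, w, hw, -⟩ := h
  exact ⟨w, hw⟩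

lemma IsWeakSolution2.mem_solutionSpace {N : ℕ} {D Γin Γout : Set (Euc N)} {T : ℝ} {f g : ℝ → ℝ}
    {ξ : Data2 D Γin Γout T} {u : L2H1 D T} (h : IsWeakSolution2 f g ξ u) :
    u ∈ solutionSpace D T := by
  obtain ⟨-, w, hw, -⟩ := h
  exact ⟨w, hw⟩

/-- One common radius for all four components. The initial value is bounded through its square, by
`x ≤ x² + 1`. -/
lemma Admissible1.norms_le {N : ℕ} {D : Set (Euc N)} (hDb : Bornology.IsBounded D) {T M : ℝ}
    {ξ : Data1 D T} (h : Admissible1 M ξ) :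
    ‖ξ.α‖ ≤ |M| + ((domMeasure D).real univ + 1) ∧ ‖ξ.β‖ ≤ |M| + ((domMeasure D).real univ + 1) ∧
      ‖ξ.V‖ ≤ |M| + ((domMeasure D).real univ + 1) ∧
      ‖ξ.u₀‖ ≤ |M| + ((domMeasure D).real univ + 1) := by
  have h0 := norm_sq_le_of_mem_unitInterval hDb h.u₀_mem
  have h1 : 0 ≤ (domMeasure D).real univ := measureReal_nonneg
  have h2 := le_abs_self M
  have h3 := abs_nonneg M
  refine ⟨h.α_le.trans ?_, h.β_le.trans ?_, h.V_le.trans ?_, ?_⟩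
  · linarith
  · linarith
  · linarith
  · nlinarith [sq_nonneg (‖ξ.u₀‖ - 1)]

lemma Admissible2.norms_le {N : ℕ} {D Γin Γout : Set (Euc N)} (hDb : Bornology.IsBounded D)
    [IsFiniteMeasure (surfMeasure D)] {T M : ℝ} {ξ : Data2 D Γin Γout T} (h : Admissible2 M ξ) :
    ‖ξ.a‖ ≤ |M| + ((domMeasure D).real univ + 1) ∧ ‖ξ.b‖ ≤ |M| + ((domMeasure D).real univ + 1) ∧
      ‖ξ.V‖ ≤ |M| + ((domMeasure D).real univ + 1) ∧
      ‖ξ.u₀‖ ≤ |M| + ((domMeasure D).real univ + 1) := by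
  have h0 := norm_sq_le_of_mem_unitInterval hDb h.u₀_mem
  have h1 : 0 ≤ (domMeasure D).real univ := measureReal_nonneg
  have h2 := le_abs_self M
  have h3 := abs_nonneg M
  obtain ⟨a₀, ha, ha'⟩ := h.a_mem
  obtain ⟨b₀, hb, hb'⟩ := h.b_mem
  have q1 : ‖ξ.a‖ ≤ 1 := norm_le_of_ae_norm_le zero_le_one (ha'.mono fun z hz => by
    rw [Real.norm_eq_abs, abs_of_nonneg (ha.le.trans hz.1)]; exact hz.2)
  have q2 : ‖ξ.b‖ ≤ 1 := norm_le_of_ae_norm_le zero_le_one (hb'.mono fun z hz => by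
    rw [Real.norm_eq_abs, abs_of_nonneg (hb.le.trans hz.1)]; exact hz.2)
  refine ⟨q1.trans ?_, q2.trans ?_, h.V_le.trans ?_, ?_⟩
  · linarith
  · linarith
  · linarith
  · nlinarith [sq_nonneg (‖ξ.u₀‖ - 1)]

set_option maxHeartbeats 1000000 in
/-- The gluing theorem for the problem with reaction terms. -/
theorem exists_gluing1 {N : ℕ} {D : Set (Euc N)} (hDb : Bornology.IsBounded D) {f : ℝ → ℝ}
    (hf : IsMobility f) (M : ℝ) :
    ∃ C > 0, ∃ C' > 0, ∀ T > 0, ∀ P P' : Measure (Data1 D T),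
      IsProbabilityMeasure P → IsProbabilityMeasure P' →
      (∀ᵐ ξ ∂P, Admissible1 M ξ) → (∀ᵐ ξ ∂P', Admissible1 M ξ) →
      ∀ S S' : Data1 D T → L2H1 D T,
      (∀ᵐ ξ ∂P, IsWeakSolution1 f ξ (S ξ)) → (∀ᵐ ξ ∂P', IsWeakSolution1 f ξ (S' ξ)) →
      ∀ (Φ : L2H1 D T → ℝ) (L : ℝ≥0), LipschitzOnWith L Φ (solutionSpace D T) → ∀ m : ℝ, 1 ≤ m →
      Integrable (fun ξ => Φ (S ξ)) P ∧ Integrable (fun ξ => Φ (S' ξ)) P' ∧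
      ENNReal.ofReal |∫ ξ, Φ (S ξ) ∂P - ∫ ξ, Φ (S' ξ) ∂P'| ≤
        ENNReal.ofReal (L * C * m * Real.exp (C' * T / 2)) *
          nestedDist dist1 2 T P (filtration1 D T) P' (filtration1 D T) := by
  obtain ⟨C, hC, C', hC', hst⟩ := exists_stability1 hDb hf M
  refine ⟨C, hC, C', hC', fun T hT P P' _ _ hP hP' S S' hS hS' Φ L hΦ m hm => ?_⟩
  have hj : Continuous fun ξ : Data1 D T => (ξ.α, ξ.β, ξ.V, ξ.u₀) := continuous_induced_dom
  have := gluing_of_stability hj (c := dist1) (fun _ _ => rfl) (Adm := Admissible1 M)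
    (Sol := IsWeakSolution1 f) (fun _ _ h => h.mem_solutionSpace)
    (C := C * Real.exp (C' * T / 2)) (by positivity) hm
    (hst T hT) (fun _ h => h.norms_le hDb) hP hP' hS hS' hΦ T (filtration1 D T)
    (filtration1 D T)
  rwa [show L * C * m * Real.exp (C' * T / 2) = L * (C * Real.exp (C' * T / 2)) * m by ring]

set_option maxHeartbeats 1000000 in
/-- The gluing theorem for the problem with in- and outflow. -/
theorem exists_gluing2 {N : ℕ} {D : Set (Euc N)} (hDo : IsOpen D) (hDb : Bornology.IsBounded D)
    (hDL : IsLipschitzDomain D) {f g : ℝ → ℝ} (hf : IsMobility f) (hg : IsInflowLimiter g) (M : ℝ)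
    (Γin Γout : Set (Euc N)) :
    ∃ C > 0, ∃ C' > 0, ∀ T > 0, ∀ P P' : Measure (Data2 D Γin Γout T),
      IsProbabilityMeasure P → IsProbabilityMeasure P' →
      (∀ᵐ ξ ∂P, Admissible2 M ξ) → (∀ᵐ ξ ∂P', Admissible2 M ξ) →
      ∀ S S' : Data2 D Γin Γout T → L2H1 D T,
      (∀ᵐ ξ ∂P, IsWeakSolution2 f g ξ (S ξ)) → (∀ᵐ ξ ∂P', IsWeakSolution2 f g ξ (S' ξ)) →
      ∀ (Φ : L2H1 D T → ℝ) (L : ℝ≥0), LipschitzOnWith L Φ (solutionSpace D T) → ∀ m : ℝ, 1 ≤ m →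
      Integrable (fun ξ => Φ (S ξ)) P ∧ Integrable (fun ξ => Φ (S' ξ)) P' ∧
      ENNReal.ofReal |∫ ξ, Φ (S ξ) ∂P - ∫ ξ, Φ (S' ξ) ∂P'| ≤
        ENNReal.ofReal (L * C * m * Real.exp (C' * T / 2)) *
          nestedDist dist2 2 T P (filtration2 D Γin Γout T) P' (filtration2 D Γin Γout T) := by
  have := isFiniteMeasure_surfMeasure hDo hDb hDL
  obtain ⟨C, hC, C', hC', hst⟩ := exists_stability2 hDo hDb hDL hf hg M Γin Γout
  refine ⟨C, hC, C', hC', fun T hT P P' _ _ hP hP' S S' hS hS' Φ L hΦ m hm => ?_⟩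
  have hj : Continuous fun ξ : Data2 D Γin Γout T => (ξ.a, ξ.b, ξ.V, ξ.u₀) :=
    continuous_induced_dom
  have := gluing_of_stability hj (c := dist2) (fun _ _ => rfl) (Adm := Admissible2 M)
    (Sol := IsWeakSolution2 f g) (fun _ _ h => h.mem_solutionSpace)
    (C := C * Real.exp (C' * T / 2)) (by positivity) hm
    (hst T hT) (fun _ h => h.norms_le hDb) hP hP' hS hS' hΦ T (filtration2 D Γin Γout T)
    (filtration2 D Γin Γout T)
  rwa [show L * C * m * Real.exp (C' * T / 2) = L * (C * Real.exp (C' * T / 2)) * m by ring]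

end DriftDiffusion

end

/-! ### The gluing theorem for both problems. -/

open DriftDiffusion in
theorem theorem4p5 {N : ℕ} (hN : 1 ≤ N) (hN' : N ≤ 3) (D : Set (Euc N)) (hDo : IsOpen D)
    (hDb : Bornology.IsBounded D) (hDL : IsLipschitzDomain D) (f : ℝ → ℝ) (hf : IsMobility f)
    (M : ℝ) :
    (∃ C > 0, ∃ C' > 0, ∀ T > 0, ∀ P P' : Measure (Data1 D T),
      IsProbabilityMeasure P → IsProbabilityMeasure P' →
      (∀ᵐ ξ ∂P, Admissible1 M ξ) → (∀ᵐ ξ ∂P', Admissible1 M ξ) →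
      ∀ S S' : Data1 D T → L2H1 D T,
      (∀ᵐ ξ ∂P, IsWeakSolution1 f ξ (S ξ)) → (∀ᵐ ξ ∂P', IsWeakSolution1 f ξ (S' ξ)) →
      ∀ (Φ : L2H1 D T → ℝ) (L : ℝ≥0), LipschitzOnWith L Φ (solutionSpace D T) →
      ∀ r CH : ℝ, 1 ≤ r → 0 < CH →
      CondWassersteinHolder segDist1 r CH T P (filtration1 D T) P' (filtration1 D T) →
      Integrable (fun ξ => Φ (S ξ)) P ∧ Integrable (fun ξ => Φ (S' ξ)) P' ∧
      ENNReal.ofReal |∫ ξ, Φ (S ξ) ∂P - ∫ ξ, Φ (S' ξ) ∂P'| ≤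
        ENNReal.ofReal (L * C * max 1 (Real.sqrt (CH * T)) * Real.exp (C' * T / 2)) *
          nestedDist dist1 2 T P (filtration1 D T) P' (filtration1 D T)) ∧
    (∀ Γin Γout : Set (Euc N), (∃ U, IsOpen U ∧ Γin = U ∩ frontier D) →
      (∃ U, IsOpen U ∧ Γout = U ∩ frontier D) → Disjoint Γin Γout → Γout.Nonempty →
      ∀ g : ℝ → ℝ, IsInflowLimiter g →
      ∃ C > 0, ∃ C' > 0, ∀ T > 0, ∀ P P' : Measure (Data2 D Γin Γout T),
      IsProbabilityMeasure P → IsProbabilityMeasure P' →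
      (∀ᵐ ξ ∂P, Admissible2 M ξ) → (∀ᵐ ξ ∂P', Admissible2 M ξ) →
      ∀ S S' : Data2 D Γin Γout T → L2H1 D T,
      (∀ᵐ ξ ∂P, IsWeakSolution2 f g ξ (S ξ)) → (∀ᵐ ξ ∂P', IsWeakSolution2 f g ξ (S' ξ)) →
      ∀ (Φ : L2H1 D T → ℝ) (L : ℝ≥0), LipschitzOnWith L Φ (solutionSpace D T) →
      ∀ r CH : ℝ, 1 ≤ r → 0 < CH →
      CondWassersteinHolder segDist2 r CH T P (filtration2 D Γin Γout T) P'
        (filtration2 D Γin Γout T) →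
      Integrable (fun ξ => Φ (S ξ)) P ∧ Integrable (fun ξ => Φ (S' ξ)) P' ∧
      ENNReal.ofReal |∫ ξ, Φ (S ξ) ∂P - ∫ ξ, Φ (S' ξ) ∂P'| ≤
        ENNReal.ofReal (L * C * max 1 (Real.sqrt (CH * T)) * Real.exp (C' * T / 2)) *
          nestedDist dist2 2 T P (filtration2 D Γin Γout T) P' (filtration2 D Γin Γout T)) := by
  refine ⟨?_, fun Γin Γout _ _ _ _ g hg => ?_⟩
  · obtain ⟨C, hC, C', hC', h⟩ := exists_gluing1 hDb hf M
    exact ⟨C, hC, C', hC', fun T hT P P' p p' hP hP' S S' hS hS' Φ L hΦ _ _ _ _ _ =>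
      h T hT P P' p p' hP hP' S S' hS hS' Φ L hΦ _ (le_max_left _ _)⟩
  · obtain ⟨C, hC, C', hC', h⟩ := exists_gluing2 hDo hDb hDL hf hg M Γin Γout
    exact ⟨C, hC, C', hC', fun T hT P P' p p' hP hP' S S' hS hS' Φ L hΦ _ _ _ _ _ =>
      h T hT P P' p p' hP hP' S S' hS hS' Φ L hΦ _ (le_max_left _ _)⟩
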